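/- Let $\mathbb O$ be either the open unit disk $\mathbb D$, with boundary $\partial\mathbb O=\mathbb T$, or the open upper half plane $\mathbb U=\{\mathrm{Im}\,z>0\}$, with boundary $\partial\mathbb O=\mathbb R\cup\{\infty\}$. Let $\alpha_0=0$ (disk) or $\alpha_0=i$ (half plane). For $a\in\mathbb O$ put $\varpi_a(z)=1-\overline a z$ (disk) or $\varpi_a(z)=z-\overline a$ (half plane), $z_a=-|a|/a$ (disk) or $z_a=|1+a^2|/(1+a^2)$ (half plane), with $z_{\alpha_0}=1$, and $\zeta_a(z)=z_a\,(z-a)/\varpi_a(z)$. Let $(\alpha_n)_{n\ge1}$ be a sequence in $\mathbb O$ and $(\gamma_n)_{n\ge0}$ a sequence in $\mathbb D$; write $\zeta_n,\varpi_n,z_n$ for $\zeta_{\alpha_n},\varpi_{\alpha_n},z_{\alpha_n}$, and $\mathbb O_0=\mathbb O\setminus\{\alpha_n: n\ge 0\}$. Wall rational functions. $R_0=\gamma_0$, $S_0=1$, $R_0^*=\overline{\gamma_0}$, $S^*_0=1$, and for $n\ge1$ $$R_n=R_{n-1}+\gamma_n\zeta_nS^*_{n-1},\quad S_n=S_{n-1}+\gamma_n\zeta_nR^*_{n-1},\quad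 R^*_n=\zeta_nR^*_{n-1}+\overline{\gamma_n}S_{n-1},\quad S^*_n=\zeta_nS^*_{n-1}+\overline{\gamma_n}R_{n-1}.$$ Orthogonal rational functions. $\Phi_0=\Phi^*_0=1$ and, for $n\ge1$, with $\Lambda_n=-\overline{z_n}\gamma_{n-1}$ and $e_n=\sqrt{\frac{\varpi_n(\alpha_n)}{\varpi_{n-1}(\alpha_{n-1})}\frac1{1-|\gamma_{n-1}|^2}}$, $$\Phi_n=e_n\tfrac{\varpi_{n-1}}{\varpi_n}\left(z_n\overline{z_{n-1}}\zeta_{n-1}\Phi_{n-1}+\overline{\Lambda_n}\Phi^*_{n-1}\right),\qquad \Phi^*_n=e_n\tfrac{\varpi_{n-1}}{\varpi_n}\left(\Lambda_nz_n\overline{z_{n-1}}\zeta_{n-1}\Phi_{n-1}+\Phi^*_{n-1}\right)$$ (values at $t=\infty$ are the limits). Let $\mathfrak M$ be the set of Borel probability measures $\mu$ on $\partial\mathbb O$ whose orthonormal rational functions are the $\Phi_n$, i.e. $\int\Phi_m\overline{\Phi_n}\,d\mu=\delta_{mn}$ for all $m,n\ge0$. For a probability measure $\mu$ on $\partial\mathbb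 O$ and $z\in\mathbb O\setminus\{\alpha_0\}$ let $$F(z;\mu)=\int\frac{\zeta_0(t)+\zeta_0(z)}{\zeta_0(t)-\zeta_0(z)}\,d\mu(t),\qquad f(z;\mu)=\frac1{\zeta_0(z)}\,\frac{F(z;\mu)-1}{F(z;\mu)+1}.$$ For $z\in\mathbb O_0$ let $\varDelta(z)=\{F(z;\mu):\mu\in\mathfrak M\}$ and let the Weyl disk be $\tilde\varDelta(z)=\{f(z;\mu):\mu\in\mathfrak M\}$. A measure $\nu$ is called N-extremal if $\nu\in\mathfrak M$ and $F(z;\nu)\in\partial\varDelta(z)$ for some (equivalently, every) $z\in\mathbb O_0$. Let $d\mu^{(n)}=dm_{\alpha_n}/|\Phi_n|^2$, where $dm_a$ is $\frac{1-|a|^2}{|e^{i\theta}-a|^2}\frac{d\theta}{2\pi}$ on $\mathbb T$ (disk) or $\frac{\mathrm{Im}\,a}{|x-a|^2}\frac{dx}{\pi}$ on $\mathbb R$ (half plane). **Proposition.** Assume that the indeterminate case holds, i.e. that $\mathfrak M$ has more than one element, and that $\sum_n|\gamma_n|<\infty$. Then: 1. for every $z\in\mathbb O_0$, every limit point of the sequence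 $(R_n(z)/S_n(z))_n$ lies in the interior of $\tilde\varDelta(z)$; 2. (equivalent formulation) no limit measure of $(d\mu^{(n)})$, that is, no probability measure on $\partial\mathbb O$ that is the weak-$*$ limit of a subsequence of $(d\mu^{(n)})$, is N-extremal. -/

import Mathlib

open MeasureTheory Filter Topology

/-- The two parallel settings: the unit disk and the upper half plane. -/
inductive RSetting where
  | disk
  | halfPlane

namespace RSetting

noncomputable section

instance : MeasurableSpace (OnePoint ℂ) := borel (OnePoint ℂ)

instance : BorelSpace (OnePoint ℂ) := ⟨rfl⟩

/-- The domain `𝕆`: the open unit disk, or the open upper half plane. -/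
def dom : RSetting → Set ℂ
  | disk => {z | ‖z‖ < 1}
  | halfPlane => {z | 0 < z.im}

/-- The boundary `∂𝕆` in the extended complex plane: the unit circle, or the extended real line. -/
def bdry : RSetting → Set (OnePoint ℂ)
  | disk => (fun z : ℂ => (z : OnePoint ℂ)) '' {z | ‖z‖ = 1}
  | halfPlane => insert OnePoint.infty ((fun z : ℂ => (z : OnePoint ℂ)) '' {z | z.im = 0})

/-- The base point `α₀`: `0` for the disk, `i` for the half plane. -/
def base : RSetting → ℂ
  | disk => 0
  | halfPlane => Complex.I

/-- First homogeneous coordinate of a point of the extended plane: `z = [z : 1]`, `∞ = [1 : 0]`. -/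
def hx (t : OnePoint ℂ) : ℂ := t.elim 1 (fun z => z)

/-- Second homogeneous coordinate of a point of the extended plane. -/
def hy (t : OnePoint ℂ) : ℂ := t.elim 0 (fun _ => 1)

/-- `ϖ_a`, which at a finite point `z` is `1 - conj a * z` (disk) or `z - conj a` (half plane).
At `∞` it is the value of the corresponding linear form at `[1 : 0]`; `ϖ` and `ϖ*` enter below only
through quotients of two linear forms, which thus take the correct value (their limit) at `∞`. -/
def varpi : RSetting → ℂ → OnePoint ℂ → ℂ
  | disk, a, t => hy t - star a * hx t
  | halfPlane, a, t => hx t - star a * hy t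

/-- `ϖ*_a`, which at a finite point `z` is `z - a`. -/
def varpiStar (a : ℂ) (t : OnePoint ℂ) : ℂ := hx t - a * hy t

open Classical in
/-- The unimodular constant `z_a`, equal to `1` when `a = α₀`. -/
def zconst (s : RSetting) (a : ℂ) : ℂ :=
  if a = s.base then 1 else
    match s with
    | disk => -((‖a‖ : ℝ) : ℂ) / a
    | halfPlane => ((‖1 + a ^ 2‖ : ℝ) : ℂ) / (1 + a ^ 2)

/-- The Blaschke factor `ζ_a = z_a ϖ*_a / ϖ_a`. -/
def zeta (s : RSetting) (a : ℂ) (t : OnePoint ℂ) : ℂ :=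
  s.zconst a * (varpiStar a t / s.varpi a t)

/-- The kernel `D(t, z) = (ζ₀(t) + ζ₀(z)) / (ζ₀(t) - ζ₀(z))`. -/
def kernelD (s : RSetting) (t z : OnePoint ℂ) : ℂ :=
  (s.zeta s.base t + s.zeta s.base z) / (s.zeta s.base t - s.zeta s.base z)

/-- The Carathéodory function `F(z; dμ) = ∫ D(t, z) dμ(t)`. -/
def cFun (s : RSetting) (μ : Measure s.bdry) (z : ℂ) : ℂ :=
  ∫ t : s.bdry, s.kernelD (t : OnePoint ℂ) (z : OnePoint ℂ) ∂μ

/-- The Schur function `f(z; dμ) = ζ₀(z)⁻¹ (F(z; dμ) - 1) / (F(z; dμ) + 1)`. -/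
def sFun (s : RSetting) (μ : Measure s.bdry) (z : ℂ) : ℂ :=
  1 / s.zeta s.base (z : OnePoint ℂ) * ((s.cFun μ z - 1) / (s.cFun μ z + 1))

/-- The factor `e_{n+1} = √(ϖ_{n+1}(α_{n+1}) / ϖ_n(α_n) · 1 / (1 - |γ_n|²))`; the quotient of the
two `ϖ` is a positive number, so it is the quotient of the absolute values. -/
def eCoef (s : RSetting) (α γ : ℕ → ℂ) (n : ℕ) : ℝ :=
  √(‖s.varpi (α (n + 1)) (α (n + 1) : ℂ)‖ / ‖s.varpi (α n) (α n : ℂ)‖ * (1 / (1 - ‖γ n‖ ^ 2)))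

/-- The recurrence coefficient `Λ_{n+1}`, determined by `γ_n = -z_{n+1} Λ_{n+1}`. -/
def lam (s : RSetting) (α γ : ℕ → ℂ) (n : ℕ) : ℂ := -(star (s.zconst (α (n + 1))) * γ n)

/-- The pair `(Φ_n, Φ*_n)` generated by the sequences `α` and `γ` through
`Φ₀ = Φ*₀ = 1` and, for `n ≥ 0`,
`Φ_{n+1}  = e_{n+1} (ϖ_n / ϖ_{n+1}) (z_{n+1} conj(z_n) ζ_n Φ_n + conj(Λ_{n+1}) Φ*_n)`,
`Φ*_{n+1} = e_{n+1} (ϖ_n / ϖ_{n+1}) (Λ_{n+1} z_{n+1} conj(z_n) ζ_n Φ_n + Φ*_n)`. -/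
def orfPair (s : RSetting) (α γ : ℕ → ℂ) : ℕ → OnePoint ℂ → ℂ × ℂ
  | 0, _ => (1, 1)
  | n + 1, t =>
    let P := orfPair s α γ n t
    let c := (s.eCoef α γ n : ℂ) * (s.varpi (α n) t / s.varpi (α (n + 1)) t)
    let u := s.zconst (α (n + 1)) * star (s.zconst (α n)) * s.zeta (α n) t * P.1
    (c * (u + star (s.lam α γ n) * P.2), c * (s.lam α γ n * u + P.2))

/-- The rational function `Φ_n`. -/
def orf (s : RSetting) (α γ : ℕ → ℂ) (n : ℕ) (t : OnePoint ℂ) : ℂ := (s.orfPair α γ n t).1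

/-- The set `𝔐_α(γ)` of probability measures on `∂𝕆` whose sequence of `α`-parameters is the
infinite sequence `γ`: those for which the `Φ_n` generated by `γ` are the orthonormal rational
functions. (The recurrence makes `Φ_n` an element of `span {B₀, …, B_n}` with nonzero
coefficient of `B_n`, so what is required is orthonormality in `L²(dμ)`.) -/
def solutions (s : RSetting) (α γ : ℕ → ℂ) : Set (ProbabilityMeasure s.bdry) :=
  {μ | ∀ m n : ℕ, ∫ t : s.bdry, s.orf α γ m (t : OnePoint ℂ) * star (s.orf α γ n (t : OnePoint ℂ))
    ∂(μ : Measure s.bdry) = if m = n then 1 else 0}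

/-- The indeterminate case: `𝔐_α(γ)` has more than one measure. -/
def Indeterminate (s : RSetting) (α γ : ℕ → ℂ) : Prop := (s.solutions α γ).Nontrivial

/-- `𝕆₀`, the domain without the points `α₀, α₁, α₂, …` (here `α 0` is the base point). -/
def dom0 (s : RSetting) (α : ℕ → ℂ) : Set ℂ := s.dom \ Set.range α

/-- `Δ(z) = {F(z; dμ) : dμ ∈ 𝔐_α(γ)}`. -/
def weylC (s : RSetting) (α γ : ℕ → ℂ) (z : ℂ) : Set ℂ :=
  (fun μ : ProbabilityMeasure s.bdry => s.cFun (μ : Measure s.bdry) z) '' s.solutions α γ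

/-- The Weyl disk `Δ̃(z) = {f(z; dμ) : dμ ∈ 𝔐_α(γ)}`. -/
def weylS (s : RSetting) (α γ : ℕ → ℂ) (z : ℂ) : Set ℂ :=
  (fun μ : ProbabilityMeasure s.bdry => s.sFun (μ : Measure s.bdry) z) '' s.solutions α γ

/-- `ν` is N-extremal: it belongs to `𝔐_α(γ)` and `F(z; dν) ∈ ∂Δ(z)` for `z ∈ 𝕆₀`. This does not
depend on `z`; asking it for a single `z` makes the negation the strong assertion that
`F(z; dν) ∉ ∂Δ(z)` for every `z ∈ 𝕆₀`. -/
def NExtremal (s : RSetting) (α γ : ℕ → ℂ) (ν : ProbabilityMeasure s.bdry) : Prop :=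
  ν ∈ s.solutions α γ ∧
    ∃ z ∈ s.dom0 α, s.cFun (ν : Measure s.bdry) z ∈ frontier (s.weylC α γ z)

/-- The values at a point of `R_n`, `S_n`, `R*_n`, `S*_n`. -/
structure Wall where
  R : ℂ
  S : ℂ
  Rs : ℂ
  Ss : ℂ

/-- The Wall rational functions of the sequences `α`, `γ`, together with `R*_n` and `S*_n`. -/
def wall (s : RSetting) (α γ : ℕ → ℂ) (z : ℂ) : ℕ → Wall
  | 0 => ⟨γ 0, 1, star (γ 0), 1⟩
  | n + 1 =>
    let W := wall s α γ z n
    let ζ := s.zeta (α (n + 1)) (z : OnePoint ℂ)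
    { R := W.R + γ (n + 1) * ζ * W.Ss
      S := W.S + γ (n + 1) * ζ * W.Rs
      Rs := ζ * W.Rs + star (γ (n + 1)) * W.S
      Ss := ζ * W.Ss + star (γ (n + 1)) * W.R }

/-- The Wall rational function `R_n`. -/
def wallR (s : RSetting) (α γ : ℕ → ℂ) (n : ℕ) (z : ℂ) : ℂ := (s.wall α γ z n).R

/-- The Wall rational function `S_n`. -/
def wallS (s : RSetting) (α γ : ℕ → ℂ) (n : ℕ) (z : ℂ) : ℂ := (s.wall α γ z n).S

/-- The point `e^{iθ}` of the unit circle. -/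
def circlePt (θ : ℝ) : disk.bdry :=
  ⟨((Complex.exp (θ * Complex.I) : ℂ) : OnePoint ℂ),
    ⟨Complex.exp (θ * Complex.I), Complex.norm_exp_ofReal_mul_I θ, rfl⟩⟩

/-- The point `x` of the extended real line. -/
def realPt (x : ℝ) : halfPlane.bdry :=
  ⟨((x : ℂ) : OnePoint ℂ), Or.inr ⟨(x : ℂ), Complex.ofReal_im x, rfl⟩⟩

/-- The measure `dm_a`: on the circle `(1 - |a|²) / |e^{iθ} - a|² dθ / 2π`, on the extended real
line `Im a / |x - a|² dx / π` (with no mass at `∞`). -/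
def mMeas : (s : RSetting) → ℂ → Measure s.bdry
  | disk, a => Measure.map circlePt
      ((volume.restrict (Set.Ioc (-Real.pi) Real.pi)).withDensity fun θ : ℝ =>
        ENNReal.ofReal ((1 - ‖a‖ ^ 2) / ‖Complex.exp (θ * Complex.I) - a‖ ^ 2 / (2 * Real.pi)))
  | halfPlane, a => Measure.map realPt
      ((volume : Measure ℝ).withDensity fun x : ℝ =>
        ENNReal.ofReal (a.im / ‖(x : ℂ) - a‖ ^ 2 / Real.pi))

/-- The measure `dμ^(n) = dm_{α_n} / |Φ_n|²`. -/
def muN (s : RSetting) (α γ : ℕ → ℂ) (n : ℕ) : Measure s.bdry :=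
  (s.mMeas (α n)).withDensity fun t : s.bdry =>
    ENNReal.ofReal (1 / ‖s.orf α γ n (t : OnePoint ℂ)‖ ^ 2)

/-- `ν` is a limit measure of the sequence `(m n)`: some subsequence converges weak-* to `ν`, that
is, against every continuous function on the compact space `∂𝕆`. -/
def IsLimitMeasure (s : RSetting) (m : ℕ → Measure s.bdry) (ν : ProbabilityMeasure s.bdry) : Prop :=
  ∃ φ : ℕ → ℕ, StrictMono φ ∧ ∀ g : C(s.bdry, ℝ),
    Tendsto (fun k => ∫ t, g t ∂(m (φ k))) atTop (𝓝 (∫ t, g t ∂(ν : Measure s.bdry)))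

end

end RSetting

/-! Everything is transported to the unit disk by the coordinate `ζ₀`. The boundary becomes the
circle, Blaschke factors and Wall functions correspond exactly, and the `Φ_n` correspond up to
unimodular constants (`zeta_eq_disk`, `wall_eq_disk`, `exists_orf_ofCircle`). Put `β_n = ζ₀(α_n)`,
let `B_n` be the Blaschke product of `β₁, …, β_n`, and let `x = ζ₀(z)`.

Truncation. The Carathéodory function with Schur function `R_n/S_n` has boundary real part `ω_n /
|S_n - u R_n|²`. The probability measure with this density makes `Φ_0, …, Φ_{n+1}` orthonormal
(`orthonormal_bsMeas`), and it is `dμ^(n+1)` (`muN_succ_eq_map`). Since these `Φ_k` do not involve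
`γ_{n+1}`, that parameter may be replaced by any `w` with `|w| < 1`. The Schur value at `x` then
runs over the Möbius image `(R_n + w ζ_{n+1} S*_n) / (S_n + w ζ_{n+1} R*_n)` of the open disk. A
value lying in all these images from some index on is attained by a true solution, by weak
compactness of probability measures (`exists_circleSolutions`).

Indeterminacy gives the Blaschke condition. Two solutions agree on the span of the `Φ_k`, which is
the full space of rational functions with the prescribed poles. That space contains `(1 - conj
B_n(z) B_n(u)) / (1 - conj z u)`, so the Cauchy transforms of the solutions differ at `z` by at most
`2 |B_n(z)| / (1 - |z|)`. Distinct solutions therefore force `B_n` to stay away from `0` at some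
point, hence `∑ (1 - |β_n|²) < ∞`, hence `B_n` stays away from `0` at every point other than the
`β_n` (`summable_of_circleSolutions`, `exists_le_norm_blaschkeProd_of_summable`).

Uniform ball. A value `v` lies in the `m`-th image when `|S_m v - R_m| < |ζ_{m+1} (S*_m - R*_m v)|`.
At `v = R_n/S_n` and `m = n` the left side is `0`, and by the determinant identity the second factor
on the right is `B_n ω_n / S_n`, which is bounded below. The recurrence changes the two sides only
by the factors `ζ_k`, whose products are bounded below, and by the tail of `∑ |γ_k|`. So one radius
`δ` works for all large `n` and all `m ≥ n` (`exists_ball_wall`). The Weyl disk thus contains a ball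
of radius `δ` about each late `R_n/S_n`, and every cluster point is interior. The second assertion
follows because `R_n/S_n` is the Schur value of `dμ^(n+1)` and `F ↦ f` is a Möbius map. -/

namespace RSetting

/-! ### Blaschke factors -/

lemma varpi_disk_coe (a z : ℂ) : disk.varpi a (z : OnePoint ℂ) = 1 - star a * z := rfl

lemma zeta_disk_coe (a z : ℂ) :
    disk.zeta a (z : OnePoint ℂ) = disk.zconst a * ((z - a) / (1 - star a * z)) := by
  have h : varpiStar a (z : OnePoint ℂ) = z - a * 1 := rfl
  rw [zeta, varpi_disk_coe, h, mul_one]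

lemma zconst_base (s : RSetting) : s.zconst s.base = 1 := by simp [zconst]

lemma norm_zconst_disk (a : ℂ) : ‖disk.zconst a‖ = 1 := by
  unfold zconst
  split_ifs with h
  · simp
  · have : ‖a‖ ≠ 0 := by simpa [base] using h
    simp [this]

lemma star_zconst_disk_mul_self (a : ℂ) : star (disk.zconst a) * disk.zconst a = 1 := by
  have h := Complex.mul_conj' (disk.zconst a)
  rw [norm_zconst_disk, mul_comm] at h
  simpa using h

lemma one_sub_star_mul_ne_zero {a z : ℂ} (ha : ‖a‖ < 1) (hz : ‖z‖ ≤ 1) : 1 - star a * z ≠ 0 := by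
  intro h
  have h1 : ‖star a * z‖ = 1 := by rw [← sub_eq_zero.mp h]; simp
  rw [norm_mul, norm_star] at h1
  nlinarith [norm_nonneg a, norm_nonneg z]

lemma norm_one_sub_star_mul_sq (a z : ℂ) :
    ‖1 - star a * z‖ ^ 2 = ‖z - a‖ ^ 2 + (1 - ‖a‖ ^ 2) * (1 - ‖z‖ ^ 2) := by
  simp only [← Complex.normSq_eq_norm_sq, Complex.normSq_apply]
  simp
  ring

/-- Besides `|ζ| ≤ 1` inside and `|ζ| = 1` on the circle, this identity makes `1 - |ζ_{β_n}(z)|`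
comparable with `1 - |β_n|²`, which is how the Blaschke condition passes from one point to another.
-/
lemma one_sub_norm_zeta_sq {a z : ℂ} (ha : ‖a‖ < 1) (hz : ‖z‖ ≤ 1) :
    1 - ‖disk.zeta a (z : OnePoint ℂ)‖ ^ 2 =
      (1 - ‖a‖ ^ 2) * (1 - ‖z‖ ^ 2) / ‖1 - star a * z‖ ^ 2 := by
  have h := norm_pos_iff.mpr (one_sub_star_mul_ne_zero ha hz)
  rw [zeta_disk_coe, norm_mul, norm_zconst_disk, norm_div, one_mul, div_pow, eq_div_iff (by positivity),
    sub_mul, div_mul_cancel₀ _ (by positivity), norm_one_sub_star_mul_sq]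
  ring

lemma norm_zeta_disk_le_one {a z : ℂ} (ha : ‖a‖ < 1) (hz : ‖z‖ ≤ 1) :
    ‖disk.zeta a (z : OnePoint ℂ)‖ ≤ 1 := by
  have h := one_sub_norm_zeta_sq ha hz
  have h2 : 0 ≤ (1 - ‖a‖ ^ 2) * (1 - ‖z‖ ^ 2) / ‖1 - star a * z‖ ^ 2 := by
    have := norm_nonneg a
    have := norm_nonneg z
    apply div_nonneg (mul_nonneg _ _) (by positivity) <;> nlinarith
  nlinarith [norm_nonneg (disk.zeta a (z : OnePoint ℂ))]

lemma norm_zeta_disk_eq_one {a z : ℂ} (ha : ‖a‖ < 1) (hz : ‖z‖ = 1) :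
    ‖disk.zeta a (z : OnePoint ℂ)‖ = 1 := by
  have h := one_sub_norm_zeta_sq ha hz.le
  rw [hz] at h
  norm_num at h
  have := norm_nonneg (disk.zeta a (z : OnePoint ℂ))
  nlinarith

lemma differentiableAt_zeta_disk {a z : ℂ} (ha : ‖a‖ < 1) (hz : ‖z‖ ≤ 1) :
    DifferentiableAt ℂ (fun z : ℂ => disk.zeta a (z : OnePoint ℂ)) z := by
  have h := one_sub_star_mul_ne_zero ha hz
  simp only [zeta_disk_coe]
  fun_prop (disch := exact h)

/-! ### Wall rational functions -/

/-- The Blaschke product `ζ₁ ⋯ ζ_n`. -/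
noncomputable def blaschkeProd (s : RSetting) (α : ℕ → ℂ) (n : ℕ) (z : ℂ) : ℂ :=
  ∏ k ∈ Finset.range n, s.zeta (α (k + 1)) (z : OnePoint ℂ)

/-- The product `(1 - |γ₀|²) ⋯ (1 - |γ_n|²)`. -/
noncomputable def omega (γ : ℕ → ℂ) (n : ℕ) : ℝ := ∏ k ∈ Finset.range (n + 1), (1 - ‖γ k‖ ^ 2)

lemma blaschkeProd_succ (s : RSetting) (α : ℕ → ℂ) (n : ℕ) (z : ℂ) :
    s.blaschkeProd α (n + 1) z = s.blaschkeProd α n z * s.zeta (α (n + 1)) (z : OnePoint ℂ) :=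
  Finset.prod_range_succ _ _

lemma omega_succ (γ : ℕ → ℂ) (n : ℕ) : omega γ (n + 1) = omega γ n * (1 - ‖γ (n + 1)‖ ^ 2) :=
  Finset.prod_range_succ _ _

lemma omega_pos {γ : ℕ → ℂ} (hγ : ∀ n, ‖γ n‖ < 1) (n : ℕ) : 0 < omega γ n :=
  Finset.prod_pos fun k _ => by nlinarith [hγ k, norm_nonneg (γ k)]

/-- Each step of the recurrence multiplies the 2×2 determinant by `ζ_{n+1} (1 - |γ_{n+1}|²)`. -/
lemma wall_det (s : RSetting) (α γ : ℕ → ℂ) (z : ℂ) (n : ℕ) :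
    (s.wall α γ z n).S * (s.wall α γ z n).Ss - (s.wall α γ z n).R * (s.wall α γ z n).Rs =
      s.blaschkeProd α n z * omega γ n := by
  induction n with
  | zero =>
    have := Complex.mul_conj' (γ 0)
    simp [wall, blaschkeProd, omega, this]
  | succ n ih =>
    rw [blaschkeProd_succ, omega_succ]
    have := Complex.mul_conj' (γ (n + 1))
    rw [← Complex.star_def] at this
    simp only [wall]
    push_cast
    rw [← this]
    linear_combination (s.zeta (α (n + 1)) (z : OnePoint ℂ)) * (1 - γ (n + 1) * star (γ (n + 1))) * ih

/-- The matrix with rows `(1, g)` and `(conj g, 1)` is a similarity of the indefinite form `|y|² -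
|x|²`. -/
lemma norm_mobius_sub (g x y : ℂ) :
    ‖star g * x + y‖ ^ 2 - ‖x + g * y‖ ^ 2 = (1 - ‖g‖ ^ 2) * (‖y‖ ^ 2 - ‖x‖ ^ 2) := by
  simp only [← Complex.normSq_eq_norm_sq, Complex.normSq_apply]
  simp
  ring

/-- The Wall matrix is a product of similarities of the form `|y|² - |x|²` and of multiplications of
the first coordinate by some `ζ_k`, which can only increase the form since `|ζ_k| ≤ 1`. The newest
factor acts first, so the induction must allow arbitrary `x` and `y`. -/
lemma wall_contractive {s : RSetting} {α γ : ℕ → ℂ} {z : ℂ} (hγ : ∀ n, ‖γ n‖ < 1)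
    (hζ : ∀ n, ‖s.zeta (α n) (z : OnePoint ℂ)‖ ≤ 1) (n : ℕ) (x y : ℂ) :
    omega γ n * (‖y‖ ^ 2 - ‖x‖ ^ 2) ≤
      ‖(s.wall α γ z n).Rs * x + (s.wall α γ z n).S * y‖ ^ 2 -
        ‖(s.wall α γ z n).Ss * x + (s.wall α γ z n).R * y‖ ^ 2 := by
  induction n generalizing x y with
  | zero => simpa [wall, omega] using (norm_mobius_sub (γ 0) x y).ge
  | succ n ih =>
    set ζ := s.zeta (α (n + 1)) (z : OnePoint ℂ) with hζdef
    set g := γ (n + 1) with hg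
    have h := ih (ζ * (x + g * y)) (star g * x + y)
    have h1 : (s.wall α γ z (n + 1)).Rs * x + (s.wall α γ z (n + 1)).S * y =
        (s.wall α γ z n).Rs * (ζ * (x + g * y)) + (s.wall α γ z n).S * (star g * x + y) := by
      simp only [wall]; ring
    have h2 : (s.wall α γ z (n + 1)).Ss * x + (s.wall α γ z (n + 1)).R * y =
        (s.wall α γ z n).Ss * (ζ * (x + g * y)) + (s.wall α γ z n).R * (star g * x + y) := by
      simp only [wall]; ring
    rw [h1, h2]
    refine le_trans ?_ h
    rw [omega_succ, mul_assoc, ← norm_mobius_sub, norm_mul, mul_pow]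
    refine mul_le_mul_of_nonneg_left ?_ (omega_pos hγ n).le
    have := hζ (n + 1)
    have h3 : ‖ζ‖ ^ 2 ≤ 1 := by rw [hζdef]; nlinarith [norm_nonneg (s.zeta (α (n + 1)) (z : OnePoint ℂ))]
    nlinarith [sq_nonneg ‖x + g * y‖]

lemma omega_le_wall {s : RSetting} {α γ : ℕ → ℂ} {z : ℂ} (hγ : ∀ n, ‖γ n‖ < 1)
    (hζ : ∀ n, ‖s.zeta (α n) (z : OnePoint ℂ)‖ ≤ 1) (n : ℕ) :
    omega γ n ≤ ‖(s.wall α γ z n).S‖ ^ 2 - ‖(s.wall α γ z n).R‖ ^ 2 := by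
  simpa using wall_contractive hγ hζ n 0 1

lemma wall_norm_lt {s : RSetting} {α γ : ℕ → ℂ} {z : ℂ} (hγ : ∀ n, ‖γ n‖ < 1)
    (hζ : ∀ n, ‖s.zeta (α n) (z : OnePoint ℂ)‖ ≤ 1) (n : ℕ) :
    ‖(s.wall α γ z n).R‖ < ‖(s.wall α γ z n).S‖ := by
  have := omega_le_wall hγ hζ n
  have := omega_pos hγ n
  exact lt_of_pow_lt_pow_left₀ 2 (norm_nonneg _) (by linarith)

/-- Where all `|ζ_k| = 1`, conjugation exchanges the starred and unstarred recurrences up to `B_n`;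
the unimodularity of `B_n` is carried along for the induction. -/
lemma wall_reflect {s : RSetting} {α γ : ℕ → ℂ} {z : ℂ}
    (hζ : ∀ n, ‖s.zeta (α n) (z : OnePoint ℂ)‖ = 1) (n : ℕ) :
    (s.wall α γ z n).Rs = s.blaschkeProd α n z * star (s.wall α γ z n).R ∧
      (s.wall α γ z n).Ss = s.blaschkeProd α n z * star (s.wall α γ z n).S ∧
      s.blaschkeProd α n z * star (s.blaschkeProd α n z) = 1 := by
  induction n with
  | zero => simp [wall, blaschkeProd]
  | succ n ih =>
    obtain ⟨h1, h2, h3⟩ := ih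
    have h4 := Complex.mul_conj' (s.zeta (α (n + 1)) (z : OnePoint ℂ))
    rw [hζ, ← Complex.star_def] at h4
    norm_num at h4
    rw [blaschkeProd_succ]
    set ζ := s.zeta (α (n + 1)) (z : OnePoint ℂ)
    set B := s.blaschkeProd α n z
    set g := γ (n + 1) with hg
    have h4 : ζ * star ζ = 1 := by simpa using h4
    simp only [wall]
    rw [h1, h2]
    simp only [star_add, star_mul', star_star]
    rw [← hg]
    refine ⟨?_, ?_, ?_⟩
    · linear_combination (-(B * star B * star g * (s.wall α γ z n).S) ) * h4 - star g * (s.wall α γ z n).S * h3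
    · linear_combination (-(B * star B * star g * (s.wall α γ z n).R) ) * h4 - star g * (s.wall α γ z n).R * h3
    · linear_combination B * star B * h4 + h3

/-- The reflection formulas turn the determinant into `B_n (|S_n|² - |R_n|²)`, and `B_n` cancels. So
`|S_n|² - |R_n|²` is constant on the circle, and the density below has a constant numerator. -/
lemma wall_boundary {s : RSetting} {α γ : ℕ → ℂ} {z : ℂ}
    (hζ : ∀ n, ‖s.zeta (α n) (z : OnePoint ℂ)‖ = 1) (n : ℕ) :
    ‖(s.wall α γ z n).S‖ ^ 2 - ‖(s.wall α γ z n).R‖ ^ 2 = omega γ n := by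
  obtain ⟨h1, h2, h3⟩ := wall_reflect (γ := γ) hζ n
  have h := wall_det s α γ z n
  rw [h1, h2] at h
  have hS := Complex.mul_conj' (s.wall α γ z n).S
  have hR := Complex.mul_conj' (s.wall α γ z n).R
  rw [← Complex.star_def] at hS hR
  have hB : s.blaschkeProd α n z ≠ 0 := left_ne_zero_of_mul_eq_one h3
  have : ((‖(s.wall α γ z n).S‖ ^ 2 - ‖(s.wall α γ z n).R‖ ^ 2 : ℝ) : ℂ) = (omega γ n : ℂ) := by
    apply mul_left_cancel₀ hB
    push_cast
    rw [← h, ← hS, ← hR]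
    ring
  exact_mod_cast this

/-! ### Integration over the circle -/

noncomputable instance : MeasurableSpace Circle := borel Circle

instance : BorelSpace Circle := ⟨rfl⟩

/-- Normalized arc length on the circle. -/
noncomputable def arcMeas : Measure Circle :=
  Measure.map Circle.exp
    (ENNReal.ofReal (1 / (2 * Real.pi)) • (volume.restrict (Set.Ioc (-Real.pi) Real.pi)))

lemma integral_arcMeas (f : ℂ → ℂ) (hf : Continuous fun u : Circle => f u) :
    ∫ u : Circle, f u ∂arcMeas = Real.circleAverage f 0 1 := by
  have hp : (fun θ : ℝ => f (circleMap 0 1 θ)).Periodic (2 * Real.pi) := fun x => by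
    simp [periodic_circleMap 0 1 x]
  have h := hp.intervalIntegral_add_eq (-Real.pi) 0
  rw [zero_add, show -Real.pi + 2 * Real.pi = Real.pi by ring] at h
  rw [arcMeas, integral_map (by fun_prop) hf.aestronglyMeasurable, integral_smul_measure,
    Real.circleAverage_def, ← h, intervalIntegral.integral_of_le (by linarith [Real.pi_pos]),
    ENNReal.toReal_ofReal (by positivity), one_div]
  simp [circleMap]

instance : IsProbabilityMeasure arcMeas := by
  constructor
  rw [arcMeas, Measure.map_apply (by fun_prop) MeasurableSet.univ]
  simp only [Set.preimage_univ, Measure.smul_apply, Measure.restrict_apply_univ, Real.volume_Ioc,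
    smul_eq_mul]
  rw [← ENNReal.ofReal_mul (by positivity)]
  have := Real.pi_pos
  rw [show 1 / (2 * Real.pi) * (Real.pi - -Real.pi) = 1 by field_simp; ring]
  simp

lemma integrable_circle {E : Type*} [NormedAddCommGroup E] (μ : Measure Circle) [IsFiniteMeasure μ]
    {f : Circle → E} (hf : Continuous f) : Integrable f μ :=
  hf.integrable_of_hasCompactSupport (HasCompactSupport.of_compactSpace f)

lemma diffContOnCl_of_differentiableAt {f : ℂ → ℂ}
    (hf : ∀ z : ℂ, ‖z‖ ≤ 1 → DifferentiableAt ℂ f z) : DiffContOnCl ℂ f (Metric.ball 0 |1|) := by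
  apply DifferentiableOn.diffContOnCl
  rw [abs_one, closure_ball 0 one_ne_zero]
  intro z hz
  exact (hf z (by simpa using hz)).differentiableWithinAt

lemma continuous_circle_of_differentiableAt {f : ℂ → ℂ}
    (hf : ∀ z : ℂ, ‖z‖ ≤ 1 → DifferentiableAt ℂ f z) : Continuous fun u : Circle => f u := by
  rw [continuous_iff_continuousAt]
  intro u
  exact ContinuousAt.comp (hf u u.norm_coe.le).continuousAt (by fun_prop)

lemma integral_arcMeas_eq_center {f : ℂ → ℂ} (hf : ∀ z : ℂ, ‖z‖ ≤ 1 → DifferentiableAt ℂ f z) :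
    ∫ u : Circle, f u ∂arcMeas = f 0 := by
  rw [integral_arcMeas f (continuous_circle_of_differentiableAt hf)]
  exact (diffContOnCl_of_differentiableAt hf).circleAverage

lemma circle_mul_star (u : Circle) : (u : ℂ) * star (u : ℂ) = 1 := by
  rw [Complex.star_def, Complex.mul_conj', u.norm_coe]
  simp

lemma circle_sub_ne_zero {x : ℂ} (hx : ‖x‖ < 1) (u : Circle) : (u : ℂ) - x ≠ 0 := by
  intro h
  rw [sub_eq_zero] at h
  rw [← h, u.norm_coe] at hx
  exact lt_irrefl _ hx

lemma continuous_circle_kernel {x : ℂ} (hx : ‖x‖ < 1) :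
    Continuous fun u : Circle => ((u : ℂ) + x) / (u - x) :=
  Continuous.div (by fun_prop) (by fun_prop) (circle_sub_ne_zero hx)

lemma integral_arcMeas_cauchy {f : ℂ → ℂ} (hf : ∀ z : ℂ, ‖z‖ ≤ 1 → DifferentiableAt ℂ f z)
    {x : ℂ} (hx : ‖x‖ < 1) : ∫ u : Circle, (u : ℂ) / (u - x) * f u ∂arcMeas = f x := by
  have hc := continuous_circle_of_differentiableAt hf
  rw [integral_arcMeas (fun u => u / (u - x) * f u)]
  · have h := (diffContOnCl_of_differentiableAt hf).circleAverage_smul_div (w := x) (by simpa using hx)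
    simpa using h
  · exact (Continuous.div (by fun_prop) (by fun_prop) (circle_sub_ne_zero hx)).mul hc

/-- The Schwarz integral formula on the unit circle. -/
lemma integral_arcMeas_schwarz {f : ℂ → ℂ} (hf : ∀ z : ℂ, ‖z‖ ≤ 1 → DifferentiableAt ℂ f z)
    (h0 : f 0 = 1) {x : ℂ} (hx : ‖x‖ < 1) :
    ∫ u : Circle, ((u : ℂ) + x) / (u - x) * ((f u).re : ℂ) ∂arcMeas = f x := by
  have hc := continuous_circle_of_differentiableAt hf
  have hk := continuous_circle_kernel hx
  have hx1 : ∀ z : ℂ, ‖z‖ ≤ 1 → DifferentiableAt ℂ (fun t => (1 + star x * t) / (1 - star x * t) * f t) z := by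
    intro z hz
    have := one_sub_star_mul_ne_zero hx hz
    have := hf z hz
    fun_prop (disch := assumption)
  -- `(u + x)/(u - x) = 2u/(u - x) - 1`: Cauchy's formula minus the mean value `f 0 = 1`.
  have h1 : ∫ u : Circle, ((u : ℂ) + x) / (u - x) * f u ∂arcMeas = 2 * f x - 1 := by
    rw [← integral_arcMeas_cauchy hf hx, ← h0, ← integral_arcMeas_eq_center hf, ← integral_const_mul,
      ← integral_sub]
    · congr 1
      ext u
      have := circle_sub_ne_zero hx u
      field_simp
      ring
    · exact integrable_circle _ (continuous_const.mul ((Continuous.div (by fun_prop) (by fun_prop)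
        (circle_sub_ne_zero hx)).mul hc))
    · exact integrable_circle _ hc
  -- On the circle the kernel is the conjugate of `(1 + conj x u)/(1 - conj x u)`, so this is the
  -- conjugate of the mean value of a holomorphic function equal to `1` at `0`.
  have h2 : ∫ u : Circle, ((u : ℂ) + x) / (u - x) * star (f u) ∂arcMeas = 1 := by
    have h := integral_arcMeas_eq_center hx1
    simp only [mul_zero, add_zero, sub_zero, div_one, one_mul, h0] at h
    have h3 := congrArg star h
    rw [Complex.star_def, ← integral_conj, map_one] at h3
    rw [← h3]
    congr 1
    ext u
    have hu := circle_mul_star u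
    have h4 := circle_sub_ne_zero hx u
    have h5 : star (u : ℂ) ≠ 0 := right_ne_zero_of_mul_eq_one hu
    simp only [← Complex.star_def, star_mul', star_div₀, star_add, star_sub, star_one, star_star]
    congr 1
    rw [← mul_div_mul_right _ _ h5, add_mul, sub_mul, hu]
  have h3 : ∫ u : Circle, ((u : ℂ) + x) / (u - x) * ((f u).re : ℂ) ∂arcMeas =
      2⁻¹ * (∫ u : Circle, ((u : ℂ) + x) / (u - x) * f u ∂arcMeas +
        ∫ u : Circle, ((u : ℂ) + x) / (u - x) * star (f u) ∂arcMeas) := by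
    rw [← integral_add, ← integral_const_mul]
    · congr 1
      ext u
      rw [Complex.re_eq_add_conj, ← Complex.star_def]
      ring
    · exact integrable_circle _ (hk.mul hc)
    · exact integrable_circle _ (hk.mul hc.star)
  rw [h3, h1, h2]
  ring

/-! ### Orthogonal rational functions in the disk -/

section disk

variable {β γ : ℕ → ℂ}

/-- The function `Φ*_n`. -/
noncomputable def orfStar (s : RSetting) (α γ : ℕ → ℂ) (n : ℕ) (t : OnePoint ℂ) : ℂ :=
  (s.orfPair α γ n t).2

lemma orf_zero (s : RSetting) (α γ : ℕ → ℂ) (t : OnePoint ℂ) : s.orf α γ 0 t = 1 := rfl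

lemma orfStar_zero (s : RSetting) (α γ : ℕ → ℂ) (t : OnePoint ℂ) : s.orfStar α γ 0 t = 1 := rfl

lemma orf_succ (s : RSetting) (α γ : ℕ → ℂ) (n : ℕ) (t : OnePoint ℂ) :
    s.orf α γ (n + 1) t = (s.eCoef α γ n : ℂ) * (s.varpi (α n) t / s.varpi (α (n + 1)) t) *
      (s.zconst (α (n + 1)) * star (s.zconst (α n)) * s.zeta (α n) t * s.orf α γ n t +
        star (s.lam α γ n) * s.orfStar α γ n t) := rfl

lemma orfStar_succ (s : RSetting) (α γ : ℕ → ℂ) (n : ℕ) (t : OnePoint ℂ) :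
    s.orfStar α γ (n + 1) t = (s.eCoef α γ n : ℂ) * (s.varpi (α n) t / s.varpi (α (n + 1)) t) *
      (s.lam α γ n * (s.zconst (α (n + 1)) * star (s.zconst (α n)) * s.zeta (α n) t * s.orf α γ n t) +
        s.orfStar α γ n t) := rfl

/-- `Φ_n` involves only `γ_0, …, γ_{n-1}`. This leaves the next parameter free when a measure with a
prescribed Schur value is built. -/
lemma orfPair_congr (s : RSetting) (α : ℕ → ℂ) {γ γ' : ℕ → ℂ} (n : ℕ) (h : ∀ k < n, γ k = γ' k)
    (t : OnePoint ℂ) : s.orfPair α γ n t = s.orfPair α γ' n t := by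
  induction n with
  | zero => rfl
  | succ n ih =>
    have h1 := ih fun k hk => h k (by omega)
    simp only [orfPair, h1, eCoef, lam, h n (by omega)]

lemma wall_congr (s : RSetting) (α : ℕ → ℂ) {γ γ' : ℕ → ℂ} (z : ℂ) (n : ℕ)
    (h : ∀ k ≤ n, γ k = γ' k) : s.wall α γ z n = s.wall α γ' z n := by
  induction n with
  | zero => simp [wall, h 0 le_rfl]
  | succ n ih => simp only [wall, ih fun k hk => h k (by omega), h (n + 1) le_rfl]

lemma differentiableAt_orf (hβ : ∀ n, ‖β n‖ < 1) (n : ℕ) {z : ℂ} (hz : ‖z‖ ≤ 1) :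
    DifferentiableAt ℂ (fun t : ℂ => disk.orf β γ n (t : OnePoint ℂ)) z ∧
      DifferentiableAt ℂ (fun t : ℂ => disk.orfStar β γ n (t : OnePoint ℂ)) z := by
  induction n with
  | zero => simp [orf_zero, orfStar_zero]
  | succ n ih =>
    obtain ⟨h1, h2⟩ := ih
    have h3 := differentiableAt_zeta_disk (hβ n) hz
    have h4 := one_sub_star_mul_ne_zero (hβ (n + 1)) hz
    simp only [orf_succ, orfStar_succ, varpi_disk_coe]
    constructor <;> fun_prop (disch := exact h4)

/-- The normalizing factor of `Φ_{n+1}` in terms of Wall rational functions. -/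
noncomputable def normCoef (β γ : ℕ → ℂ) (n : ℕ) : ℝ := √((1 - ‖β (n + 1)‖ ^ 2) / omega γ n)

lemma norm_varpi_self {a : ℂ} (ha : ‖a‖ < 1) : ‖disk.varpi a (a : OnePoint ℂ)‖ = 1 - ‖a‖ ^ 2 := by
  rw [varpi_disk_coe, Complex.star_def, Complex.conj_mul', ← Complex.ofReal_pow, ← Complex.ofReal_one,
    ← Complex.ofReal_sub, Complex.norm_real, Real.norm_of_nonneg]
  nlinarith [norm_nonneg a]

lemma one_sub_norm_sq_pos {a : ℂ} (ha : ‖a‖ < 1) : 0 < 1 - ‖a‖ ^ 2 := by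
  nlinarith [norm_nonneg a]

lemma normCoef_zero (hβ0 : β 0 = 0) (hβ : ∀ n, ‖β n‖ < 1) : disk.eCoef β γ 0 = normCoef β γ 0 := by
  rw [eCoef, normCoef, norm_varpi_self (hβ _), norm_varpi_self (hβ _), hβ0]
  simp [omega, div_eq_mul_inv]

lemma normCoef_succ (hβ : ∀ n, ‖β n‖ < 1) (hγ : ∀ n, ‖γ n‖ < 1) (n : ℕ) :
    disk.eCoef β γ (n + 1) * normCoef β γ n = normCoef β γ (n + 1) := by
  have h1 := one_sub_norm_sq_pos (hβ (n + 1))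
  have h2 := one_sub_norm_sq_pos (hβ (n + 2))
  have h3 := one_sub_norm_sq_pos (hγ (n + 1))
  have h4 := omega_pos hγ n
  rw [eCoef, normCoef, normCoef, norm_varpi_self (hβ _), norm_varpi_self (hβ _),
    ← Real.sqrt_mul (by positivity), omega_succ]
  congr 1
  field_simp

/-- The functions `Φ_{n+1}`, `Φ*_{n+1}` in terms of the Wall rational functions. -/
lemma orf_eq_wall (hβ0 : β 0 = 0) (hβ : ∀ n, ‖β n‖ < 1) (hγ : ∀ n, ‖γ n‖ < 1) (n : ℕ) {t : ℂ}
    (ht : ‖t‖ ≤ 1) :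
    disk.orf β γ (n + 1) (t : OnePoint ℂ) = disk.zconst (β (n + 1)) * (normCoef β γ n : ℂ) /
        (1 - star (β (n + 1)) * t) * (t * (disk.wall β γ t n).Ss - (disk.wall β γ t n).Rs) ∧
      disk.orfStar β γ (n + 1) (t : OnePoint ℂ) = (normCoef β γ n : ℂ) /
        (1 - star (β (n + 1)) * t) * ((disk.wall β γ t n).S - t * (disk.wall β γ t n).R) := by
  have hz : ∀ n, star (disk.zconst (β n)) * disk.zconst (β n) = 1 :=
    fun n => star_zconst_disk_mul_self _
  induction n with
  | zero =>
    have h0 : disk.zconst 0 = 1 := disk.zconst_base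
    have h1 := hz 1
    have h2 := one_sub_star_mul_ne_zero (hβ 1) ht
    rw [orf_succ, orfStar_succ, orf_zero, orfStar_zero, normCoef_zero hβ0 hβ]
    simp only [varpi_disk_coe, hβ0, zeta_disk_coe, lam, h0, wall, zero_add, star_neg, star_mul',
      star_star, star_zero, star_one]
    constructor
    · field_simp
      ring
    · field_simp
      linear_combination (-(γ 0 * t * (normCoef β γ 0 : ℂ)) / (1 - star (β 1) * t)) * h1
  | succ n ih =>
    obtain ⟨h1, h2⟩ := ih
    have h3 := hz (n + 1)
    have h4 := hz (n + 2)
    have h5 := one_sub_star_mul_ne_zero (hβ (n + 1)) ht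
    have h6 := one_sub_star_mul_ne_zero (hβ (n + 2)) ht
    rw [orf_succ _ _ _ (n + 1), orfStar_succ _ _ _ (n + 1), h1, h2, ← normCoef_succ hβ hγ n]
    simp only [varpi_disk_coe, lam, wall, star_neg, star_mul', star_star]
    push_cast
    set ζ := disk.zeta (β (n + 1)) (t : OnePoint ℂ)
    set S := (disk.wall β γ t n).S
    set R := (disk.wall β γ t n).R
    set Ss := (disk.wall β γ t n).Ss
    set Rs := (disk.wall β γ t n).Rs
    set c := (disk.eCoef β γ (n + 1) : ℂ)
    set d := (normCoef β γ n : ℂ)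
    set y := disk.zconst (β (n + 1))
    set y' := disk.zconst (β (n + 1 + 1))
    constructor
    · field_simp
      linear_combination (c * d * y' * ζ * (t * Ss - Rs) / (1 - star (β (n + 1 + 1)) * t)) * h3
    · field_simp
      linear_combination (-(c * d * ζ * γ (n + 1) * (t * Ss - Rs) * star y' * y') /
        (1 - star (β (n + 1 + 1)) * t)) * h3 -
        (c * d * ζ * γ (n + 1) * (t * Ss - Rs) / (1 - star (β (n + 1 + 1)) * t)) * h4

/-- Lets a conjugate `conj Φ_n` under a circle integral be replaced by `conj B_n Φ*_n`; once
multiplied by a multiple of `B_n`, the integrand becomes holomorphic. -/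
lemma orf_reflect (hβ0 : β 0 = 0) (hβ : ∀ n, ‖β n‖ < 1) (hγ : ∀ n, ‖γ n‖ < 1) (n : ℕ) (u : Circle) :
    disk.orf β γ n ((u : ℂ) : OnePoint ℂ) =
      disk.blaschkeProd β n u * star (disk.orfStar β γ n ((u : ℂ) : OnePoint ℂ)) := by
  cases n with
  | zero => simp [orf_zero, orfStar_zero, blaschkeProd]
  | succ n =>
    obtain ⟨h1, h2⟩ := orf_eq_wall hβ0 hβ hγ n u.norm_coe.le
    obtain ⟨h3, h4, -⟩ := wall_reflect (γ := γ) (fun n => norm_zeta_disk_eq_one (hβ n) u.norm_coe) n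
    have hu := circle_mul_star u
    have h5 := one_sub_star_mul_ne_zero (hβ (n + 1)) u.norm_coe.le
    have h6 : 1 - β (n + 1) * star (u : ℂ) ≠ 0 := by
      have := star_ne_zero.mpr h5
      simpa [mul_comm] using this
    have h7 : (u : ℂ) - β (n + 1) = u * (1 - β (n + 1) * star (u : ℂ)) := by
      linear_combination (β (n + 1)) * hu
    rw [h1, h2, h3, h4, blaschkeProd_succ, zeta_disk_coe, h7]
    simp only [star_mul', star_div₀, star_sub, star_one, star_star]
    have h8 : star ((normCoef β γ n : ℝ) : ℂ) = normCoef β γ n := by simp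
    rw [h8]
    field_simp
    linear_combination (disk.zconst (β (n + 1)) * (normCoef β γ n : ℂ) * disk.blaschkeProd β n u *
      star (disk.wall β γ u n).R) * hu

end disk
/-! ### Bernstein–Szegő measures on the circle -/

section disk

variable {β γ : ℕ → ℂ}

lemma differentiableAt_wall (γ : ℕ → ℂ) (hβ : ∀ n, ‖β n‖ < 1) (n : ℕ) {z : ℂ} (hz : ‖z‖ ≤ 1) :
    DifferentiableAt ℂ (fun t => (disk.wall β γ t n).R) z ∧
      DifferentiableAt ℂ (fun t => (disk.wall β γ t n).S) z ∧
      DifferentiableAt ℂ (fun t => (disk.wall β γ t n).Rs) z ∧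
      DifferentiableAt ℂ (fun t => (disk.wall β γ t n).Ss) z := by
  induction n with
  | zero => simp [wall]
  | succ n ih =>
    obtain ⟨h1, h2, h3, h4⟩ := ih
    have h5 := differentiableAt_zeta_disk (hβ (n + 1)) hz
    simp only [wall]
    refine ⟨?_, ?_, ?_, ?_⟩ <;> fun_prop

lemma differentiableAt_blaschkeProd (hβ : ∀ n, ‖β n‖ < 1) (n : ℕ) {z : ℂ} (hz : ‖z‖ ≤ 1) :
    DifferentiableAt ℂ (disk.blaschkeProd β n) z := by
  induction n with
  | zero =>
    have : disk.blaschkeProd β 0 = fun _ => 1 := by ext; simp [blaschkeProd]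
    rw [this]
    fun_prop
  | succ n ih =>
    have : disk.blaschkeProd β (n + 1) =
        fun z : ℂ => disk.blaschkeProd β n z * disk.zeta (β (n + 1)) (z : OnePoint ℂ) := by
      ext z; exact blaschkeProd_succ _ _ _ _
    rw [this]
    exact ih.mul (differentiableAt_zeta_disk (hβ (n + 1)) hz)

/-- The denominator `S_n - t R_n`. -/
noncomputable def wallDen (β γ : ℕ → ℂ) (n : ℕ) (t : ℂ) : ℂ :=
  (disk.wall β γ t n).S - t * (disk.wall β γ t n).R

/-- The Carathéodory function with Schur function `R_n / S_n`. -/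
noncomputable def wallF (β γ : ℕ → ℂ) (n : ℕ) (t : ℂ) : ℂ :=
  ((disk.wall β γ t n).S + t * (disk.wall β γ t n).R) / wallDen β γ n t

/-- The density of the Bernstein–Szegő measure. -/
noncomputable def bsDensity (β γ : ℕ → ℂ) (n : ℕ) (t : ℂ) : ℝ := omega γ n / ‖wallDen β γ n t‖ ^ 2

lemma wallDen_ne_zero (hβ : ∀ n, ‖β n‖ < 1) (hγ : ∀ n, ‖γ n‖ < 1) (n : ℕ) {t : ℂ} (ht : ‖t‖ ≤ 1) :
    wallDen β γ n t ≠ 0 := by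
  have h := wall_norm_lt (s := disk) hγ (fun n => norm_zeta_disk_le_one (hβ n) ht) n
  intro h0
  rw [wallDen, sub_eq_zero] at h0
  rw [h0, norm_mul] at h
  nlinarith [norm_nonneg (disk.wall β γ t n).R]

lemma differentiableAt_wallDen (γ : ℕ → ℂ) (hβ : ∀ n, ‖β n‖ < 1) (n : ℕ) {t : ℂ} (ht : ‖t‖ ≤ 1) :
    DifferentiableAt ℂ (wallDen β γ n) t := by
  obtain ⟨h1, h2, -⟩ := differentiableAt_wall γ hβ n ht
  unfold wallDen
  fun_prop

lemma differentiableAt_wallF (hβ : ∀ n, ‖β n‖ < 1) (hγ : ∀ n, ‖γ n‖ < 1) (n : ℕ) {t : ℂ}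
    (ht : ‖t‖ ≤ 1) : DifferentiableAt ℂ (wallF β γ n) t := by
  obtain ⟨h1, h2, -⟩ := differentiableAt_wall γ hβ n ht
  have h3 := differentiableAt_wallDen γ hβ n ht
  have h4 := wallDen_ne_zero hβ hγ n ht
  unfold wallF
  fun_prop (disch := exact h4)

lemma wallF_zero (hβ : ∀ n, ‖β n‖ < 1) (hγ : ∀ n, ‖γ n‖ < 1) (n : ℕ) : wallF β γ n 0 = 1 := by
  have := wallDen_ne_zero hβ hγ n (t := 0) (by simp)
  simp only [wallF, wallDen, zero_mul, add_zero, sub_zero] at this ⊢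
  exact div_self this

lemma re_add_div_sub (a b : ℂ) : ((a + b) / (a - b)).re = (‖a‖ ^ 2 - ‖b‖ ^ 2) / ‖a - b‖ ^ 2 := by
  rw [Complex.div_re, ← add_div, ← Complex.normSq_eq_norm_sq, ← Complex.normSq_eq_norm_sq,
    ← Complex.normSq_eq_norm_sq]
  congr 1
  simp [Complex.normSq_apply]
  ring

/-- `Re ((a + b)/(a - b)) = (|a|² - |b|²)/|a - b|²`, and for `|u| = 1` the numerator `|S_n|² - |u
R_n|²` is the constant `ω_n`. -/
lemma re_wallF (hβ : ∀ n, ‖β n‖ < 1) (n : ℕ) (u : Circle) :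
    (wallF β γ n u).re = bsDensity β γ n u := by
  rw [wallF, wallDen, re_add_div_sub, norm_mul, u.norm_coe, one_mul,
    wall_boundary fun n => norm_zeta_disk_eq_one (hβ n) u.norm_coe]
  rfl

lemma continuous_bsDensity (hβ : ∀ n, ‖β n‖ < 1) (hγ : ∀ n, ‖γ n‖ < 1) (n : ℕ) :
    Continuous fun u : Circle => bsDensity β γ n u := by
  simp only [← re_wallF hβ]
  exact Complex.continuous_re.comp
    (continuous_circle_of_differentiableAt fun z hz => differentiableAt_wallF hβ hγ n hz)

lemma bsDensity_nonneg (hγ : ∀ n, ‖γ n‖ < 1) (n : ℕ) (t : ℂ) : 0 ≤ bsDensity β γ n t :=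
  div_nonneg (omega_pos hγ n).le (by positivity)

/-- The Bernstein–Szegő measure. -/
noncomputable def bsMeas (β γ : ℕ → ℂ) (n : ℕ) : Measure Circle :=
  arcMeas.withDensity fun u => ENNReal.ofReal (bsDensity β γ n u)

lemma integral_bsMeas (hβ : ∀ n, ‖β n‖ < 1) (hγ : ∀ n, ‖γ n‖ < 1) (n : ℕ) (f : Circle → ℂ) :
    ∫ u, f u ∂(bsMeas β γ n) = ∫ u, f u * ((wallF β γ n u).re : ℂ) ∂arcMeas := by
  rw [bsMeas, integral_withDensity_eq_integral_toReal_smul₀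
    (continuous_bsDensity hβ hγ n).measurable.ennreal_ofReal.aemeasurable
    (Eventually.of_forall fun _ => ENNReal.ofReal_lt_top)]
  congr 1
  ext u
  rw [ENNReal.toReal_ofReal (bsDensity_nonneg hγ n u), re_wallF hβ, Complex.real_smul, mul_comm]

lemma integral_kernel_bsMeas (hβ : ∀ n, ‖β n‖ < 1) (hγ : ∀ n, ‖γ n‖ < 1) (n : ℕ) {x : ℂ}
    (hx : ‖x‖ < 1) : ∫ u : Circle, ((u : ℂ) + x) / (u - x) ∂(bsMeas β γ n) = wallF β γ n x := by
  rw [integral_bsMeas hβ hγ]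
  exact integral_arcMeas_schwarz (fun z hz => differentiableAt_wallF hβ hγ n hz)
    (wallF_zero hβ hγ n) hx

lemma isProbabilityMeasure_bsMeas (hβ : ∀ n, ‖β n‖ < 1) (hγ : ∀ n, ‖γ n‖ < 1) (n : ℕ) :
    IsProbabilityMeasure (bsMeas β γ n) := by
  have h1 : ∫ u : Circle, wallF β γ n u ∂arcMeas = 1 := by
    rw [integral_arcMeas_eq_center fun z hz => differentiableAt_wallF hβ hγ n hz,
      wallF_zero hβ hγ]
  have h2 : ∫ u : Circle, bsDensity β γ n u ∂arcMeas = 1 := by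
    have h3 := integral_re (𝕜 := ℂ) (integrable_circle arcMeas
      (continuous_circle_of_differentiableAt fun z hz => differentiableAt_wallF hβ hγ n hz))
    rw [h1] at h3
    simpa [re_wallF hβ] using h3
  constructor
  rw [bsMeas, withDensity_apply _ MeasurableSet.univ, Measure.restrict_univ,
    ← ofReal_integral_eq_lintegral_ofReal
      (integrable_circle arcMeas (continuous_bsDensity hβ hγ n))
      (Eventually.of_forall fun u => bsDensity_nonneg hγ n u), h2]
  simp

lemma norm_blaschkeProd_circle (hβ : ∀ n, ‖β n‖ < 1) (n : ℕ) (u : Circle) :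
    disk.blaschkeProd β n u * star (disk.blaschkeProd β n u) = 1 :=
  (wall_reflect (γ := 0) (fun n => norm_zeta_disk_eq_one (hβ n) u.norm_coe) n).2.2

lemma blaschkeProd_add (s : RSetting) (α : ℕ → ℂ) (m n : ℕ) (z : ℂ) :
    s.blaschkeProd α (m + n) z = s.blaschkeProd α m z * s.blaschkeProd (fun k => α (m + k)) n z := by
  simp [blaschkeProd, Finset.prod_range_add, add_assoc]

/-- For `k ≤ n` the product `conj Φ_k B_n` is, on the circle, `Φ*_k` times the remaining Blaschke
factors. The integrand then extends holomorphically to the disk, and the factor `u` makes its mean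
value `0`. -/
lemma integral_orf_mul_blaschke (hβ0 : β 0 = 0) (hβ : ∀ n, ‖β n‖ < 1) (hγ : ∀ n, ‖γ n‖ < 1)
    {j k n : ℕ} (hkn : k ≤ n) {G : ℂ → ℂ}
    (hG : ∀ z : ℂ, ‖z‖ ≤ 1 → DifferentiableAt ℂ G z) :
    ∫ u : Circle, disk.orf β γ j ((u : ℂ) : OnePoint ℂ) *
      star (disk.orf β γ k ((u : ℂ) : OnePoint ℂ)) * (u * disk.blaschkeProd β n u * G u) ∂arcMeas = 0 := by
  obtain ⟨l, rfl⟩ := Nat.exists_eq_add_of_le hkn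
  have h := integral_arcMeas_eq_center (f := fun t : ℂ => disk.orf β γ j (t : OnePoint ℂ) *
    disk.orfStar β γ k (t : OnePoint ℂ) *
      (t * disk.blaschkeProd (fun i => β (k + i)) l t * G t)) (fun z hz => by
        have h1 := (differentiableAt_orf (γ := γ) hβ j hz).1
        have h2 := (differentiableAt_orf (γ := γ) hβ k hz).2
        have h3 := differentiableAt_blaschkeProd (fun i => hβ (k + i)) l hz
        have h4 := hG z hz
        fun_prop)
  simp only [zero_mul, mul_zero] at h
  rw [← h]
  congr 1
  ext u
  have h1 := norm_blaschkeProd_circle hβ k u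
  rw [blaschkeProd_add, orf_reflect hβ0 hβ hγ k]
  simp only [star_mul', star_star]
  linear_combination (disk.orf β γ j ((u : ℂ) : OnePoint ℂ) * disk.orfStar β γ k ((u : ℂ) : OnePoint ℂ) *
    (u * disk.blaschkeProd (fun i => β (k + i)) l u * G u)) * h1

/-- The real part is half the sum with the conjugate, and conjugating the integral exchanges `j` and
`k`; hence both indices must be at most `n`. -/
lemma integral_orf_mul_re_blaschke (hβ0 : β 0 = 0) (hβ : ∀ n, ‖β n‖ < 1) (hγ : ∀ n, ‖γ n‖ < 1)
    {j k n : ℕ} (hj : j ≤ n) (hk : k ≤ n) {G : ℂ → ℂ}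
    (hG : ∀ z : ℂ, ‖z‖ ≤ 1 → DifferentiableAt ℂ G z) :
    ∫ u : Circle, disk.orf β γ j ((u : ℂ) : OnePoint ℂ) *
      star (disk.orf β γ k ((u : ℂ) : OnePoint ℂ)) *
        ((u * disk.blaschkeProd β n u * G u : ℂ).re : ℂ) ∂arcMeas = 0 := by
  have hc : ∀ i, Continuous fun u : Circle => disk.orf β γ i ((u : ℂ) : OnePoint ℂ) := fun i =>
    continuous_circle_of_differentiableAt fun z hz => (differentiableAt_orf hβ i hz).1
  have hB : Continuous fun u : Circle => (u : ℂ) * disk.blaschkeProd β n u * G u :=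
    ((by fun_prop : Continuous fun u : Circle => (u : ℂ)).mul (continuous_circle_of_differentiableAt
      fun z hz => differentiableAt_blaschkeProd hβ n hz)).mul
      (continuous_circle_of_differentiableAt hG)
  have h1 := integral_orf_mul_blaschke hβ0 hβ hγ (j := j) hk hG
  have h2 := congrArg star (integral_orf_mul_blaschke hβ0 hβ hγ (j := k) hj hG)
  rw [Complex.star_def, ← integral_conj, map_zero] at h2
  have h3 := congrArg₂ (fun a b : ℂ => 2⁻¹ * (a + b)) h1 h2
  rw [add_zero, mul_zero] at h3
  rw [← h3]
  rw [← integral_add, ← integral_const_mul]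
  · congr 1
    ext u
    rw [Complex.re_eq_add_conj]
    simp only [← Complex.star_def, star_mul', star_star]
    ring
  · exact integrable_circle _ (((hc j).mul (hc k).star).mul hB)
  · exact integrable_circle _ (Complex.continuous_conj.comp (((hc k).mul (hc j).star).mul hB))

/-- The determinant identity makes the difference of consecutive Carathéodory functions divisible by
`t B_{n+1}`. Consequently the two densities give the same integrals of `Φ_j conj Φ_k` for `j, k ≤ n
+ 1`. -/
lemma wallF_succ_eq (hβ : ∀ n, ‖β n‖ < 1) (hγ : ∀ n, ‖γ n‖ < 1) (n : ℕ) {t : ℂ} (ht : ‖t‖ ≤ 1) :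
    wallF β γ (n + 1) t = wallF β γ n t + t * disk.blaschkeProd β (n + 1) t *
      (2 * γ (n + 1) * omega γ n / (wallDen β γ (n + 1) t * wallDen β γ n t)) := by
  have h1 := wallDen_ne_zero hβ hγ n ht
  have h2 := wallDen_ne_zero hβ hγ (n + 1) ht
  have h3 := wall_det disk β γ t n
  rw [wallF, wallF, blaschkeProd_succ]
  field_simp
  simp only [wallDen, wall]
  linear_combination (2 * t * γ (n + 1) * disk.zeta (β (n + 1)) (t : OnePoint ℂ)) * h3

/-- The numerator of `Φ_{n+1}` is `u B_n` times the conjugate of `S_n - u R_n`, which cancels half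
of the density. What remains is `u B_n` times a holomorphic function, hence orthogonal to `Φ_0, …,
Φ_n`. -/
lemma orf_succ_mul_re_wallF (hβ0 : β 0 = 0) (hβ : ∀ n, ‖β n‖ < 1) (hγ : ∀ n, ‖γ n‖ < 1) (n : ℕ)
    (u : Circle) : disk.orf β γ (n + 1) ((u : ℂ) : OnePoint ℂ) * ((wallF β γ n u).re : ℂ) =
      u * disk.blaschkeProd β n u * (disk.zconst (β (n + 1)) * (normCoef β γ n : ℂ) * omega γ n /
        ((1 - star (β (n + 1)) * u) * wallDen β γ n u)) := by
  have h1 := wallDen_ne_zero hβ hγ n u.norm_coe.le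
  have h2 := one_sub_star_mul_ne_zero (hβ (n + 1)) u.norm_coe.le
  obtain ⟨h3, h4, -⟩ := wall_reflect (γ := γ) (fun n => norm_zeta_disk_eq_one (hβ n) u.norm_coe) n
  have h5 : (u : ℂ) * (disk.wall β γ u n).Ss - (disk.wall β γ u n).Rs =
      u * disk.blaschkeProd β n u * star (wallDen β γ n u) := by
    have hu := circle_mul_star u
    rw [h3, h4, wallDen]
    simp only [star_sub, star_mul']
    linear_combination (disk.blaschkeProd β n u * star (disk.wall β γ u n).R) * hu
  have h6 : wallDen β γ n u * star (wallDen β γ n u) = (‖wallDen β γ n u‖ : ℂ) ^ 2 :=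
    Complex.mul_conj' _
  have h7 : star (wallDen β γ n u) ≠ 0 := star_ne_zero.mpr h1
  rw [(orf_eq_wall hβ0 hβ hγ n u.norm_coe.le).1, re_wallF hβ, bsDensity, h5]
  push_cast
  rw [← h6]
  field_simp

/-- The right side is the Poisson kernel of `β_{n+1}`. Its total mass `1` normalizes `Φ_{n+1}`, and
the identity also recognizes the density as that of `dm_{α_{n+1}} / |Φ_{n+1}|²`. -/
lemma norm_orf_succ_mul_re_wallF (hβ0 : β 0 = 0) (hβ : ∀ n, ‖β n‖ < 1) (hγ : ∀ n, ‖γ n‖ < 1) (n : ℕ)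
    (u : Circle) : disk.orf β γ (n + 1) ((u : ℂ) : OnePoint ℂ) *
      star (disk.orf β γ (n + 1) ((u : ℂ) : OnePoint ℂ)) * ((wallF β γ n u).re : ℂ) =
      (((1 + star (β (n + 1)) * (u : ℂ)) / (1 - star (β (n + 1)) * u)).re : ℂ) := by
  have h1 := wallDen_ne_zero hβ hγ n u.norm_coe.le
  have h2 := one_sub_star_mul_ne_zero (hβ (n + 1)) u.norm_coe.le
  have h3 := norm_blaschkeProd_circle hβ (n + 1) u
  have h4 := omega_pos hγ n
  have h5 : (normCoef β γ n) ^ 2 = (1 - ‖β (n + 1)‖ ^ 2) / omega γ n :=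
    Real.sq_sqrt (div_nonneg (one_sub_norm_sq_pos (hβ _)).le h4.le)
  rw [orf_reflect hβ0 hβ hγ, re_wallF hβ, re_add_div_sub]
  simp only [star_mul', star_star]
  have h6 : disk.orfStar β γ (n + 1) ((u : ℂ) : OnePoint ℂ) *
      star (disk.orfStar β γ (n + 1) ((u : ℂ) : OnePoint ℂ)) =
      (((normCoef β γ n) ^ 2 / ‖1 - star (β (n + 1)) * u‖ ^ 2 * ‖wallDen β γ n u‖ ^ 2 : ℝ) : ℂ) := by
    rw [Complex.star_def, Complex.mul_conj', (orf_eq_wall hβ0 hβ hγ n u.norm_coe.le).2, norm_mul,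
      norm_div, ← wallDen, ← Complex.ofReal_pow, mul_pow, div_pow, Complex.norm_real, Real.norm_eq_abs,
      sq_abs]
    rfl
  have h7 : disk.blaschkeProd β (n + 1) u * star (disk.orfStar β γ (n + 1) ((u : ℂ) : OnePoint ℂ)) *
      (star (disk.blaschkeProd β (n + 1) u) * disk.orfStar β γ (n + 1) ((u : ℂ) : OnePoint ℂ)) =
      (((normCoef β γ n) ^ 2 / ‖1 - star (β (n + 1)) * u‖ ^ 2 * ‖wallDen β γ n u‖ ^ 2 : ℝ) : ℂ) := by
    linear_combination h6 + disk.orfStar β γ (n + 1) ((u : ℂ) : OnePoint ℂ) *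
      star (disk.orfStar β γ (n + 1) ((u : ℂ) : OnePoint ℂ)) * h3
  rw [h7, bsDensity, h5, ← Complex.ofReal_mul]
  congr 1
  have h8 := norm_pos_iff.mpr h1
  have h9 := norm_pos_iff.mpr h2
  rw [norm_mul, u.norm_coe, norm_star, norm_one]
  field_simp

/-- The first rational functions are orthonormal with respect to the Bernstein–Szegő measure. -/
theorem orthonormal_bsMeas (hβ0 : β 0 = 0) (hβ : ∀ n, ‖β n‖ < 1) (hγ : ∀ n, ‖γ n‖ < 1) (n : ℕ)
    {j k : ℕ} (hj : j ≤ n + 1) (hk : k ≤ n + 1) :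
    ∫ u : Circle, disk.orf β γ j ((u : ℂ) : OnePoint ℂ) *
      star (disk.orf β γ k ((u : ℂ) : OnePoint ℂ)) ∂(bsMeas β γ n) = if j = k then 1 else 0 := by
  have hc : ∀ i, Continuous fun u : Circle => disk.orf β γ i ((u : ℂ) : OnePoint ℂ) := fun i =>
    continuous_circle_of_differentiableAt fun z hz => (differentiableAt_orf hβ i hz).1
  have htop : ∀ n, ∀ k ≤ n, ∫ u : Circle, disk.orf β γ (n + 1) ((u : ℂ) : OnePoint ℂ) *
      star (disk.orf β γ k ((u : ℂ) : OnePoint ℂ)) * ((wallF β γ n u).re : ℂ) ∂arcMeas = 0 := by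
    intro n k hk
    rw [← integral_orf_mul_blaschke hβ0 hβ hγ (j := 0) hk
      (G := fun t => disk.zconst (β (n + 1)) * (normCoef β γ n : ℂ) * omega γ n /
        ((1 - star (β (n + 1)) * t) * wallDen β γ n t))]
    · congr 1
      ext u
      rw [← orf_succ_mul_re_wallF hβ0 hβ hγ, orf_zero]
      ring
    · intro z hz
      have h1 := wallDen_ne_zero hβ hγ n hz
      have h2 := one_sub_star_mul_ne_zero (hβ (n + 1)) hz
      have h3 := differentiableAt_wallDen γ hβ n hz
      fun_prop (disch := exact mul_ne_zero h2 h1)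
  have hdiag : ∀ n, ∫ u : Circle, disk.orf β γ (n + 1) ((u : ℂ) : OnePoint ℂ) *
      star (disk.orf β γ (n + 1) ((u : ℂ) : OnePoint ℂ)) * ((wallF β γ n u).re : ℂ) ∂arcMeas = 1 := by
    intro n
    simp only [norm_orf_succ_mul_re_wallF hβ0 hβ hγ]
    have hd : ∀ z : ℂ, ‖z‖ ≤ 1 → DifferentiableAt ℂ
        (fun t => (1 + star (β (n + 1)) * t) / (1 - star (β (n + 1)) * t)) z := by
      intro z hz
      have h2 := one_sub_star_mul_ne_zero (hβ (n + 1)) hz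
      fun_prop (disch := exact h2)
    have h := integral_arcMeas_schwarz hd (by simp) (x := 0) (by simp)
    simp only [add_zero, sub_zero, mul_zero, div_one] at h
    refine Eq.trans ?_ h
    congr 1
    ext u
    have : (u : ℂ) ≠ 0 := left_ne_zero_of_mul_eq_one (circle_mul_star u)
    rw [div_self this, one_mul]
  have hcF : ∀ n, Continuous fun u : Circle => ((wallF β γ n u).re : ℂ) := fun n => by
    have := Complex.continuous_re.comp
      (continuous_circle_of_differentiableAt fun z hz => differentiableAt_wallF hβ hγ n hz)
    exact Complex.continuous_ofReal.comp this
  -- With the measure fixed, orthonormality up to `n` extends to `n + 1`. The main induction then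
  -- only has to replace measure `n` by measure `n + 1`.
  have hext : ∀ n, (∀ j ≤ n, ∀ k ≤ n, ∫ u : Circle, disk.orf β γ j ((u : ℂ) : OnePoint ℂ) *
      star (disk.orf β γ k ((u : ℂ) : OnePoint ℂ)) * ((wallF β γ n u).re : ℂ) ∂arcMeas =
        if j = k then 1 else 0) → ∀ j ≤ n + 1, ∀ k ≤ n + 1,
      ∫ u : Circle, disk.orf β γ j ((u : ℂ) : OnePoint ℂ) *
      star (disk.orf β γ k ((u : ℂ) : OnePoint ℂ)) * ((wallF β γ n u).re : ℂ) ∂arcMeas =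
        if j = k then 1 else 0 := by
    intro n h j hj k hk
    rcases Nat.le_succ_iff.mp hj with hj' | rfl <;> rcases Nat.le_succ_iff.mp hk with hk' | rfl
    · exact h j hj' k hk'
    · rw [if_neg (by omega), ← map_zero (starRingEnd ℂ), ← htop n j hj', ← integral_conj]
      congr 1
      ext u
      simp only [map_mul, Complex.conj_ofReal, ← Complex.star_def, star_star]
      ring
    · rw [if_neg (by omega), htop n k hk']
    · rw [if_pos rfl, hdiag]
  rw [integral_bsMeas hβ hγ]
  induction n generalizing j k with
  | zero =>
    refine hext 0 (fun j hj k hk => ?_) j hj k hk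
    obtain rfl : j = 0 := by omega
    obtain rfl : k = 0 := by omega
    have h := integral_arcMeas_schwarz (fun z hz => differentiableAt_wallF hβ hγ 0 hz)
      (wallF_zero hβ hγ 0) (x := 0) (by simp)
    rw [wallF_zero hβ hγ] at h
    rw [if_pos rfl, ← h]
    congr 1
    ext u
    simp [orf_zero]
  | succ n ih =>
    refine hext (n + 1) (fun j hj k hk => ?_) j hj k hk
    have hd : ∀ z : ℂ, ‖z‖ ≤ 1 → DifferentiableAt ℂ
        (fun t => 2 * γ (n + 1) * omega γ n / (wallDen β γ (n + 1) t * wallDen β γ n t)) z := by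
      intro z hz
      have h1 := mul_ne_zero (wallDen_ne_zero hβ hγ (n + 1) hz) (wallDen_ne_zero hβ hγ n hz)
      have h2 := differentiableAt_wallDen γ hβ n hz
      have h3 := differentiableAt_wallDen γ hβ (n + 1) hz
      fun_prop (disch := exact h1)
    rw [← ih hj hk, ← sub_eq_zero, ← integral_sub,
      ← integral_orf_mul_re_blaschke hβ0 hβ hγ hj hk hd]
    · congr 1
      ext u
      rw [wallF_succ_eq hβ hγ n u.norm_coe.le, Complex.add_re]
      push_cast
      ring
    · exact integrable_circle _ (((hc j).mul (hc k).star).mul (hcF _))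
    · exact integrable_circle _ (((hc j).mul (hc k).star).mul (hcF _))

end disk
/-! ### Infinite products and the Wall recurrence -/

/-- The partial products decrease to the infinite product, which is nonzero because the series
converges and no factor vanishes. -/
lemma exists_pos_le_prod_one_sub {x : ℕ → ℝ} (h0 : ∀ n, 0 ≤ x n) (h1 : ∀ n, x n < 1)
    (hx : Summable x) : ∃ p > 0, ∀ n, p ≤ ∏ k ∈ Finset.range n, (1 - x k) := by
  have hm : Multipliable fun n => 1 + -x n := by
    apply multipliable_one_add_of_summable
    simpa using hx.abs
  have hne : ∏' n, (1 + -x n) ≠ 0 := by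
    apply tprod_one_add_ne_zero_of_summable
    · intro n; linarith [h1 n]
    · simpa using hx.abs
  have ht := hm.hasProd.tendsto_prod_nat
  have hanti : Antitone fun n => ∏ k ∈ Finset.range n, (1 + -x k) := by
    apply antitone_nat_of_succ_le
    intro n
    rw [Finset.prod_range_succ]
    apply mul_le_of_le_one_right
    · exact Finset.prod_nonneg fun k _ => by linarith [h1 k]
    · linarith [h0 n]
  have hle := hanti.le_of_tendsto ht
  have hnn : 0 ≤ ∏' n, (1 + -x n) := ge_of_tendsto' ht fun n =>
    Finset.prod_nonneg fun k _ => by linarith [h1 k]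
  exact ⟨_, lt_of_le_of_ne hnn hne.symm, fun n => by simpa [sub_eq_add_neg] using hle n⟩

/-- From `1 - x ≤ exp (-x)`, the partial sums are at most `-log p`. -/
lemma summable_of_le_prod_one_sub {x : ℕ → ℝ} (h0 : ∀ n, 0 ≤ x n) (h1 : ∀ n, x n ≤ 1) {p : ℝ}
    (hp : 0 < p) (h : ∀ n, p ≤ ∏ k ∈ Finset.range n, (1 - x k)) : Summable x := by
  apply summable_of_sum_range_le (c := -Real.log p) h0
  intro n
  have h2 : ∏ k ∈ Finset.range n, (1 - x k) ≤ Real.exp (-∑ k ∈ Finset.range n, x k) := by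
    rw [← Finset.sum_neg_distrib, Real.exp_sum]
    exact Finset.prod_le_prod (fun k _ => by linarith [h1 k]) fun k _ => Real.one_sub_le_exp_neg _
  have h3 := Real.log_le_log hp ((h n).trans h2)
  rw [Real.log_exp] at h3
  linarith

lemma wall_norm_le {s : RSetting} {α γ : ℕ → ℂ} {z : ℂ}
    (hζ : ∀ n, ‖s.zeta (α n) (z : OnePoint ℂ)‖ ≤ 1) (n : ℕ) :
    ‖(s.wall α γ z n).R‖ ≤ ∏ k ∈ Finset.range (n + 1), (1 + ‖γ k‖) ∧
      ‖(s.wall α γ z n).S‖ ≤ ∏ k ∈ Finset.range (n + 1), (1 + ‖γ k‖) ∧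
      ‖(s.wall α γ z n).Rs‖ ≤ ∏ k ∈ Finset.range (n + 1), (1 + ‖γ k‖) ∧
      ‖(s.wall α γ z n).Ss‖ ≤ ∏ k ∈ Finset.range (n + 1), (1 + ‖γ k‖) := by
  have key : ∀ (a b c d : ℂ) (P : ℝ), ‖c‖ ≤ 1 → ‖a‖ ≤ P → ‖b‖ ≤ P → ‖c * a + d * b‖ ≤ P * (1 + ‖d‖) := by
    intro a b c d P hc ha hb
    calc ‖c * a + d * b‖ ≤ ‖c‖ * ‖a‖ + ‖d‖ * ‖b‖ := by
          simpa using norm_add_le (c * a) (d * b)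
      _ ≤ 1 * P + ‖d‖ * P := by gcongr
      _ = P * (1 + ‖d‖) := by ring
  induction n with
  | zero =>
    simp [wall]
  | succ n ih =>
    obtain ⟨h1, h2, h3, h4⟩ := ih
    have hz := hζ (n + 1)
    simp only [wall]
    rw [Finset.prod_range_succ]
    set P := ∏ k ∈ Finset.range (n + 1), (1 + ‖γ k‖)
    have hm : ∀ w : ℂ, ‖w‖ ≤ P → ‖s.zeta (α (n + 1)) (z : OnePoint ℂ) * w‖ ≤ P := fun w hw => by
      rw [norm_mul]
      exact (mul_le_of_le_one_left (norm_nonneg _) hz).trans hw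
    refine ⟨?_, ?_, ?_, ?_⟩
    · have := key _ _ 1 (γ (n + 1)) P (by simp) h1 (hm _ h4)
      rwa [one_mul, ← mul_assoc] at this
    · have := key _ _ 1 (γ (n + 1)) P (by simp) h2 (hm _ h3)
      rwa [one_mul, ← mul_assoc] at this
    · have := key _ _ _ (star (γ (n + 1))) P hz h3 h2
      rwa [norm_star] at this
    · have := key _ _ _ (star (γ (n + 1))) P hz h4 h1
      rwa [norm_star] at this

lemma prod_one_add_le_exp_tsum {g : ℕ → ℝ} (hg : ∀ n, 0 ≤ g n) (hsum : Summable g) (t : Finset ℕ) :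
    ∏ k ∈ t, (1 + g k) ≤ Real.exp (∑' k, g k) := by
  calc ∏ k ∈ t, (1 + g k) ≤ Real.exp (∑ k ∈ t, g k) := by
        rw [Real.exp_sum]
        exact Finset.prod_le_prod (fun k _ => by linarith [hg k])
          fun k _ => by linarith [Real.add_one_le_exp (g k)]
    _ ≤ _ := Real.exp_le_exp.mpr (hsum.sum_le_tsum _ fun k _ => hg k)

/-- The Wall recurrence applied to the pair `(S_m v - R_m, S*_m - R*_m v)`. -/
lemma wall_apply_succ (s : RSetting) (α γ : ℕ → ℂ) (z v : ℂ) (n : ℕ) :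
    (s.wall α γ z (n + 1)).S * v - (s.wall α γ z (n + 1)).R =
      ((s.wall α γ z n).S * v - (s.wall α γ z n).R) - γ (n + 1) * s.zeta (α (n + 1)) (z : OnePoint ℂ) *
        ((s.wall α γ z n).Ss - (s.wall α γ z n).Rs * v) ∧
    (s.wall α γ z (n + 1)).Ss - (s.wall α γ z (n + 1)).Rs * v =
      s.zeta (α (n + 1)) (z : OnePoint ℂ) * ((s.wall α γ z n).Ss - (s.wall α γ z n).Rs * v) -
        star (γ (n + 1)) * ((s.wall α γ z n).S * v - (s.wall α γ z n).R) := by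
  constructor <;> simp only [wall] <;> ring

/-- If `∑ |γ_n| < ∞` and the Blaschke product does not diverge to `0`, the points near `R_n / S_n`
are strictly inside all the nested disks of index `m ≥ n`. -/
theorem exists_ball_wall {s : RSetting} {α γ : ℕ → ℂ} {z : ℂ} (hγ : ∀ n, ‖γ n‖ < 1)
    (hζ : ∀ n, ‖s.zeta (α n) (z : OnePoint ℂ)‖ ≤ 1) (hsum : Summable fun n => ‖γ n‖) {p : ℝ}
    (hp : 0 < p) (hB : ∀ n, p ≤ ‖s.blaschkeProd α n z‖) :
    ∃ δ > 0, ∃ N, ∀ n ≥ N, ∀ v : ℂ, ‖v - (s.wall α γ z n).R / (s.wall α γ z n).S‖ < δ → ∀ m ≥ n,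
      ‖(s.wall α γ z m).S * v - (s.wall α γ z m).R‖ < ‖s.zeta (α (m + 1)) (z : OnePoint ℂ) *
        ((s.wall α γ z m).Ss - (s.wall α γ z m).Rs * v)‖ := by
  obtain ⟨w, hw, hω⟩ : ∃ w > 0, ∀ n, w ≤ omega γ n := by
    obtain ⟨w, hw, h⟩ := exists_pos_le_prod_one_sub (x := fun n => ‖γ n‖ ^ 2) (fun n => by positivity)
      (fun n => by nlinarith [hγ n, norm_nonneg (γ n)])
      (hsum.of_nonneg_of_le (fun n => by positivity)
        fun n => by nlinarith [hγ n, norm_nonneg (γ n)])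
    exact ⟨w, hw, fun n => h (n + 1)⟩
  set C := Real.exp (∑' k, ‖γ k‖) with hC
  have hC1 : 1 ≤ C := Real.one_le_exp (tsum_nonneg fun k => norm_nonneg _)
  have hprod := prod_one_add_le_exp_tsum (fun n => norm_nonneg (γ n)) hsum
  have hR : ∀ n, ‖(s.wall α γ z n).R‖ ≤ C := fun n => (wall_norm_le hζ n).1.trans (hprod _)
  have hS : ∀ n, ‖(s.wall α γ z n).S‖ ≤ C := fun n => (wall_norm_le hζ n).2.1.trans (hprod _)
  have hRs : ∀ n, ‖(s.wall α γ z n).Rs‖ ≤ C :=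
    fun n => (wall_norm_le hζ n).2.2.1.trans (hprod _)
  have hSs : ∀ n, ‖(s.wall α γ z n).Ss‖ ≤ C :=
    fun n => (wall_norm_le hζ n).2.2.2.trans (hprod _)
  have hp1 : p ≤ 1 := by simpa [blaschkeProd] using hB 0
  -- a lower bound for products over blocks
  have hblock : ∀ n m, n ≤ m → p ≤ ∏ k ∈ Finset.Ico n m, ‖s.zeta (α (k + 1)) (z : OnePoint ℂ)‖ := by
    intro n m hnm
    refine (hB m).trans ?_
    rw [blaschkeProd, norm_prod, ← Finset.prod_range_mul_prod_Ico _ hnm]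
    exact mul_le_of_le_one_left (Finset.prod_nonneg fun k _ => norm_nonneg _)
      (Finset.prod_le_one (fun k _ => norm_nonneg _) fun k _ => hζ _)
  -- `c` bounds `|B_n ω_n / S_n|`, the value of `|Y n|` at the centre, from below; `D` will bound
  -- both `|X m|` and `|Y m|`, using `|v| ≤ 2`.
  set c := p * w / C with hc
  have hcpos : 0 < c := by positivity
  set D := 3 * C with hD
  have hDpos : 0 < D := by positivity
  -- The `1` gives `|v| ≤ 2`; the other term keeps the initial deviation `C δ` at most `p c / 8`.
  set δ := min 1 (p * c / (8 * C)) with hδ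
  have hδpos : 0 < δ := by positivity
  -- The tail of `∑ |γ_k|` is chosen so that the drift accumulated after index `N` also stays below
  -- `p c / 8`.
  obtain ⟨N, hN⟩ : ∃ N, ∀ n ≥ N, ∀ m, n ≤ m → ∑ k ∈ Finset.Ico n m, ‖γ (k + 1)‖ ≤ p * c / (8 * D) := by
    have hs' : Summable fun n => ‖γ (n + 1)‖ := (summable_nat_add_iff 1).mpr hsum
    have ht := tendsto_sum_nat_add fun n => ‖γ (n + 1)‖
    obtain ⟨N, hN⟩ := eventually_atTop.mp (ht.eventually_lt_const (show 0 < p * c / (8 * D) by positivity))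
    refine ⟨N, fun n hn m hnm => (le_trans ?_ (hN n hn).le)⟩
    rw [Finset.sum_Ico_eq_sum_range]
    refine le_trans (le_of_eq ?_) (((summable_nat_add_iff n).mpr hs').sum_le_tsum (Finset.range (m - n))
      fun k _ => norm_nonneg _)
    refine Finset.sum_congr rfl fun k _ => ?_
    rw [add_comm n k]
  refine ⟨δ, hδpos, N, fun n hn v hv m hm => ?_⟩
  have hRS := wall_norm_lt hγ hζ n
  have hSn : (s.wall α γ z n).S ≠ 0 := norm_pos_iff.mp ((norm_nonneg _).trans_lt hRS)
  set q := (s.wall α γ z n).R / (s.wall α γ z n).S with hq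
  have hq1 : ‖q‖ ≤ 1 := by
    rw [hq, norm_div]
    exact div_le_one_of_le₀ hRS.le (norm_nonneg _)
  have hv2 : ‖v‖ ≤ 2 := by
    have h1 : ‖v‖ ≤ ‖v - q‖ + ‖q‖ := by simpa using norm_add_le (v - q) q
    have h2 : δ ≤ 1 := min_le_left _ _
    linarith
  set X := fun m => (s.wall α γ z m).S * v - (s.wall α γ z m).R with hX
  set Y := fun m => (s.wall α γ z m).Ss - (s.wall α γ z m).Rs * v with hY
  have hXb : ∀ m, ‖X m‖ ≤ D := fun m => by
    calc ‖X m‖ ≤ ‖(s.wall α γ z m).S‖ * ‖v‖ + ‖(s.wall α γ z m).R‖ := by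
          simpa [hX] using norm_sub_le ((s.wall α γ z m).S * v) (s.wall α γ z m).R
      _ ≤ C * 2 + C := by
          gcongr
          exacts [hS m, hR m]
      _ = D := by rw [hD]; ring
  have hYb : ∀ m, ‖Y m‖ ≤ D := fun m => by
    calc ‖Y m‖ ≤ ‖(s.wall α γ z m).Ss‖ + ‖(s.wall α γ z m).Rs‖ * ‖v‖ := by
          simpa [hY] using norm_sub_le (s.wall α γ z m).Ss ((s.wall α γ z m).Rs * v)
      _ ≤ C + C * 2 := by
          gcongr
          exacts [hSs m, hRs m]
      _ = D := by rw [hD]; ring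
  have hXn : ‖X n‖ ≤ C * δ := by
    have : X n = (s.wall α γ z n).S * (v - q) := by
      simp only [hX, hq]
      field_simp
    rw [this, norm_mul]
    gcongr
    exact hS n
  -- At `v = q` the determinant identity gives `Y n = B_n ω_n / S_n`; moving to `v` costs at most `C
  -- δ`.
  have hYn : c - C * δ ≤ ‖Y n‖ := by
    have h1 : Y n = s.blaschkeProd α n z * omega γ n / (s.wall α γ z n).S -
        (s.wall α γ z n).Rs * (v - q) := by
      simp only [hY, hq]
      rw [← wall_det]
      field_simp
      ring
    have h2 : c ≤ ‖s.blaschkeProd α n z * omega γ n / (s.wall α γ z n).S‖ := by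
      rw [norm_div, norm_mul, Complex.norm_real, Real.norm_of_nonneg (omega_pos hγ n).le, hc]
      have := norm_pos_iff.mpr hSn
      have := omega_pos hγ n
      gcongr
      exacts [hB n, hω n, hS n]
    have h3 : ‖(s.wall α γ z n).Rs * (v - q)‖ ≤ C * δ := by
      rw [norm_mul]
      gcongr
      exact hRs n
    rw [h1]
    linarith [norm_sub_norm_le (s.blaschkeProd α n z * omega γ n / (s.wall α γ z n).S)
      ((s.wall α γ z n).Rs * (v - q))]
  have hXm : ‖X m‖ ≤ C * δ + D * ∑ k ∈ Finset.Ico n m, ‖γ (k + 1)‖ := by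
    induction m, hm using Nat.le_induction with
    | base => simpa using hXn
    | succ m hm ih =>
      rw [Finset.sum_Ico_succ_top hm, show X (m + 1) = _ from (wall_apply_succ s α γ z v m).1]
      have h1 : ‖γ (m + 1) * s.zeta (α (m + 1)) (z : OnePoint ℂ) * Y m‖ ≤ D * ‖γ (m + 1)‖ := by
        rw [norm_mul, norm_mul]
        have := mul_le_mul (hζ (m + 1)) (hYb m) (norm_nonneg _) zero_le_one
        calc _ = ‖γ (m + 1)‖ * (‖s.zeta (α (m + 1)) (z : OnePoint ℂ)‖ * ‖Y m‖) := by ring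
          _ ≤ ‖γ (m + 1)‖ * (1 * D) := by gcongr
          _ = _ := by ring
      have h2 := norm_sub_le (X m) (γ (m + 1) * s.zeta (α (m + 1)) (z : OnePoint ℂ) * Y m)
      have h3 : ‖X m - γ (m + 1) * s.zeta (α (m + 1)) (z : OnePoint ℂ) * Y m‖ ≤
        C * δ + D * (∑ k ∈ Finset.Ico n m, ‖γ (k + 1)‖ + ‖γ (m + 1)‖) := by linarith
      exact h3
  -- `Y` is damped by each `|ζ_k|`, so only the product over the block survives; the damping never
  -- enlarges the earlier errors.
  have hYm : (∏ k ∈ Finset.Ico n m, ‖s.zeta (α (k + 1)) (z : OnePoint ℂ)‖) * ‖Y n‖ -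
      D * ∑ k ∈ Finset.Ico n m, ‖γ (k + 1)‖ ≤ ‖Y m‖ := by
    clear hXm
    induction m, hm using Nat.le_induction with
    | base => simp
    | succ m hm ih =>
      rw [Finset.sum_Ico_succ_top hm, Finset.prod_Ico_succ_top hm,
        show Y (m + 1) = _ from (wall_apply_succ s α γ z v m).2]
      have h1 : ‖star (γ (m + 1)) * X m‖ ≤ D * ‖γ (m + 1)‖ := by
        rw [norm_mul, norm_star, mul_comm]
        gcongr
        exact hXb m
      have h2 := norm_sub_norm_le (s.zeta (α (m + 1)) (z : OnePoint ℂ) * Y m) (star (γ (m + 1)) * X m)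
      rw [norm_mul] at h2
      have h3 := mul_le_mul_of_nonneg_left ih (norm_nonneg (s.zeta (α (m + 1)) (z : OnePoint ℂ)))
      have h4 : ‖s.zeta (α (m + 1)) (z : OnePoint ℂ)‖ * (D * ∑ k ∈ Finset.Ico n m, ‖γ (k + 1)‖) ≤
          D * ∑ k ∈ Finset.Ico n m, ‖γ (k + 1)‖ :=
        mul_le_of_le_one_left (mul_nonneg (by positivity) (Finset.sum_nonneg fun k _ => norm_nonneg _))
          (hζ _)
      change _ ≤ ‖s.zeta (α (m + 1)) (z : OnePoint ℂ) * Y m - star (γ (m + 1)) * X m‖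
      linarith
  -- The left side is at most `p c / 4`. The right side is at least `p (c - C δ) - D T ≥ 3 p c / 4`,
  -- the factor `ζ_{m+1}` being absorbed into the block product up to `m + 1`.
  change ‖X m‖ < ‖s.zeta (α (m + 1)) (z : OnePoint ℂ) * Y m‖
  have hT := hN n hn m hm
  set T := ∑ k ∈ Finset.Ico n m, ‖γ (k + 1)‖ with hTdef
  have hT' : D * T ≤ p * c / 8 := by
    calc D * T ≤ D * (p * c / (8 * D)) := by gcongr
      _ = p * c / 8 := by field_simp
  have hδ' : C * δ ≤ p * c / 8 := by
    calc C * δ ≤ C * (p * c / (8 * C)) := by gcongr; exact min_le_right _ _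
      _ = p * c / 8 := by field_simp
  have hpc : p * c ≤ c := mul_le_of_le_one_left hcpos.le hp1
  have h1 := hblock n (m + 1) (by omega)
  rw [Finset.prod_Ico_succ_top hm] at h1
  have hζm := hζ (m + 1)
  rw [norm_mul]
  set Z := ‖s.zeta (α (m + 1)) (z : OnePoint ℂ)‖
  have hZ0 : 0 ≤ Z := norm_nonneg _
  have hTnn : 0 ≤ D * T := mul_nonneg (by positivity) (Finset.sum_nonneg fun k _ => norm_nonneg _)
  have h2 := mul_le_mul_of_nonneg_left hYm hZ0
  have h3 : Z * (D * T) ≤ D * T := mul_le_of_le_one_left hTnn hζm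
  have h4 := mul_le_mul_of_nonneg_right h1 (norm_nonneg (Y n))
  have h5 : p * (c - C * δ) ≤ p * ‖Y n‖ := mul_le_mul_of_nonneg_left hYn hp.le
  have h6 : p * (C * δ) ≤ C * δ := mul_le_of_le_one_left (by positivity) hp1
  have h7 : 0 < p * c := by positivity
  linarith

/-! ### Solutions of the moment problem on the circle -/

section disk

variable {β γ : ℕ → ℂ}

/-- The probability measures on the circle with orthonormal rational functions `Φ_n`. -/
def circleSolutions (β γ : ℕ → ℂ) : Set (ProbabilityMeasure Circle) :=
  {μ | ∀ m n : ℕ, ∫ u : Circle, disk.orf β γ m ((u : ℂ) : OnePoint ℂ) *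
    star (disk.orf β γ n ((u : ℂ) : OnePoint ℂ)) ∂(μ : Measure Circle) = if m = n then 1 else 0}

lemma continuous_orf_circle (hβ : ∀ n, ‖β n‖ < 1) (n : ℕ) :
    Continuous fun u : Circle => disk.orf β γ n ((u : ℂ) : OnePoint ℂ) :=
  continuous_circle_of_differentiableAt fun _ hz => (differentiableAt_orf hβ n hz).1

lemma isClosed_integral_eq {f : Circle → ℂ} (hf : Continuous f) (c : ℂ) :
    IsClosed {μ : ProbabilityMeasure Circle | ∫ u, f u ∂(μ : Measure Circle) = c} := by
  apply isClosed_eq _ continuous_const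
  rw [continuous_iff_continuousAt]
  intro μ
  exact (ProbabilityMeasure.tendsto_iff_forall_integral_rclike_tendsto ℂ).mp tendsto_id
    (BoundedContinuousFunction.mkOfCompact ⟨f, hf⟩)

lemma wallF_of_wall_eq {n : ℕ} {x v : ℂ} (hS : (disk.wall β γ x n).S ≠ 0)
    (h : (disk.wall β γ x n).R = v * (disk.wall β γ x n).S) :
    wallF β γ n x = (1 + x * v) / (1 - x * v) := by
  rw [wallF, wallDen, h]
  rw [← mul_div_mul_right (1 + x * v) _ hS]
  congr 1 <;> ring

/-- A value which is strictly inside all the nested disks from some index on is attained by a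
solution. -/
theorem exists_circleSolutions (hβ0 : β 0 = 0) (hβ : ∀ n, ‖β n‖ < 1) (hγ : ∀ n, ‖γ n‖ < 1) {x v : ℂ}
    (hx : ‖x‖ < 1) (n : ℕ) (h : ∀ m ≥ n, ‖(disk.wall β γ x m).S * v - (disk.wall β γ x m).R‖ <
      ‖disk.zeta (β (m + 1)) (x : OnePoint ℂ) *
        ((disk.wall β γ x m).Ss - (disk.wall β γ x m).Rs * v)‖) :
    ∃ μ ∈ circleSolutions β γ,
      ∫ u : Circle, ((u : ℂ) + x) / (u - x) ∂(μ : Measure Circle) = (1 + x * v) / (1 - x * v) := by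
  have key : ∀ m ≥ n, ∃ μ : ProbabilityMeasure Circle,
      (∀ j k, j ≤ m → k ≤ m → ∫ u : Circle, disk.orf β γ j ((u : ℂ) : OnePoint ℂ) *
        star (disk.orf β γ k ((u : ℂ) : OnePoint ℂ)) ∂(μ : Measure Circle) = if j = k then 1 else 0) ∧
      ∫ u : Circle, ((u : ℂ) + x) / (u - x) ∂(μ : Measure Circle) = (1 + x * v) / (1 - x * v) := by
    intro m hm
    have hlt := h m hm
    set d := disk.zeta (β (m + 1)) (x : OnePoint ℂ) *
        ((disk.wall β γ x m).Ss - (disk.wall β γ x m).Rs * v) with hd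
    have hd0 : d ≠ 0 := norm_pos_iff.mp ((norm_nonneg _).trans_lt hlt)
    -- The parameter for which `(R_m + w ζ_{m+1} S*_m)/(S_m + w ζ_{m+1} R*_m) = v`; the hypothesis
    -- on `v` says exactly that `|w| < 1`.
    set w := ((disk.wall β γ x m).S * v - (disk.wall β γ x m).R) / d with hw
    have hw1 : ‖w‖ < 1 := by
      rw [hw, norm_div, div_lt_one (norm_pos_iff.mpr hd0)]
      exact hlt
    set γ' := Function.update γ (m + 1) w with hγ'def
    have hγ' : ∀ k, ‖γ' k‖ < 1 := by
      intro k
      by_cases hk : k = m + 1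
      · rw [hγ'def, hk, Function.update_self]; exact hw1
      · rw [hγ'def, Function.update_of_ne hk]; exact hγ k
    have hagree : ∀ k ≤ m, γ k = γ' k := fun k hk => by
      rw [hγ'def, Function.update_of_ne (by omega)]
    have hprob := isProbabilityMeasure_bsMeas hβ hγ' (m + 1)
    refine ⟨⟨bsMeas β γ' (m + 1), hprob⟩, fun j k hj hk => ?_, ?_⟩
    · have h1 := orthonormal_bsMeas hβ0 hβ hγ' (m + 1) (show j ≤ m + 1 + 1 by omega)
        (show k ≤ m + 1 + 1 by omega)
      simp only [orf, orfPair_congr disk β j (fun i hi => hagree i (by omega)),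
        orfPair_congr disk β k (fun i hi => hagree i (by omega))] at h1 ⊢
      exact h1
    · change ∫ u : Circle, ((u : ℂ) + x) / (u - x) ∂(bsMeas β γ' (m + 1)) = _
      rw [integral_kernel_bsMeas hβ hγ' (m + 1) hx]
      have hlt' := wall_norm_lt (s := disk) (α := β) (z := x) hγ'
        (fun n => norm_zeta_disk_le_one (hβ n) hx.le) (m + 1)
      refine wallF_of_wall_eq (norm_pos_iff.mp ((norm_nonneg _).trans_lt hlt')) ?_
      have hwall : disk.wall β γ' x m = disk.wall β γ x m :=
        (wall_congr disk β x m hagree).symm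
      have hgw : γ' (m + 1) = w := Function.update_self _ _ _
      simp only [wall, hwall, hgw]
      have : w * d = (disk.wall β γ x m).S * v - (disk.wall β γ x m).R := by
        rw [hw, div_mul_cancel₀ _ hd0]
      rw [hd] at this
      linear_combination this
  -- `choose!` needs a default measure for the irrelevant indices `m < n`.
  have hne : Nonempty (ProbabilityMeasure Circle) := ⟨⟨arcMeas, inferInstance⟩⟩
  choose! ρ hρ1 hρ2 using key
  -- Probability measures on the circle are weakly compact, and each required identity is a closed
  -- condition that holds for all large `m`.
  obtain ⟨μ, -, hμ⟩ := isCompact_univ.exists_mapClusterPt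
    (show map ρ atTop ≤ 𝓟 Set.univ by simp)
  have hcl : ∀ K : Set (ProbabilityMeasure Circle), IsClosed K → (∀ᶠ m in atTop, ρ m ∈ K) → μ ∈ K :=
    fun K hK he => isClosed_iff_clusterPt.mp hK μ (ClusterPt.mono hμ (le_principal_iff.mpr he))
  refine ⟨μ, fun j k => ?_, ?_⟩
  · refine hcl _ (isClosed_integral_eq
      ((continuous_orf_circle hβ j).mul (continuous_orf_circle hβ k).star) _) ?_
    filter_upwards [eventually_ge_atTop n, eventually_ge_atTop j, eventually_ge_atTop k] with m h1 h2 h3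
    exact hρ1 m h1 j k h2 h3
  · refine hcl _ (isClosed_integral_eq (continuous_circle_kernel hx) _) ?_
    filter_upwards [eventually_ge_atTop n] with m h1
    exact hρ2 m h1

end disk

/-! ### Measures on the circle are determined by their Cauchy transforms -/

lemma one_sub_star_mul_circle_ne_zero {z : ℂ} (hz : ‖z‖ < 1) (u : Circle) : 1 - star z * (u : ℂ) ≠ 0 :=
  one_sub_star_mul_ne_zero hz u.norm_coe.le

lemma continuous_circle_cauchy {z : ℂ} (hz : ‖z‖ < 1) (k : ℕ) :
    Continuous fun u : Circle => (u : ℂ) ^ k / (1 - star z * u) :=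
  Continuous.div (by fun_prop) (by fun_prop) (one_sub_star_mul_circle_ne_zero hz)

lemma norm_one_sub_star_mul_circle_ge (z : ℂ) (u : Circle) : 1 - ‖z‖ ≤ ‖1 - star z * (u : ℂ)‖ := by
  have := norm_sub_norm_le (1 : ℂ) (star z * u)
  rwa [norm_mul, u.norm_coe, mul_one, norm_star, norm_one] at this

/-- With `C_k(z) = ∫ u^k / (1 - conj z u)` and `m_k = ∫ u^k`, one has `C_k(z) = m_k + conj z
C_{k+1}(z)`. Equality of the `C_k` for two measures yields `m_k` at `z = 0` and then `C_{k+1}` for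
`z ≠ 0`. -/
lemma integral_pow_eq_of_cauchy {μ ν : Measure Circle} [IsProbabilityMeasure μ]
    [IsProbabilityMeasure ν] (h : ∀ z : ℂ, ‖z‖ < 1 →
      ∫ u : Circle, 1 / (1 - star z * (u : ℂ)) ∂μ = ∫ u : Circle, 1 / (1 - star z * (u : ℂ)) ∂ν) (k : ℕ) :
    ∫ u : Circle, (u : ℂ) ^ k ∂μ = ∫ u : Circle, (u : ℂ) ^ k ∂ν := by
  have hrec : ∀ (ρ : Measure Circle) [IsProbabilityMeasure ρ] (k : ℕ) (z : ℂ), ‖z‖ < 1 →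
      ∫ u : Circle, (u : ℂ) ^ k / (1 - star z * (u : ℂ)) ∂ρ = ∫ u : Circle, (u : ℂ) ^ k ∂ρ +
        star z * ∫ u : Circle, (u : ℂ) ^ (k + 1) / (1 - star z * (u : ℂ)) ∂ρ := by
    intro ρ _ k z hz
    rw [← integral_const_mul, ← integral_add]
    · congr 1
      ext u
      have := one_sub_star_mul_circle_ne_zero hz u
      field_simp
      ring
    · exact integrable_circle _ (by fun_prop)
    · exact integrable_circle _ (continuous_const.mul (continuous_circle_cauchy hz _))
  have hbd : ∀ (ρ : Measure Circle) [IsProbabilityMeasure ρ] (k : ℕ) (z : ℂ), ‖z‖ < 1 / 2 →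
      ‖∫ u : Circle, (u : ℂ) ^ k / (1 - star z * (u : ℂ)) ∂ρ‖ ≤ 2 := by
    intro ρ _ k z hz
    have h1 := norm_integral_le_of_norm_le_const (μ := ρ) (C := 2)
      (f := fun u : Circle => (u : ℂ) ^ k / (1 - star z * (u : ℂ))) (Eventually.of_forall fun u => by
        have := norm_one_sub_star_mul_circle_ge z u
        rw [norm_div, norm_pow, u.norm_coe, one_pow, div_le_iff₀ (by linarith)]
        linarith)
    simpa using h1
  have hall : ∀ k : ℕ, ∀ z : ℂ, ‖z‖ < 1 → ∫ u : Circle, (u : ℂ) ^ k / (1 - star z * (u : ℂ)) ∂μ =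
      ∫ u : Circle, (u : ℂ) ^ k / (1 - star z * (u : ℂ)) ∂ν := by
    intro k
    induction k with
    | zero => simpa using h
    | succ k ih =>
      have h0 : ∫ u : Circle, (u : ℂ) ^ k ∂μ = ∫ u : Circle, (u : ℂ) ^ k ∂ν := by
        simpa using ih 0 (by simp)
      have hne : ∀ z : ℂ, ‖z‖ < 1 → z ≠ 0 →
          ∫ u : Circle, (u : ℂ) ^ (k + 1) / (1 - star z * (u : ℂ)) ∂μ =
            ∫ u : Circle, (u : ℂ) ^ (k + 1) / (1 - star z * (u : ℂ)) ∂ν := by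
        intro z hz hz0
        have h1 := ih z hz
        rw [hrec μ k z hz, hrec ν k z hz, h0] at h1
        exact mul_left_cancel₀ (star_ne_zero.mpr hz0) (add_left_cancel h1)
      intro z hz
      by_cases hz0 : z = 0
      -- Dividing by `conj z` is impossible here, so the origin is approached along small real `r`.
      -- The recursion leaves an error `r |B - A| ≤ 4 r`, which dictates `r ≤ ε / 4`.
      · subst hz0
        simp only [star_zero, zero_mul, sub_zero, div_one]
        rw [← sub_eq_zero, ← norm_le_zero_iff]
        apply le_of_forall_pos_le_add
        intro ε hε
        set r : ℝ := min (1 / 4) (ε / 4) with hr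
        have hrpos : 0 < r := by positivity
        have hrn : ‖(r : ℂ)‖ = r := by rw [Complex.norm_real, Real.norm_of_nonneg hrpos.le]
        have hr4 : r ≤ 1 / 4 := min_le_left _ _
        have hr1 : ‖(r : ℂ)‖ < 1 := by rw [hrn]; linarith
        have hr2 : ‖(r : ℂ)‖ < 1 / 2 := by rw [hrn]; linarith
        have h1 := hne r hr1 (by exact_mod_cast hrpos.ne')
        rw [hrec μ _ _ hr1, hrec ν _ _ hr1] at h1
        have h2 := hbd μ (k + 1 + 1) r hr2
        have h3 := hbd ν (k + 1 + 1) r hr2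
        set A := ∫ u : Circle, (u : ℂ) ^ (k + 1 + 1) / (1 - star (r : ℂ) * (u : ℂ)) ∂μ
        set B := ∫ u : Circle, (u : ℂ) ^ (k + 1 + 1) / (1 - star (r : ℂ) * (u : ℂ)) ∂ν
        have h4 : ∫ u : Circle, (u : ℂ) ^ (k + 1) ∂μ - ∫ u : Circle, (u : ℂ) ^ (k + 1) ∂ν =
            star (r : ℂ) * (B - A) := by linear_combination h1
        rw [h4, norm_mul, norm_star, hrn, zero_add]
        have h5 : ‖B - A‖ ≤ 4 := (norm_sub_le _ _).trans (by linarith)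
        calc r * ‖B - A‖ ≤ (ε / 4) * 4 := by
              gcongr
              exact min_le_right _ _
          _ = ε := by ring
      · exact hne z hz hz0
  simpa using hall k 0 (by simp)

/-- Conjugation supplies the negative moments. The star algebra generated by the coordinate
separates points, so agreement of integrals on it determines the measure. -/
lemma measure_circle_ext {μ ν : Measure Circle} [IsProbabilityMeasure μ] [IsProbabilityMeasure ν]
    (h : ∀ k : ℕ, ∫ u : Circle, (u : ℂ) ^ k ∂μ = ∫ u : Circle, (u : ℂ) ^ k ∂ν) : μ = ν := by
  have hz : ∀ k : ℤ, ∫ u : Circle, (u : ℂ) ^ k ∂μ = ∫ u : Circle, (u : ℂ) ^ k ∂ν := by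
    intro k
    rcases Int.eq_nat_or_neg k with ⟨n, rfl | rfl⟩
    · simpa using h n
    · have h1 := congrArg (starRingEnd ℂ) (h n)
      rw [← integral_conj, ← integral_conj] at h1
      have h2 : ∀ u : Circle, (starRingEnd ℂ) ((u : ℂ) ^ n) = (u : ℂ) ^ (-(n : ℤ)) := by
        intro u
        rw [map_pow, ← Circle.coe_inv_eq_conj, Circle.coe_inv, zpow_neg, zpow_natCast, inv_pow]
      simpa only [h2] using h1
  let c : BoundedContinuousFunction Circle ℂ :=
    BoundedContinuousFunction.mkOfCompact ⟨fun u : Circle => (u : ℂ), by fun_prop⟩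
  -- Quantifying over all integer powers makes this agreement stable under multiplication by `u` and
  -- under conjugation.
  let I : (Circle → ℂ) → Prop := fun f => ∀ k : ℤ, ∫ u : Circle, (u : ℂ) ^ k * f u ∂μ =
    ∫ u : Circle, (u : ℂ) ^ k * f u ∂ν
  have hcz : ∀ k : ℤ, Continuous fun u : Circle => (u : ℂ) ^ k := fun k =>
    Continuous.zpow₀ (by fun_prop) k fun u => Or.inl u.coe_ne_zero
  have hIc : ∀ f : Circle → ℂ, I f → I fun u => u * f u := by
    intro f hf k
    have := hf (k + 1)
    simpa only [zpow_add₀ (Circle.coe_ne_zero _), zpow_one, mul_assoc] using this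
  have hIs : ∀ f : Circle → ℂ, I f → I fun u => star (f u) := by
    intro f hf k
    have h1 := congrArg (starRingEnd ℂ) (hf (-k))
    rw [← integral_conj, ← integral_conj] at h1
    have h2 : ∀ u : Circle, (starRingEnd ℂ) ((u : ℂ) ^ (-k) * f u) = (u : ℂ) ^ k * star (f u) := by
      intro u
      rw [map_mul, map_zpow₀, ← Circle.coe_inv_eq_conj, Circle.coe_inv, inv_zpow', neg_neg]
      rfl
    simpa only [h2] using h1
  refine ext_of_forall_mem_subalgebra_integral_eq_of_polish
    (A := StarAlgebra.adjoin ℂ {c}) ?_ ?_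
  · intro u v huv
    refine ⟨fun u => (u : ℂ), ⟨c.toContinuousMap, ⟨c, StarAlgebra.subset_adjoin ℂ {c} rfl, rfl⟩, rfl⟩, ?_⟩
    exact fun h => huv (Circle.ext h)
  · intro g hg
    -- The extra factor `f` is what lets the induction over the algebra pass through products.
    have key : ∀ f : Circle → ℂ, Continuous f → I f → I fun u => g u * f u := by
      induction hg using StarAlgebra.adjoin_induction with
      | mem g hg =>
        intro f _ hf
        rw [Set.mem_singleton_iff] at hg
        subst hg
        exact hIc f hf
      | algebraMap r =>
        intro f _ hf k
        have h1 : ∀ u : Circle, (u : ℂ) ^ k *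
            ((algebraMap ℂ (BoundedContinuousFunction Circle ℂ) r) u * f u) =
            r * ((u : ℂ) ^ k * f u) := fun u => by
          rw [show (algebraMap ℂ (BoundedContinuousFunction Circle ℂ) r) u = r from rfl]
          ring
        simp only [h1, integral_const_mul, hf k]
      | add g g' _ _ h1 h2 =>
        intro f hfc hf k
        simp only [BoundedContinuousFunction.add_apply, add_mul, mul_add]
        rw [integral_add, integral_add, h1 f hfc hf k, h2 f hfc hf k]
        all_goals
          refine integrable_circle _ ((hcz k).mul (Continuous.mul ?_ hfc))
          exact ContinuousMapClass.map_continuous _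
      | mul g g' _ _ h1 h2 =>
        intro f hfc hf
        have := h1 (fun u => g' u * f u) ((ContinuousMapClass.map_continuous g').mul hfc) (h2 f hfc hf)
        simpa only [BoundedContinuousFunction.mul_apply, mul_assoc] using this
      | star g _ h1 =>
        intro f hfc hf
        have h2 := hIs _ (h1 (fun u => star (f u)) hfc.star (hIs f hf))
        simpa only [star_mul', star_star, BoundedContinuousFunction.star_apply] using h2
    have := key (fun _ => 1) continuous_const (fun k => by simpa using hz k) 0
    simpa using this

/-! ### Indeterminacy forces the Blaschke condition -/

section disk

variable {β γ : ℕ → ℂ}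

/-- The common denominator `(1 - conj β₁ u) ⋯ (1 - conj β_n u)`. -/
noncomputable def poleProd (β : ℕ → ℂ) (n : ℕ) (u : Circle) : ℂ :=
  ∏ k ∈ Finset.range n, (1 - star (β (k + 1)) * (u : ℂ))

/-- The map `p ↦ p / ((1 - conj β₁ u) ⋯ (1 - conj β_n u))`. -/
noncomputable def ratMap (β : ℕ → ℂ) (n : ℕ) : Polynomial ℂ →ₗ[ℂ] (Circle → ℂ) where
  toFun p u := p.eval (u : ℂ) / poleProd β n u
  map_add' p q := by ext u; simp [add_div]
  map_smul' c p := by ext u; simp [mul_div_assoc]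

/-- The rational functions of degree `≤ n` with poles at the reflections of `β₁, …, β_n`. -/
noncomputable def ratSpace (β : ℕ → ℂ) (n : ℕ) : Submodule ℂ (Circle → ℂ) :=
  (Polynomial.degreeLT ℂ (n + 1)).map (ratMap β n)

instance (n : ℕ) : Module.Finite ℂ (Polynomial.degreeLT ℂ n) :=
  Module.Finite.equiv (Polynomial.degreeLTEquiv ℂ n).symm

instance (n : ℕ) : Module.Finite ℂ (ratSpace β n) := by
  unfold ratSpace; infer_instance

lemma finrank_ratSpace_le (n : ℕ) : Module.finrank ℂ (ratSpace β n) ≤ n + 1 := by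
  refine (Submodule.finrank_map_le _ _).trans (le_of_eq ?_)
  rw [(Polynomial.degreeLTEquiv ℂ (n + 1)).finrank_eq]
  simp

lemma mul_mem_ratSpace (hβ : ∀ n, ‖β n‖ < 1) {n : ℕ} {f : Circle → ℂ} (hf : f ∈ ratSpace β n)
    (a b : ℂ) : (fun u : Circle => (a + b * u) / (1 - star (β (n + 1)) * (u : ℂ)) * f u) ∈
      ratSpace β (n + 1) := by
  obtain ⟨p, hp, rfl⟩ := hf
  refine ⟨(Polynomial.C a + Polynomial.C b * Polynomial.X) * p, ?_, ?_⟩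
  · rw [SetLike.mem_coe, Polynomial.mem_degreeLT] at hp ⊢
    by_cases hp0 : p = 0
    · simp [hp0]
    have h1 : (Polynomial.C a + Polynomial.C b * Polynomial.X).degree ≤ 1 := by
      rw [add_comm]; exact Polynomial.degree_linear_le
    rw [Polynomial.degree_eq_natDegree hp0] at hp
    have hp' : p.natDegree < n + 1 := by exact_mod_cast hp
    refine (Polynomial.degree_mul_le _ _).trans_lt ?_
    rw [Polynomial.degree_eq_natDegree hp0]
    refine (add_le_add_left h1 _).trans_lt ?_
    norm_cast
    omega
  · ext u
    have h1 := one_sub_star_mul_circle_ne_zero (hβ (n + 1)) u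
    simp only [ratMap, LinearMap.coe_mk, AddHom.coe_mk, poleProd, Finset.prod_range_succ]
    simp only [Polynomial.eval_mul, Polynomial.eval_add, Polynomial.eval_C, Polynomial.eval_X]
    rw [div_mul_div_comm, mul_comm (1 - star (β (n + 1)) * (u : ℂ))]

lemma ratSpace_mono (hβ : ∀ n, ‖β n‖ < 1) {m n : ℕ} (h : m ≤ n) : ratSpace β m ≤ ratSpace β n := by
  induction n, h using Nat.le_induction with
  | base => exact le_rfl
  | succ n _ ih =>
    refine ih.trans fun f hf => ?_
    have h1 := mul_mem_ratSpace hβ hf 1 (-star (β (n + 1)))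
    convert h1 using 1
    ext u
    have h1 := one_sub_star_mul_circle_ne_zero (hβ (n + 1)) u
    rw [neg_mul, ← sub_eq_add_neg, div_self h1, one_mul]

lemma one_mem_ratSpace : (fun _ => 1 : Circle → ℂ) ∈ ratSpace β 0 := by
  refine ⟨1, ?_, ?_⟩
  · rw [SetLike.mem_coe, Polynomial.mem_degreeLT]
    simp
  · ext u; simp [ratMap, poleProd]

lemma orf_mem_ratSpace (hβ : ∀ n, ‖β n‖ < 1) (n : ℕ) :
    (fun u : Circle => disk.orf β γ n ((u : ℂ) : OnePoint ℂ)) ∈ ratSpace β n ∧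
      (fun u : Circle => disk.orfStar β γ n ((u : ℂ) : OnePoint ℂ)) ∈ ratSpace β n := by
  induction n with
  | zero => exact ⟨one_mem_ratSpace, one_mem_ratSpace⟩
  | succ n ih =>
    obtain ⟨h1, h2⟩ := ih
    have h3 := mul_mem_ratSpace hβ h1 (-(disk.zconst (β n) * β n)) (disk.zconst (β n))
    have h4 := mul_mem_ratSpace hβ h2 1 (-star (β n))
    have key : ∀ a b : ℂ, (fun u : Circle => disk.varpi (β n) ((u : ℂ) : OnePoint ℂ) /
        disk.varpi (β (n + 1)) ((u : ℂ) : OnePoint ℂ) *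
        (a * (disk.zeta (β n) ((u : ℂ) : OnePoint ℂ) * disk.orf β γ n ((u : ℂ) : OnePoint ℂ)) +
          b * disk.orfStar β γ n ((u : ℂ) : OnePoint ℂ))) ∈ ratSpace β (n + 1) := by
      intro a b
      have h5 := (ratSpace β (n + 1)).add_mem ((ratSpace β (n + 1)).smul_mem a h3)
        ((ratSpace β (n + 1)).smul_mem b h4)
      convert h5 using 1
      ext u
      have h6 := one_sub_star_mul_circle_ne_zero (hβ n) u
      have h7 := one_sub_star_mul_circle_ne_zero (hβ (n + 1)) u
      simp only [varpi_disk_coe, zeta_disk_coe, Pi.add_apply, Pi.smul_apply, smul_eq_mul]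
      field_simp
      ring
    constructor
    · convert (ratSpace β (n + 1)).smul_mem (disk.eCoef β γ n : ℂ)
        (key (disk.zconst (β (n + 1)) * star (disk.zconst (β n))) (star (disk.lam β γ n))) using 1
      ext u
      simp only [orf_succ, Pi.smul_apply, smul_eq_mul]
      ring
    · convert (ratSpace β (n + 1)).smul_mem (disk.eCoef β γ n : ℂ)
        (key (disk.lam β γ n * (disk.zconst (β (n + 1)) * star (disk.zconst (β n)))) 1) using 1
      ext u
      simp only [orfStar_succ, Pi.smul_apply, smul_eq_mul]
      ring

/-- Orthonormality makes the `n + 1` functions independent inside a space of dimension at most `n +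
1`. -/
lemma span_orf_eq_ratSpace (hβ : ∀ n, ‖β n‖ < 1) {μ : ProbabilityMeasure Circle}
    (hμ : μ ∈ circleSolutions β γ) (n : ℕ) :
    Submodule.span ℂ (Set.range fun k : Fin (n + 1) =>
      fun u : Circle => disk.orf β γ k ((u : ℂ) : OnePoint ℂ)) = ratSpace β n := by
  have hli : LinearIndependent ℂ fun k : Fin (n + 1) =>
      fun u : Circle => disk.orf β γ k ((u : ℂ) : OnePoint ℂ) := by
    rw [Fintype.linearIndependent_iff]
    intro g hg i
    have h1 : ∫ u : Circle, (∑ k : Fin (n + 1), g k * disk.orf β γ k ((u : ℂ) : OnePoint ℂ)) *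
        star (disk.orf β γ i ((u : ℂ) : OnePoint ℂ)) ∂(μ : Measure Circle) = g i := by
      simp only [Finset.sum_mul, mul_assoc]
      rw [integral_finsetSum]
      · simp only [integral_const_mul, hμ _ _]
        simp [Fin.val_inj]
      · intro k _
        exact integrable_circle _ (continuous_const.mul
          ((continuous_orf_circle hβ k).mul (continuous_orf_circle hβ i).star))
    rw [← h1]
    have h2 : ∀ u : Circle, ∑ k : Fin (n + 1), g k * disk.orf β γ k ((u : ℂ) : OnePoint ℂ) = 0 := by
      intro u
      simpa using congrFun hg u
    simp [h2]
  apply Submodule.eq_of_le_of_finrank_le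
  · rw [Submodule.span_le]
    rintro _ ⟨k, rfl⟩
    exact ratSpace_mono hβ (Nat.lt_succ_iff.mp k.2) (orf_mem_ratSpace hβ k).1
  · rw [finrank_span_eq_card hli, Fintype.card_fin]
    exact finrank_ratSpace_le n

/-- As `Φ_0 = 1`, every solution prescribes the same integral of each `Φ_k`, and these span the
space. -/
lemma integral_eq_of_mem_ratSpace (hβ : ∀ n, ‖β n‖ < 1) {μ ν : ProbabilityMeasure Circle}
    (hμ : μ ∈ circleSolutions β γ) (hν : ν ∈ circleSolutions β γ) {n : ℕ} {f : Circle → ℂ}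
    (hf : f ∈ ratSpace β n) :
    ∫ u, f u ∂(μ : Measure Circle) = ∫ u, f u ∂(ν : Measure Circle) := by
  rw [← span_orf_eq_ratSpace hβ hμ n] at hf
  suffices h : Continuous f ∧ ∫ u, f u ∂(μ : Measure Circle) = ∫ u, f u ∂(ν : Measure Circle) from h.2
  induction hf using Submodule.span_induction with
  | mem f hf =>
    obtain ⟨k, rfl⟩ := hf
    refine ⟨continuous_orf_circle hβ k, ?_⟩
    have h1 := hμ k 0
    have h2 := hν k 0
    simp only [orf_zero, star_one, mul_one] at h1 h2
    rw [h1, h2]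
  | zero => exact ⟨continuous_const, by simp⟩
  | add f g _ _ hf hg =>
    refine ⟨hf.1.add hg.1, ?_⟩
    simp only [Pi.add_apply]
    rw [integral_add (integrable_circle _ hf.1) (integrable_circle _ hg.1),
      integral_add (integrable_circle _ hf.1) (integrable_circle _ hg.1), hf.2, hg.2]
  | smul c f _ hf =>
    refine ⟨hf.1.const_smul c, ?_⟩
    simp only [Pi.smul_apply, integral_smul, hf.2]

lemma blaschkeProd_mem_ratSpace (hβ : ∀ n, ‖β n‖ < 1) (n : ℕ) :
    (fun u : Circle => disk.blaschkeProd β n u) ∈ ratSpace β n := by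
  induction n with
  | zero => simpa [blaschkeProd] using one_mem_ratSpace
  | succ n ih =>
    convert mul_mem_ratSpace hβ ih (-(disk.zconst (β (n + 1)) * β (n + 1))) (disk.zconst (β (n + 1)))
      using 1
    ext u
    rw [blaschkeProd_succ, zeta_disk_coe]
    ring

/-- The reproducing kernel of the rational functions, as an element of the space. -/
lemma kernel_mem_ratSpace (hβ : ∀ n, ‖β n‖ < 1) {z : ℂ} (hz : ‖z‖ < 1) (n : ℕ) :
    (fun u : Circle => (1 - star (disk.blaschkeProd β n z) * disk.blaschkeProd β n u) /
      (1 - star z * (u : ℂ))) ∈ ratSpace β n := by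
  induction n with
  | zero =>
    convert (ratSpace β 0).zero_mem using 1
    ext u
    simp [blaschkeProd]
  | succ n ih =>
    have h1 := ratSpace_mono hβ n.le_succ ih
    -- Christoffel–Darboux increment: consecutive kernels differ by `conj B_n(z) B_n(u) (1 - |b|²) /
    -- ((1 - b conj z)(1 - conj b u))` with `b = β_{n+1}`.
    have h2 := (ratSpace β (n + 1)).smul_mem (star (disk.blaschkeProd β n z) * (1 - star (β (n + 1)) *
      β (n + 1)) / (1 - β (n + 1) * star z)) (mul_mem_ratSpace hβ (blaschkeProd_mem_ratSpace hβ n) 1 0)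
    convert (ratSpace β (n + 1)).add_mem h1 h2 using 1
    ext u
    have h3 := one_sub_star_mul_circle_ne_zero hz u
    have h4 := one_sub_star_mul_circle_ne_zero (hβ (n + 1)) u
    have h5 : 1 - β (n + 1) * star z ≠ 0 := by
      have := star_ne_zero.mpr (one_sub_star_mul_ne_zero (hβ (n + 1)) hz.le)
      simpa [mul_comm] using this
    have h6 := star_zconst_disk_mul_self (β (n + 1))
    simp only [Pi.add_apply, Pi.smul_apply, smul_eq_mul, blaschkeProd_succ, zeta_disk_coe, star_mul',
      star_div₀, star_sub, star_one, star_star, zero_mul, add_zero]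
    set B := disk.blaschkeProd β n u
    set B' := star (disk.blaschkeProd β n z)
    set b := β (n + 1)
    rw [← sub_eq_zero]
    have h7 : B' * (star (disk.zconst b) * ((star z - star b) / (1 - b * star z))) *
        (B * (disk.zconst b * ((u - b) / (1 - star b * u)))) =
        B' * B * ((star z - star b) * (u - b) / ((1 - b * star z) * (1 - star b * u))) := by
      rw [mul_div_mul_comm]
      linear_combination (B' * B * ((star z - star b) / (1 - b * star z)) *
        ((u - b) / (1 - star b * u))) * h6
    rw [h7]
    have h8 : 1 - star z * b ≠ 0 := by rwa [mul_comm]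
    field_simp
    ring

/-- The Cauchy kernel is the reproducing kernel, on which the solutions agree, plus a remainder
bounded by `|B_n(z)| / (1 - |z|)` on the circle. -/
lemma norm_circleCauchy_sub_le (hβ : ∀ n, ‖β n‖ < 1) {μ ν : ProbabilityMeasure Circle}
    (hμ : μ ∈ circleSolutions β γ) (hν : ν ∈ circleSolutions β γ) {z : ℂ} (hz : ‖z‖ < 1) (n : ℕ) :
    ‖∫ u : Circle, 1 / (1 - star z * (u : ℂ)) ∂(μ : Measure Circle) -
      ∫ u : Circle, 1 / (1 - star z * (u : ℂ)) ∂(ν : Measure Circle)‖ ≤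
      2 * (‖disk.blaschkeProd β n z‖ / (1 - ‖z‖)) := by
  have hK := integral_eq_of_mem_ratSpace hβ hμ hν (kernel_mem_ratSpace hβ hz n)
  have hcB : Continuous fun u : Circle => disk.blaschkeProd β n u :=
    continuous_circle_of_differentiableAt fun z hz => differentiableAt_blaschkeProd hβ n hz
  have hc1 : Continuous fun u : Circle =>
      (1 - star (disk.blaschkeProd β n z) * disk.blaschkeProd β n u) / (1 - star z * (u : ℂ)) :=
    Continuous.div (continuous_const.sub (continuous_const.mul hcB)) (by fun_prop)
      (one_sub_star_mul_circle_ne_zero hz)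
  have hc2 : Continuous fun u : Circle =>
      star (disk.blaschkeProd β n z) * disk.blaschkeProd β n u / (1 - star z * (u : ℂ)) :=
    Continuous.div (continuous_const.mul hcB) (by fun_prop) (one_sub_star_mul_circle_ne_zero hz)
  have hsplit : ∀ ρ : ProbabilityMeasure Circle,
      ∫ u : Circle, 1 / (1 - star z * (u : ℂ)) ∂(ρ : Measure Circle) =
      ∫ u : Circle, (1 - star (disk.blaschkeProd β n z) * disk.blaschkeProd β n u) /
        (1 - star z * (u : ℂ)) ∂(ρ : Measure Circle) +
      ∫ u : Circle, star (disk.blaschkeProd β n z) * disk.blaschkeProd β n u /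
        (1 - star z * (u : ℂ)) ∂(ρ : Measure Circle) := by
    intro ρ
    rw [← integral_add (integrable_circle _ hc1) (integrable_circle _ hc2)]
    congr 1
    ext u
    rw [← add_div, sub_add_cancel]
  have hbd : ∀ ρ : ProbabilityMeasure Circle,
      ‖∫ u : Circle, star (disk.blaschkeProd β n z) * disk.blaschkeProd β n u /
        (1 - star z * (u : ℂ)) ∂(ρ : Measure Circle)‖ ≤ ‖disk.blaschkeProd β n z‖ / (1 - ‖z‖) := by
    intro ρ
    have h1 := norm_integral_le_of_norm_le_const (μ := (ρ : Measure Circle))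
      (C := ‖disk.blaschkeProd β n z‖ / (1 - ‖z‖))
      (f := fun u : Circle => star (disk.blaschkeProd β n z) * disk.blaschkeProd β n u /
        (1 - star z * (u : ℂ))) (Eventually.of_forall fun u => by
        have h2 := norm_one_sub_star_mul_circle_ge z u
        have h3 : ‖disk.blaschkeProd β n u‖ = 1 := by
          rw [blaschkeProd, norm_prod]
          exact Finset.prod_eq_one fun k _ => norm_zeta_disk_eq_one (hβ _) u.norm_coe
        rw [norm_div, norm_mul, norm_star, h3, mul_one]
        exact div_le_div_of_nonneg_left (norm_nonneg _) (by linarith) h2)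
    simpa using h1
  rw [hsplit μ, hsplit ν, hK, add_sub_add_left_eq_sub]
  refine (norm_sub_le _ _).trans ?_
  linarith [hbd μ, hbd ν]

/-- Otherwise `|B_n(z)|` gets arbitrarily small at each `z`, so the Cauchy transforms coincide,
hence all moments and the measures. -/
lemma exists_le_norm_blaschkeProd (hβ : ∀ n, ‖β n‖ < 1) {μ ν : ProbabilityMeasure Circle}
    (hμ : μ ∈ circleSolutions β γ) (hν : ν ∈ circleSolutions β γ) (hne : μ ≠ ν) :
    ∃ z : ℂ, ‖z‖ < 1 ∧ ∃ p > 0, ∀ n, p ≤ ‖disk.blaschkeProd β n z‖ := by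
  by_contra hcon
  push Not at hcon
  apply hne
  apply Subtype.ext
  change (μ : Measure Circle) = (ν : Measure Circle)
  apply measure_circle_ext
  apply integral_pow_eq_of_cauchy
  intro z hz
  rw [← sub_eq_zero, ← norm_le_zero_iff]
  apply le_of_forall_pos_le_add
  intro ε hε
  obtain ⟨n, hn⟩ := hcon z hz (ε * (1 - ‖z‖) / 2) (by have : 0 < 1 - ‖z‖ := by linarith
                                                      positivity)
  refine (norm_circleCauchy_sub_le hβ hμ hν hz n).trans ?_
  have h1 : 0 < 1 - ‖z‖ := by linarith
  rw [zero_add, ← mul_div_assoc, div_le_iff₀ h1]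
  linarith

/-- In the indeterminate case the `β_n` satisfy the Blaschke condition. -/
lemma summable_of_circleSolutions (hβ : ∀ n, ‖β n‖ < 1) (h : (circleSolutions β γ).Nontrivial) :
    Summable fun n => 1 - ‖β (n + 1)‖ ^ 2 := by
  obtain ⟨μ, hμ, ν, hν, hne⟩ := h
  obtain ⟨z, hz, p, hp, hB⟩ := exists_le_norm_blaschkeProd hβ hμ hν hne
  have hle := fun n => norm_zeta_disk_le_one (hβ n) hz.le
  have h1 : Summable fun n => 1 - ‖disk.zeta (β (n + 1)) (z : OnePoint ℂ)‖ := by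
    refine summable_of_le_prod_one_sub (fun n => sub_nonneg.mpr (hle _))
      (fun n => sub_le_self _ (norm_nonneg _)) hp fun n => ?_
    simpa [blaschkeProd] using hB n
  -- The `8` comes from `|1 - conj β z|² ≤ 4` and `1 - |ζ|² ≤ 2 (1 - |ζ|)`.
  refine Summable.of_nonneg_of_le (fun n => (one_sub_norm_sq_pos (hβ _)).le) (fun n => ?_)
    (h1.mul_left (8 / (1 - ‖z‖ ^ 2)))
  have h2 := one_sub_norm_zeta_sq (hβ (n + 1)) hz.le
  have h3 := one_sub_norm_sq_pos hz
  have h4 := one_sub_norm_sq_pos (hβ (n + 1))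
  have h5 := norm_pos_iff.mpr (one_sub_star_mul_ne_zero (hβ (n + 1)) hz.le)
  have h6 : ‖1 - star (β (n + 1)) * z‖ ≤ 2 := by
    refine (norm_sub_le _ _).trans ?_
    rw [norm_one, norm_mul, norm_star]
    nlinarith [hβ (n + 1), norm_nonneg (β (n + 1)), norm_nonneg z]
  rw [eq_div_iff (by positivity)] at h2
  rw [div_mul_eq_mul_div, le_div_iff₀ h3, ← h2]
  have h7 := hle (n + 1)
  have h8 := norm_nonneg (disk.zeta (β (n + 1)) (z : OnePoint ℂ))
  have h9 : ‖1 - star (β (n + 1)) * z‖ ^ 2 ≤ 4 := by nlinarith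
  calc _ ≤ (1 - ‖disk.zeta (β (n + 1)) (z : OnePoint ℂ)‖ ^ 2) * 4 := by
        apply mul_le_mul_of_nonneg_left h9; nlinarith
    _ ≤ _ := by nlinarith

/-- `1 - |ζ_{β_n}(z)| ≤ (1 - |β_n|²)/(1 - |z|)²` is summable, and avoiding the `β_n` keeps every
factor nonzero. -/
lemma exists_le_norm_blaschkeProd_of_summable (hβ : ∀ n, ‖β n‖ < 1)
    (hsum : Summable fun n => 1 - ‖β (n + 1)‖ ^ 2) {z : ℂ} (hz : ‖z‖ < 1) (hne : ∀ n, z ≠ β n) :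
    ∃ p > 0, ∀ n, p ≤ ‖disk.blaschkeProd β n z‖ := by
  have hle := fun n => norm_zeta_disk_le_one (hβ n) hz.le
  have hz1 : 0 < 1 - ‖z‖ := by linarith
  obtain ⟨p, hp, h⟩ := exists_pos_le_prod_one_sub
    (x := fun n => 1 - ‖disk.zeta (β (n + 1)) (z : OnePoint ℂ)‖) (fun n => sub_nonneg.mpr (hle _))
    (fun n => by
      have h1 : disk.zeta (β (n + 1)) (z : OnePoint ℂ) ≠ 0 := by
        rw [zeta_disk_coe]
        refine mul_ne_zero ?_ (div_ne_zero (sub_ne_zero.mpr (hne _))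
          (one_sub_star_mul_ne_zero (hβ _) hz.le))
        rw [← norm_ne_zero_iff, norm_zconst_disk]
        exact one_ne_zero
      have := norm_pos_iff.mpr h1
      linarith)
    (by
      refine Summable.of_nonneg_of_le (fun n => sub_nonneg.mpr (hle _)) (fun n => ?_)
        (hsum.mul_left (1 / (1 - ‖z‖) ^ 2))
      have h2 := one_sub_norm_zeta_sq (hβ (n + 1)) hz.le
      have h4 := one_sub_norm_sq_pos (hβ (n + 1))
      have h5 : 1 - ‖z‖ ≤ ‖1 - star (β (n + 1)) * z‖ := by
        have h6 := norm_sub_norm_le (1 : ℂ) (star (β (n + 1)) * z)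
        rw [norm_one, norm_mul, norm_star] at h6
        nlinarith [hβ (n + 1), norm_nonneg (β (n + 1)), norm_nonneg z]
      have h7 := hle (n + 1)
      have h8 := norm_nonneg (disk.zeta (β (n + 1)) (z : OnePoint ℂ))
      calc _ ≤ 1 - ‖disk.zeta (β (n + 1)) (z : OnePoint ℂ)‖ ^ 2 := by nlinarith
        _ = (1 - ‖β (n + 1)‖ ^ 2) * (1 - ‖z‖ ^ 2) / ‖1 - star (β (n + 1)) * z‖ ^ 2 := h2
        _ ≤ (1 - ‖β (n + 1)‖ ^ 2) * 1 / (1 - ‖z‖) ^ 2 := by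
            gcongr
            nlinarith [norm_nonneg z]
        _ = _ := by ring)
  exact ⟨p, hp, fun n => by simpa [blaschkeProd] using h n⟩

end disk

/-! ### The coordinate `ζ₀` -/

/-- The conformal coordinate `ζ₀` on the domain. -/
noncomputable def coord (s : RSetting) (z : ℂ) : ℂ := s.zeta s.base (z : OnePoint ℂ)

lemma coord_disk (z : ℂ) : disk.coord z = z := by
  rw [coord, zeta_disk_coe, zconst_base]
  simp [base]

/-- The Cayley transform maps `u` to `t`, in homogeneous coordinates. -/
def IsCayley (t : OnePoint ℂ) (u : ℂ) : Prop :=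
  ∃ l : ℂ, l ≠ 0 ∧ hx t = l * (Complex.I * (1 + u)) ∧ hy t = l * (1 - u)

lemma add_I_ne_zero {a : ℂ} (ha : 0 ≤ a.im) : a + Complex.I ≠ 0 := by
  intro h
  have := congrArg Complex.im h
  simp at this
  linarith

lemma I_sub_star_ne_zero {a : ℂ} (ha : 0 ≤ a.im) : Complex.I - star a ≠ 0 := by
  intro h
  have := congrArg Complex.im h
  simp at this
  linarith

lemma isCayley_coe {z : ℂ} (hz : z + Complex.I ≠ 0) :
    IsCayley (z : OnePoint ℂ) ((z - Complex.I) / (z + Complex.I)) := by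
  refine ⟨(z + Complex.I) / (2 * Complex.I), div_ne_zero hz (by simp), ?_, ?_⟩
  · change z = _
    field_simp
    ring
  · change (1 : ℂ) = _
    field_simp
    ring

/-- The scalar `l` depends on the point only, not on `a`, so it cancels in every quotient of two
linear forms, at `∞` as well. -/
lemma IsCayley.varpi_eq {t : OnePoint ℂ} {u : ℂ} (h : IsCayley t u) :
    ∃ l : ℂ, l ≠ 0 ∧ ∀ a : ℂ, 0 < a.im →
      halfPlane.varpi a t = l * (Complex.I - star a) *
        (1 - star ((a - Complex.I) / (a + Complex.I)) * u) ∧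
      varpiStar a t = l * (a + Complex.I) * (u - (a - Complex.I) / (a + Complex.I)) := by
  obtain ⟨l, hl, h1, h2⟩ := h
  refine ⟨l, hl, fun a ha => ?_⟩
  have h3 := add_I_ne_zero ha.le
  have h4 : star a - Complex.I ≠ 0 := by
    have := I_sub_star_ne_zero ha.le
    rw [← neg_sub]
    exact neg_ne_zero.mpr this
  have h5 : star ((a - Complex.I) / (a + Complex.I)) = (star a + Complex.I) / (star a - Complex.I) := by
    simp [sub_eq_add_neg]
  constructor
  · rw [varpi, h1, h2, h5]
    field_simp
    ring
  · rw [varpiStar, h1, h2]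
    field_simp
    ring

lemma base_halfPlane : halfPlane.base = Complex.I := rfl

lemma norm_I_sub_star (a : ℂ) : ‖Complex.I - star a‖ = ‖a + Complex.I‖ := by
  rw [← norm_star]
  simp only [star_sub, star_star]
  rw [Complex.star_def, Complex.conj_I, ← norm_neg]
  congr 1
  ring

/-- The constants `z_a` of the two settings are matched: the Blaschke factors correspond with no
leftover unimodular factor, and so do the Wall functions. -/
lemma zconst_halfPlane {a : ℂ} (ha : 0 < a.im) :
    halfPlane.zconst a * (a + Complex.I) = disk.zconst ((a - Complex.I) / (a + Complex.I)) *
      (Complex.I - star a) := by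
  have h3 := add_I_ne_zero ha.le
  by_cases h : a = Complex.I
  · subst h
    rw [← base_halfPlane, zconst_base, base_halfPlane, sub_self, zero_div]
    have : disk.zconst 0 = 1 := disk.zconst_base
    rw [this]
    simp
  · have h1 : (a - Complex.I) / (a + Complex.I) ≠ 0 := div_ne_zero (sub_ne_zero.mpr h) h3
    have h1' : (a - Complex.I) / (a + Complex.I) ≠ disk.base := h1
    have h' : a ≠ halfPlane.base := h
    have h2 : 1 + a ^ 2 = (a - Complex.I) * (a + Complex.I) := by
      linear_combination Complex.I_sq
    have h4 := sub_ne_zero.mpr h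
    simp only [zconst, if_neg h', if_neg h1']
    rw [h2, norm_mul, norm_div]
    have h5 := norm_ne_zero_iff.mpr h3
    have h6 := norm_ne_zero_iff.mpr h4
    have h7 := Complex.mul_conj' (a + Complex.I)
    have h8 : (starRingEnd ℂ) (a + Complex.I) = -(Complex.I - star a) := by
      simp [sub_eq_add_neg]
    rw [h8] at h7
    push_cast
    have h9 : (‖a + Complex.I‖ : ℂ) ≠ 0 := by exact_mod_cast h5
    field_simp
    linear_combination (-(‖a - Complex.I‖ : ℂ)) * h7

lemma IsCayley.zeta_eq {t : OnePoint ℂ} {u : ℂ} (h : IsCayley t u) {a : ℂ} (ha : 0 < a.im) :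
    halfPlane.zeta a t = disk.zeta ((a - Complex.I) / (a + Complex.I)) (u : OnePoint ℂ) := by
  obtain ⟨l, hl, h1⟩ := h.varpi_eq
  obtain ⟨h2, h3⟩ := h1 a ha
  have h4 := I_sub_star_ne_zero ha.le
  have h5 := zconst_halfPlane ha
  have h6 := add_I_ne_zero ha.le
  rw [zeta, h2, h3, zeta_disk_coe, mul_assoc l, mul_assoc l, mul_div_mul_left _ _ hl, ← mul_div_assoc,
    ← mul_assoc, h5, mul_div_assoc, mul_assoc, ← mul_div_assoc, mul_div_mul_left _ _ h4]

lemma coord_halfPlane {z : ℂ} (hz : 0 < z.im) :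
    halfPlane.coord z = (z - Complex.I) / (z + Complex.I) := by
  rw [coord, (isCayley_coe (add_I_ne_zero hz.le)).zeta_eq (by simp [base_halfPlane]), base_halfPlane,
    sub_self, zero_div]
  exact coord_disk _

lemma norm_coord_lt_one {s : RSetting} {z : ℂ} (hz : z ∈ s.dom) : ‖s.coord z‖ < 1 := by
  cases s with
  | disk => rw [coord_disk]; exact hz
  | halfPlane =>
    have hz' : 0 < z.im := hz
    have h := norm_pos_iff.mpr (add_I_ne_zero hz'.le)
    rw [coord_halfPlane hz', norm_div, div_lt_one h]
    apply lt_of_pow_lt_pow_left₀ 2 (norm_nonneg _)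
    rw [← Complex.normSq_eq_norm_sq, ← Complex.normSq_eq_norm_sq, Complex.normSq_apply,
      Complex.normSq_apply]
    simp
    nlinarith

lemma coord_injOn (s : RSetting) : Set.InjOn s.coord s.dom := by
  intro z hz w hw h
  cases s with
  | disk => rwa [coord_disk, coord_disk] at h
  | halfPlane =>
    have hz' : 0 < z.im := hz
    have hw' : 0 < w.im := hw
    have h1 := add_I_ne_zero hz'.le
    have h2 := add_I_ne_zero hw'.le
    rw [coord_halfPlane hz', coord_halfPlane hw', div_eq_div_iff h1 h2] at h
    have h3 : (2 * Complex.I) * z = (2 * Complex.I) * w := by linear_combination h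
    exact mul_left_cancel₀ (by simp) h3

lemma base_mem_dom (s : RSetting) : s.base ∈ s.dom := by
  cases s <;> simp [base, dom]

lemma coord_base (s : RSetting) : s.coord s.base = 0 := by
  cases s with
  | disk => exact coord_disk _
  | halfPlane =>
    rw [coord_halfPlane (by simp [base_halfPlane]), base_halfPlane, sub_self, zero_div]

lemma zeta_eq_disk {s : RSetting} {a z : ℂ} (ha : a ∈ s.dom) (hz : z ∈ s.dom) :
    s.zeta a (z : OnePoint ℂ) = disk.zeta (s.coord a) (s.coord z : OnePoint ℂ) := by
  cases s with
  | disk => rw [coord_disk, coord_disk]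
  | halfPlane =>
    have ha' : 0 < a.im := ha
    have hz' : 0 < z.im := hz
    rw [coord_halfPlane ha', coord_halfPlane hz', (isCayley_coe (add_I_ne_zero hz'.le)).zeta_eq ha']

lemma wall_eq_disk {s : RSetting} {α : ℕ → ℂ} (γ : ℕ → ℂ) {z : ℂ} (hα : ∀ n, α n ∈ s.dom)
    (hz : z ∈ s.dom) (n : ℕ) :
    s.wall α γ z n = disk.wall (fun n => s.coord (α n)) γ (s.coord z) n := by
  induction n with
  | zero => rfl
  | succ n ih => simp only [wall, ih, zeta_eq_disk (hα (n + 1)) hz]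

/-! ### The boundary as a circle -/

lemma im_cayley_circle {u : ℂ} (hu : ‖u‖ = 1) : (Complex.I * (1 + u) / (1 - u)).im = 0 := by
  rw [Complex.div_im, ← sub_div]
  have h : u.re * u.re + u.im * u.im = 1 := by
    rw [← Complex.normSq_apply, Complex.normSq_eq_norm_sq, hu, one_pow]
  simp
  left
  linear_combination -h

/-- The parametrization of the boundary by the unit circle. -/
noncomputable def ofCircle : (s : RSetting) → Circle → s.bdry
  | disk, u => ⟨((u : ℂ) : OnePoint ℂ), ⟨u, u.norm_coe, rfl⟩⟩
  | halfPlane, u => open Classical in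
    if u = 1 then ⟨OnePoint.infty, Or.inl rfl⟩
    else ⟨((Complex.I * (1 + u) / (1 - u) : ℂ) : OnePoint ℂ),
      Or.inr ⟨_, im_cayley_circle u.norm_coe, rfl⟩⟩

lemma one_sub_circle_ne_zero {u : Circle} (hu : u ≠ 1) : 1 - (u : ℂ) ≠ 0 := by
  intro h
  apply hu
  apply Circle.ext
  rw [Circle.coe_one]
  exact (sub_eq_zero.mp h).symm

lemma isCayley_ofCircle (u : Circle) : IsCayley (ofCircle halfPlane u : OnePoint ℂ) u := by
  by_cases hu : u = 1
  · subst hu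
    refine ⟨1 / (2 * Complex.I), by simp, ?_, ?_⟩
    · simp only [ofCircle, if_pos]
      change (1 : ℂ) = _
      rw [Circle.coe_one]
      field_simp
      ring
    · simp only [ofCircle, if_pos]
      change (0 : ℂ) = _
      simp
  · have h := one_sub_circle_ne_zero hu
    refine ⟨1 / (1 - u), by simpa using h, ?_, ?_⟩
    · simp only [ofCircle, if_neg hu]
      change Complex.I * (1 + u) / (1 - u) = _
      field_simp
    · simp only [ofCircle, if_neg hu]
      change (1 : ℂ) = _
      field_simp

lemma zeta_ofCircle {s : RSetting} {a : ℂ} (ha : a ∈ s.dom) (u : Circle) :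
    s.zeta a (s.ofCircle u : OnePoint ℂ) = disk.zeta (s.coord a) ((u : ℂ) : OnePoint ℂ) := by
  cases s with
  | disk => rw [coord_disk]; rfl
  | halfPlane =>
    have ha' : 0 < a.im := ha
    rw [coord_halfPlane ha', (isCayley_ofCircle u).zeta_eq ha']

lemma zeta_base_ofCircle (s : RSetting) (u : Circle) :
    s.zeta s.base (s.ofCircle u : OnePoint ℂ) = u := by
  rw [zeta_ofCircle s.base_mem_dom, coord_base]
  exact coord_disk _

lemma ofCircle_injective (s : RSetting) : Function.Injective s.ofCircle := by
  intro u v h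
  apply Circle.ext
  rw [← zeta_base_ofCircle s u, ← zeta_base_ofCircle s v, h]

lemma ofCircle_surjective (s : RSetting) : Function.Surjective s.ofCircle := by
  cases s with
  | disk =>
    rintro ⟨_, z, hz, rfl⟩
    exact ⟨⟨z, by simpa [Submonoid.unitSphere] using hz⟩, rfl⟩
  | halfPlane =>
    rintro ⟨_, rfl | ⟨z, hz, rfl⟩⟩
    · exact ⟨1, by simp [ofCircle]⟩
    · have hz' : z.im = 0 := hz
      have h1 := add_I_ne_zero hz'.ge
      have h2 : ‖(z - Complex.I) / (z + Complex.I)‖ = 1 := by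
        rw [norm_div, div_eq_one_iff_eq (norm_ne_zero_iff.mpr h1)]
        rw [Complex.norm_def, Complex.norm_def, Complex.normSq_apply, Complex.normSq_apply]
        simp [hz']
      let u : Circle := ⟨(z - Complex.I) / (z + Complex.I), by simpa [Submonoid.unitSphere] using h2⟩
      have hu : (u : ℂ) = (z - Complex.I) / (z + Complex.I) := rfl
      have h3 : 1 - (u : ℂ) = 2 * Complex.I / (z + Complex.I) := by
        rw [hu]
        field_simp
        ring
      have hne : u ≠ 1 := by
        intro h
        rw [h, Circle.coe_one, sub_self] at h3
        exact (div_ne_zero (by simp) h1) h3.symm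
      refine ⟨u, Subtype.ext ?_⟩
      simp only [ofCircle, if_neg hne]
      congr 1
      rw [h3, hu]
      field_simp
      ring

lemma continuous_ofCircle (s : RSetting) : Continuous s.ofCircle := by
  cases s with
  | disk =>
    refine Continuous.subtype_mk ?_ _
    exact OnePoint.continuous_coe.comp (by fun_prop)
  | halfPlane =>
    rw [continuous_induced_rng, continuous_iff_continuousAt]
    intro u
    have heq : ∀ v : Circle, v ≠ 1 → (Subtype.val ∘ ofCircle halfPlane) v =
        ((Complex.I * (1 + v) / (1 - v) : ℂ) : OnePoint ℂ) := by
      intro v hv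
      simp only [Function.comp_apply, ofCircle, if_neg hv]
    by_cases hu : u = 1
    · subst hu
      rw [continuousAt_iff_punctured_nhds]
      have h1 : (Subtype.val ∘ ofCircle halfPlane) 1 = OnePoint.infty := by simp [ofCircle]
      rw [h1]
      -- Near `1` the map is `2i/(1 - v) - i`, of norm at least `2/|1 - v| - 1`.
      have h2 : Tendsto (fun v : Circle => Complex.I * (1 + (v : ℂ)) / (1 - v)) (𝓝[≠] 1)
          (cocompact ℂ) := by
        rw [← Metric.cobounded_eq_cocompact, ← tendsto_norm_atTop_iff_cobounded]
        have h3 : Tendsto (fun v : Circle => 1 - (v : ℂ)) (𝓝[≠] 1) (𝓝[≠] 0) := by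
          apply tendsto_nhdsWithin_of_tendsto_nhds_of_eventually_within
          · have : Continuous fun v : Circle => 1 - (v : ℂ) := by fun_prop
            have h4 := this.tendsto 1
            rw [Circle.coe_one, sub_self] at h4
            exact h4.mono_left nhdsWithin_le_nhds
          · filter_upwards [self_mem_nhdsWithin] with v hv
            exact one_sub_circle_ne_zero hv
        have h4 := (tendsto_norm_cobounded_atTop.comp
          (Filter.tendsto_inv₀_nhdsNE_zero.comp h3)).const_mul_atTop (show (0 : ℝ) < 2 by norm_num)
        have h5 := tendsto_atTop_add_const_right _ (-1 : ℝ) h4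
        refine tendsto_atTop_mono' _ ?_ h5
        filter_upwards [self_mem_nhdsWithin] with v hv
        have h6 := one_sub_circle_ne_zero hv
        have h7 : Complex.I * (1 + (v : ℂ)) / (1 - v) =
            2 * Complex.I * (1 - (v : ℂ))⁻¹ - Complex.I := by
          field_simp
          ring
        rw [h7]
        have h8 := norm_sub_norm_le (2 * Complex.I * (1 - (v : ℂ))⁻¹) Complex.I
        rw [norm_mul, norm_mul, Complex.norm_I] at h8
        simp only [Function.comp_apply]
        norm_num at h8 ⊢
        linarith
      have h9 := OnePoint.tendsto_coe_infty.comp (by rwa [Filter.coclosedCompact_eq_cocompact] :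
        Tendsto (fun v : Circle => Complex.I * (1 + (v : ℂ)) / (1 - v)) (𝓝[≠] 1) (coclosedCompact ℂ))
      refine h9.congr' ?_
      filter_upwards [self_mem_nhdsWithin] with v hv
      exact (heq v hv).symm
    · have h1 : ContinuousAt (fun v : Circle => ((Complex.I * (1 + v) / (1 - v) : ℂ) : OnePoint ℂ)) u := by
        apply OnePoint.continuous_coe.continuousAt.comp
        exact ContinuousAt.div (by fun_prop) (by fun_prop) (one_sub_circle_ne_zero hu)
      refine h1.congr ?_
      filter_upwards [isOpen_ne.mem_nhds hu] with v hv
      exact (heq v hv).symm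

/-- The boundary is homeomorphic to the unit circle. -/
noncomputable def bdryHomeo (s : RSetting) : Circle ≃ₜ s.bdry :=
  Continuous.homeoOfEquivCompactToT2
    (f := Equiv.ofBijective s.ofCircle ⟨s.ofCircle_injective, s.ofCircle_surjective⟩)
    s.continuous_ofCircle

lemma bdryHomeo_apply (s : RSetting) (u : Circle) : s.bdryHomeo u = s.ofCircle u := rfl

lemma kernelD_ofCircle (s : RSetting) (u : Circle) (z : ℂ) :
    s.kernelD (s.ofCircle u : OnePoint ℂ) (z : OnePoint ℂ) = (u + s.coord z) / (u - s.coord z) := by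
  rw [kernelD, zeta_base_ofCircle]
  rfl

/-! ### Transport of the orthogonal rational functions -/

lemma norm_zconst {s : RSetting} {a : ℂ} (ha : a ∈ s.dom) : ‖s.zconst a‖ = 1 := by
  cases s with
  | disk => exact norm_zconst_disk a
  | halfPlane =>
    have ha' : 0 < a.im := ha
    have h := congrArg norm (zconst_halfPlane ha')
    have h1 := norm_ne_zero_iff.mpr (add_I_ne_zero ha'.le)
    rw [norm_mul, norm_mul, norm_zconst_disk, norm_I_sub_star] at h
    exact mul_right_cancel₀ h1 h

lemma star_zconst_mul_self {s : RSetting} {a : ℂ} (ha : a ∈ s.dom) :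
    star (s.zconst a) * s.zconst a = 1 := by
  rw [Complex.star_def, Complex.conj_mul', norm_zconst ha]
  simp

/-- Passing from `Φ_n` to `conj z_n Φ_n` removes the constants `z_n` from the recurrence, leaving
only quantities that transform simply under the Cayley map. -/
lemma orf_succ' {s : RSetting} {α : ℕ → ℂ} (γ : ℕ → ℂ) (hα : ∀ n, α n ∈ s.dom) (n : ℕ)
    (t : OnePoint ℂ) :
    star (s.zconst (α (n + 1))) * s.orf α γ (n + 1) t =
      (s.eCoef α γ n : ℂ) * (s.varpi (α n) t / s.varpi (α (n + 1)) t) *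
        (s.zeta (α n) t * (star (s.zconst (α n)) * s.orf α γ n t) - star (γ n) * s.orfStar α γ n t) ∧
    s.orfStar α γ (n + 1) t = (s.eCoef α γ n : ℂ) * (s.varpi (α n) t / s.varpi (α (n + 1)) t) *
        (s.orfStar α γ n t - γ n * (s.zeta (α n) t * (star (s.zconst (α n)) * s.orf α γ n t))) := by
  have h := star_zconst_mul_self (hα (n + 1))
  have hl : star (s.lam α γ n) = -(s.zconst (α (n + 1)) * star (γ n)) := by
    simp [lam]
  rw [orf_succ, orfStar_succ, hl, lam]
  set c := (s.eCoef α γ n : ℂ) * (s.varpi (α n) t / s.varpi (α (n + 1)) t)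
  constructor
  · linear_combination c * (s.zeta (α n) t * (star (s.zconst (α n)) * s.orf α γ n t) -
      star (γ n) * s.orfStar α γ n t) * h
  · linear_combination -(c * γ n * (s.zeta (α n) t * (star (s.zconst (α n)) * s.orf α γ n t))) * h

lemma one_sub_norm_cayley_sq {a : ℂ} (ha : 0 < a.im) :
    1 - ‖(a - Complex.I) / (a + Complex.I)‖ ^ 2 = 4 * a.im / ‖a + Complex.I‖ ^ 2 := by
  have h := norm_pos_iff.mpr (add_I_ne_zero ha.le)
  have h1 : ‖a + Complex.I‖ ^ 2 - ‖a - Complex.I‖ ^ 2 = 4 * a.im := by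
    rw [← Complex.normSq_eq_norm_sq, ← Complex.normSq_eq_norm_sq, Complex.normSq_apply,
      Complex.normSq_apply]
    simp
    ring
  rw [norm_div, div_pow, ← h1]
  field_simp

lemma norm_varpi_self_halfPlane {a : ℂ} (ha : 0 < a.im) :
    ‖halfPlane.varpi a (a : OnePoint ℂ)‖ = 2 * a.im := by
  have h : halfPlane.varpi a (a : OnePoint ℂ) = ((2 * a.im : ℝ) : ℂ) * Complex.I := by
    change a - star a * 1 = _
    apply Complex.ext <;> simp
    ring
  rw [h, norm_mul, Complex.norm_I, Complex.norm_real, mul_one, Real.norm_of_nonneg (by positivity)]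

lemma eCoef_halfPlane {α : ℕ → ℂ} (γ : ℕ → ℂ) (hα : ∀ n, 0 < (α n).im) (n : ℕ) :
    halfPlane.eCoef α γ n = ‖α (n + 1) + Complex.I‖ / ‖α n + Complex.I‖ *
      disk.eCoef (fun n => halfPlane.coord (α n)) γ n := by
  have h1 := norm_pos_iff.mpr (add_I_ne_zero (hα n).le)
  have h2 := norm_pos_iff.mpr (add_I_ne_zero (hα (n + 1)).le)
  rw [eCoef, eCoef, norm_varpi_self_halfPlane (hα _), norm_varpi_self_halfPlane (hα _),
    norm_varpi_self (norm_coord_lt_one (s := halfPlane) (hα _)),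
    norm_varpi_self (norm_coord_lt_one (s := halfPlane) (hα _)),
    coord_halfPlane (hα _), coord_halfPlane (hα _), one_sub_norm_cayley_sq (hα _),
    one_sub_norm_cayley_sq (hα _)]
  rw [← Real.sqrt_sq (show 0 ≤ ‖α (n + 1) + Complex.I‖ / ‖α n + Complex.I‖ by positivity),
    ← Real.sqrt_mul (by positivity)]
  congr 1
  have h3 := hα n
  have h4 := hα (n + 1)
  field_simp

/-- `e_{n+1}` and the quotient of the `ϖ` change exactly by the ratio of successive values of the
unimodular number `i |α_n + i| / (i - conj α_n)`, whose `i` makes it `1` at `α_0 = i`. -/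
lemma orf_halfPlane {α : ℕ → ℂ} (γ : ℕ → ℂ) (hα0 : α 0 = Complex.I) (hα : ∀ n, 0 < (α n).im) {t : OnePoint ℂ}
    {u : Circle} (ht : IsCayley t u) (n : ℕ) :
    star (halfPlane.zconst (α n)) * halfPlane.orf α γ n t =
      Complex.I * ‖α n + Complex.I‖ / (Complex.I - star (α n)) *
        (star (disk.zconst (halfPlane.coord (α n))) *
          disk.orf (fun n => halfPlane.coord (α n)) γ n ((u : ℂ) : OnePoint ℂ)) ∧
    halfPlane.orfStar α γ n t = Complex.I * ‖α n + Complex.I‖ / (Complex.I - star (α n)) *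
        disk.orfStar (fun n => halfPlane.coord (α n)) γ n ((u : ℂ) : OnePoint ℂ) := by
  induction n with
  | zero =>
    have h1 : Complex.I * (‖Complex.I + Complex.I‖ : ℂ) / (Complex.I - star Complex.I) = 1 := by
      have h : Complex.I - star Complex.I = 2 * Complex.I := by
        simp
        ring
      rw [h, ← two_mul, norm_mul, Complex.norm_I, Complex.norm_ofNat]
      push_cast
      field_simp
    have h2 := coord_base halfPlane
    rw [base_halfPlane] at h2
    have h3 : disk.zconst 0 = 1 := disk.zconst_base
    have h4 : halfPlane.zconst Complex.I = 1 := halfPlane.zconst_base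
    rw [hα0, h1, h2, h3, h4]
    simp [orf_zero, orfStar_zero]
  | succ n ih =>
    obtain ⟨ih1, ih2⟩ := ih
    obtain ⟨h1, h2⟩ := orf_succ' (s := halfPlane) γ hα n t
    obtain ⟨h3, h4⟩ := orf_succ' (s := disk) (α := fun n => halfPlane.coord (α n)) γ
      (fun n => norm_coord_lt_one (s := halfPlane) (hα n)) n ((u : ℂ) : OnePoint ℂ)
    have hζ : halfPlane.zeta (α n) t = disk.zeta (halfPlane.coord (α n)) ((u : ℂ) : OnePoint ℂ) := by
      rw [coord_halfPlane (hα n), ht.zeta_eq (hα n)]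
    have hI := fun n => I_sub_star_ne_zero (hα n).le
    have hv : halfPlane.varpi (α n) t / halfPlane.varpi (α (n + 1)) t =
        (Complex.I - star (α n)) / (Complex.I - star (α (n + 1))) *
          (disk.varpi (halfPlane.coord (α n)) ((u : ℂ) : OnePoint ℂ) /
            disk.varpi (halfPlane.coord (α (n + 1))) ((u : ℂ) : OnePoint ℂ)) := by
      obtain ⟨l, hl, h⟩ := ht.varpi_eq
      rw [(h _ (hα n)).1, (h _ (hα (n + 1))).1, coord_halfPlane (hα n), coord_halfPlane (hα (n + 1)),
        varpi_disk_coe, varpi_disk_coe, mul_assoc l, mul_assoc l, mul_div_mul_left _ _ hl,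
        mul_div_mul_comm]
    have hN : (‖α n + Complex.I‖ : ℂ) ≠ 0 := by
      exact_mod_cast norm_ne_zero_iff.mpr (add_I_ne_zero (hα n).le)
    have hcoef : (halfPlane.eCoef α γ n : ℂ) *
        (halfPlane.varpi (α n) t / halfPlane.varpi (α (n + 1)) t) *
          (Complex.I * ‖α n + Complex.I‖ / (Complex.I - star (α n))) =
        Complex.I * ‖α (n + 1) + Complex.I‖ / (Complex.I - star (α (n + 1))) *
          ((disk.eCoef (fun n => halfPlane.coord (α n)) γ n : ℂ) *
            (disk.varpi (halfPlane.coord (α n)) ((u : ℂ) : OnePoint ℂ) /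
            disk.varpi (halfPlane.coord (α (n + 1))) ((u : ℂ) : OnePoint ℂ))) := by
      have h5 := hI n
      have h6 := hI (n + 1)
      rw [hv, eCoef_halfPlane γ hα]
      generalize disk.varpi (halfPlane.coord (α n)) ((u : ℂ) : OnePoint ℂ) /
            disk.varpi (halfPlane.coord (α (n + 1))) ((u : ℂ) : OnePoint ℂ) = V
      push_cast
      field_simp
    rw [h1, h2, h3, h4, ih1, ih2, hζ]
    constructor
    · linear_combination hcoef * (disk.zeta (halfPlane.coord (α n)) ((u : ℂ) : OnePoint ℂ) *
        (star (disk.zconst (halfPlane.coord (α n))) *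
          disk.orf (fun n => halfPlane.coord (α n)) γ n ((u : ℂ) : OnePoint ℂ)) -
          star (γ n) * disk.orfStar (fun n => halfPlane.coord (α n)) γ n ((u : ℂ) : OnePoint ℂ))
    · linear_combination hcoef * (disk.orfStar (fun n => halfPlane.coord (α n)) γ n ((u : ℂ) : OnePoint ℂ) -
        γ n * (disk.zeta (halfPlane.coord (α n)) ((u : ℂ) : OnePoint ℂ) *
        (star (disk.zconst (halfPlane.coord (α n))) *
          disk.orf (fun n => halfPlane.coord (α n)) γ n ((u : ℂ) : OnePoint ℂ))))

/-- The rational functions `Φ_n` correspond to those of the disk up to unimodular constants. -/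
lemma exists_orf_ofCircle {s : RSetting} {α : ℕ → ℂ} (γ : ℕ → ℂ) (hα0 : α 0 = s.base)
    (hα : ∀ n, α n ∈ s.dom) : ∃ c : ℕ → ℂ, (∀ n, ‖c n‖ = 1) ∧ ∀ n u,
      s.orf α γ n (s.ofCircle u : OnePoint ℂ) =
        c n * disk.orf (fun n => s.coord (α n)) γ n ((u : ℂ) : OnePoint ℂ) := by
  cases s with
  | disk => exact ⟨fun _ => 1, fun _ => norm_one, fun n u => by simp only [coord_disk, one_mul]; rfl⟩
  | halfPlane =>
    have hα' : ∀ n, 0 < (α n).im := hα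
    refine ⟨fun n => halfPlane.zconst (α n) * (Complex.I * ‖α n + Complex.I‖ /
      (Complex.I - star (α n)) * star (disk.zconst (halfPlane.coord (α n)))), fun n => ?_, fun n u => ?_⟩
    · have h := norm_ne_zero_iff.mpr (add_I_ne_zero (hα' n).le)
      rw [norm_mul, norm_zconst (hα n), norm_mul, norm_star, norm_zconst_disk, norm_div,
        norm_I_sub_star, norm_mul, Complex.norm_I]
      simp [h]
    · have h := (orf_halfPlane γ hα0 hα' (isCayley_ofCircle u) n).1
      have h1 := star_zconst_mul_self (hα n)
      linear_combination halfPlane.zconst (α n) * h -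
        halfPlane.orf α γ n (halfPlane.ofCircle u : OnePoint ℂ) * h1

/-! ### Transport of measures -/

lemma withDensity_map {X Y : Type*} [MeasurableSpace X] [MeasurableSpace Y] (μ : Measure X) {f : X → Y}
    (hf : Measurable f) {g : Y → ENNReal} (hg : Measurable g) :
    (μ.map f).withDensity g = (μ.withDensity fun x => g (f x)).map f := by
  ext t ht
  rw [withDensity_apply _ ht, Measure.map_apply hf ht, withDensity_apply _ (hf ht),
    setLIntegral_map ht hg hf]

/-- The density of harmonic measure at `b` with respect to arc length. -/
noncomputable def poissonDensity (b : ℂ) (u : Circle) : ENNReal :=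
  ENNReal.ofReal ((1 - ‖b‖ ^ 2) / ‖(u : ℂ) - b‖ ^ 2)

lemma measurable_poissonDensity (b : ℂ) : Measurable (poissonDensity b) := by
  apply Measurable.ennreal_ofReal
  apply Measurable.div measurable_const
  exact (by fun_prop : Continuous fun u : Circle => ‖(u : ℂ) - b‖ ^ 2).measurable

/-- By the mean value property at `0`, the functions `(z ξ)^k` and `z^k` have the same integral. -/
lemma arcMeas_map_mul (ξ : Circle) : arcMeas.map (fun u => u * ξ) = arcMeas := by
  have hm : Measurable fun u : Circle => u * ξ := (by fun_prop : Continuous fun u : Circle => u * ξ).measurable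
  have := Measure.isProbabilityMeasure_map (μ := arcMeas) hm.aemeasurable
  apply measure_circle_ext
  intro k
  rw [integral_map hm.aemeasurable
    (by fun_prop : Continuous fun u : Circle => (u : ℂ) ^ k).aestronglyMeasurable]
  have h1 := integral_arcMeas_eq_center (f := fun z => (z * (ξ : ℂ)) ^ k) fun z _ => by fun_prop
  have h2 := integral_arcMeas_eq_center (f := fun z => z ^ k) fun z _ => by fun_prop
  simp only [Circle.coe_mul]
  rw [h1, h2, zero_mul]

/-- The point of the circle corresponding to a real number. -/
noncomputable def circleOfReal (x : ℝ) : Circle := Circle.exp (2 * Real.arctan x) * Circle.exp Real.pi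

lemma coe_circleOfReal (x : ℝ) :
    (circleOfReal x : ℂ) = ((x : ℂ) - Complex.I) / (x + Complex.I) := by
  have h0 : (0 : ℝ) < 1 + x ^ 2 := by positivity
  have h1 : ((x : ℂ) + Complex.I) ≠ 0 := add_I_ne_zero (by simp)
  have h2 : Complex.exp (Real.arctan x * Complex.I) = (1 + x * Complex.I) / (√(1 + x ^ 2) : ℝ) := by
    rw [Complex.exp_mul_I, ← Complex.ofReal_cos, ← Complex.ofReal_sin, Real.cos_arctan, Real.sin_arctan]
    push_cast
    ring
  have h3 : ((√(1 + x ^ 2) : ℝ) : ℂ) ^ 2 = 1 + x ^ 2 := by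
    rw [← Complex.ofReal_pow, Real.sq_sqrt h0.le]
    push_cast
    ring
  have h4 : (1 + (x : ℂ) ^ 2) ≠ 0 := by exact_mod_cast h0.ne'
  have h5 : Complex.exp ((2 * Real.arctan x : ℝ) * Complex.I) = (1 + x * Complex.I) ^ 2 / (1 + x ^ 2) := by
    have : ((2 * Real.arctan x : ℝ) : ℂ) * Complex.I = 2 * (Real.arctan x * Complex.I) := by
      push_cast; ring
    rw [this, two_mul, Complex.exp_add, ← sq, h2, div_pow, h3]
  rw [circleOfReal, Circle.coe_mul, Circle.coe_exp, Circle.coe_exp, Complex.exp_pi_mul_I, h5]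
  rw [div_mul_eq_mul_div, div_eq_div_iff h4 h1]
  linear_combination (-(x : ℂ) ^ 3 - 2 * x - Complex.I * (x : ℂ) ^ 2) * Complex.I_sq

lemma ofCircle_circleOfReal (x : ℝ) : halfPlane.ofCircle (circleOfReal x) = realPt x := by
  obtain ⟨u, hu⟩ := halfPlane.ofCircle_surjective (realPt x)
  have h1 := zeta_base_ofCircle halfPlane u
  have h2 := (isCayley_coe (z := (x : ℂ)) (add_I_ne_zero (by simp))).zeta_eq
    (a := Complex.I) (by simp)
  rw [sub_self, zero_div] at h2
  have h3 : (u : ℂ) = circleOfReal x := by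
    rw [← h1, hu, coe_circleOfReal]
    exact h2.trans (coord_disk _)
  rw [← hu, Circle.ext h3]

lemma continuous_circleOfReal : Continuous circleOfReal := by
  unfold circleOfReal
  fun_prop

lemma map_arctan_restrict :
    Measure.map (fun x : ℝ => 2 * Real.arctan x)
      ((volume : Measure ℝ).withDensity fun x => ENNReal.ofReal (2 / (1 + x ^ 2))) =
      volume.restrict (Set.Ioc (-Real.pi) Real.pi) := by
  have hd : ∀ x ∈ (Set.univ : Set ℝ), HasDerivWithinAt (fun x : ℝ => 2 * Real.arctan x)
      (2 / (1 + x ^ 2)) Set.univ x := fun x _ => by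
    have := (Real.hasDerivAt_arctan x).const_mul 2
    rw [← mul_div_assoc, mul_one] at this
    exact this.hasDerivWithinAt
  have hinj : Set.InjOn (fun x : ℝ => 2 * Real.arctan x) Set.univ := fun x _ y _ h =>
    Real.arctan_injective (mul_left_cancel₀ two_ne_zero h)
  have h := map_withDensity_abs_det_fderiv_eq_addHaar volume MeasurableSet.univ.nullMeasurableSet
    (fun x hx => (hd x hx).hasFDerivWithinAt) hinj
  have himg : (fun x : ℝ => 2 * Real.arctan x) '' Set.univ = Set.Ioo (-Real.pi) Real.pi := by
    ext y
    simp only [Set.image_univ, Set.mem_range, Set.mem_Ioo]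
    constructor
    · rintro ⟨x, rfl⟩
      constructor <;> linarith [Real.neg_pi_div_two_lt_arctan x, Real.arctan_lt_pi_div_two x]
    · rintro ⟨h1, h2⟩
      refine ⟨Real.tan (y / 2), ?_⟩
      rw [Real.arctan_tan (by linarith) (by linarith)]
      ring
  rw [himg, Measure.restrict_univ] at h
  rw [← Measure.restrict_congr_set (Ioo_ae_eq_Ioc (μ := volume) (a := -Real.pi) (b := Real.pi)), ← h]
  congr 2
  ext x
  rw [ContinuousLinearMap.det_toSpanSingleton, abs_of_nonneg (by positivity)]

/-- Substituting `θ = 2 arctan x` turns the Cauchy density into normalized arc length on `(-π, π]`;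
the rotation by `π`, needed because `x = 0` corresponds to `-1`, preserves it. -/
lemma map_circleOfReal :
    Measure.map circleOfReal ((volume : Measure ℝ).withDensity fun x =>
      ENNReal.ofReal (1 / (Real.pi * (1 + x ^ 2)))) = arcMeas := by
  have h1 : ((volume : Measure ℝ).withDensity fun x => ENNReal.ofReal (1 / (Real.pi * (1 + x ^ 2)))) =
      ENNReal.ofReal (1 / (2 * Real.pi)) •
        (volume : Measure ℝ).withDensity fun x => ENNReal.ofReal (2 / (1 + x ^ 2)) := by
    rw [← withDensity_smul _ (by fun_prop)]
    congr 1
    ext x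
    rw [Pi.smul_apply, smul_eq_mul, ← ENNReal.ofReal_mul (by positivity)]
    congr 1
    field_simp
  have h2 : circleOfReal = (fun u => u * Circle.exp Real.pi) ∘ Circle.exp ∘
      fun x : ℝ => 2 * Real.arctan x := rfl
  have hm : Measurable fun u : Circle => u * Circle.exp Real.pi :=
    (by fun_prop : Continuous fun u : Circle => u * Circle.exp Real.pi).measurable
  have he : Measurable (Circle.exp : ℝ → Circle) := (by fun_prop : Continuous Circle.exp).measurable
  have ha : Measurable fun x : ℝ => 2 * Real.arctan x := by fun_prop
  rw [h1, h2, ← Measure.map_map hm (he.comp ha), ← Measure.map_map he ha, Measure.map_smul,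
    map_arctan_restrict, ← arcMeas, arcMeas_map_mul]

/-- Conformal invariance of harmonic measure, verified on densities; in the half plane the Cauchy
density is the Jacobian. -/
lemma mMeas_eq_map {s : RSetting} {a : ℂ} (ha : a ∈ s.dom) :
    s.mMeas a = (arcMeas.withDensity (poissonDensity (s.coord a))).map s.ofCircle := by
  have hcirc := (continuous_ofCircle s).measurable
  cases s with
  | disk =>
    have h1 : circlePt = disk.ofCircle ∘ Circle.exp := rfl
    have he : Measurable (Circle.exp : ℝ → Circle) := (by fun_prop : Continuous Circle.exp).measurable
    have hp : Measurable fun θ => poissonDensity a (Circle.exp θ) :=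
      (measurable_poissonDensity a).comp he
    rw [mMeas, coord_disk, h1, ← Measure.map_map hcirc he, arcMeas, Measure.map_smul,
      withDensity_smul_measure, withDensity_map _ he (measurable_poissonDensity a),
      ← Measure.map_smul, ← withDensity_smul _ hp]
    congr 3
    ext θ
    rw [Pi.smul_apply, smul_eq_mul, poissonDensity, ← ENNReal.ofReal_mul (by positivity),
      Circle.coe_exp]
    congr 1
    ring
  | halfPlane =>
    have ha' : 0 < a.im := ha
    have h1 : realPt = halfPlane.ofCircle ∘ circleOfReal := by
      ext x
      rw [Function.comp_apply, ofCircle_circleOfReal]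
    have hc := continuous_circleOfReal.measurable
    have hp : Measurable fun x => poissonDensity (halfPlane.coord a) (circleOfReal x) :=
      (measurable_poissonDensity _).comp hc
    have hq : Measurable fun x : ℝ => ENNReal.ofReal (1 / (Real.pi * (1 + x ^ 2))) := by fun_prop
    rw [mMeas, h1, ← Measure.map_map hcirc hc, ← map_circleOfReal,
      withDensity_map _ hc (measurable_poissonDensity _),
      ← withDensity_mul _ hq hp]
    congr 3
    ext x
    rw [Pi.mul_apply, poissonDensity, ← ENNReal.ofReal_mul (by positivity), coord_halfPlane ha',
      one_sub_norm_cayley_sq ha', coe_circleOfReal]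
    congr 1
    have h2 := add_I_ne_zero ha'.le
    have h3 : ((x : ℂ) + Complex.I) ≠ 0 := add_I_ne_zero (by simp)
    have h4 : ((x : ℂ) - Complex.I) / (x + Complex.I) - (a - Complex.I) / (a + Complex.I) =
        2 * Complex.I * (x - a) / ((x + Complex.I) * (a + Complex.I)) := by
      field_simp
      ring
    have h5 : ‖(x : ℂ) + Complex.I‖ ^ 2 = 1 + x ^ 2 := by
      rw [← Complex.normSq_eq_norm_sq, Complex.normSq_apply]
      simp
      ring
    have h6 : ((x : ℂ) - a) ≠ 0 := by
      intro h
      have := congrArg Complex.im h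
      simp at this
      linarith
    have h7 := norm_pos_iff.mpr h6
    have h8 := norm_pos_iff.mpr h2
    have h9 : (0 : ℝ) < 1 + x ^ 2 := by positivity
    rw [h4, norm_div, norm_mul, norm_mul, norm_mul, Complex.norm_I, div_pow, mul_pow, mul_pow, mul_pow, h5]
    have hπ := Real.pi_pos
    simp only [Complex.norm_ofNat, one_pow, mul_one]
    field_simp
    norm_num

/-- The measure `dμ^(n+1)` is the image of the Bernstein–Szegő measure on the circle. -/
lemma muN_succ_eq_map {s : RSetting} {α γ : ℕ → ℂ} (hα0 : α 0 = s.base) (hα : ∀ n, α n ∈ s.dom)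
    (hγ : ∀ n, ‖γ n‖ < 1) (n : ℕ) :
    s.muN α γ (n + 1) = (bsMeas (fun n => s.coord (α n)) γ n).map s.ofCircle := by
  set β := fun n => s.coord (α n) with hβdef
  have hβ : ∀ n, ‖β n‖ < 1 := fun n => norm_coord_lt_one (hα n)
  have hβ0 : β 0 = 0 := by simp only [hβdef, hα0, coord_base]
  obtain ⟨c, hc, horf⟩ := exists_orf_ofCircle γ hα0 hα
  have hcirc := (continuous_ofCircle s).measurable
  have hD : ∀ u : Circle, ENNReal.ofReal (1 / ‖s.orf α γ (n + 1) (s.ofCircle u : OnePoint ℂ)‖ ^ 2) =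
      ENNReal.ofReal (1 / ‖disk.orf β γ (n + 1) ((u : ℂ) : OnePoint ℂ)‖ ^ 2) := by
    intro u
    rw [horf, norm_mul, hc, one_mul]
  have hDm : Measurable fun u : Circle =>
      ENNReal.ofReal (1 / ‖disk.orf β γ (n + 1) ((u : ℂ) : OnePoint ℂ)‖ ^ 2) := by
    have := (continuous_orf_circle (γ := γ) hβ (n + 1)).measurable
    fun_prop
  have hDm' : Measurable fun t : s.bdry =>
      ENNReal.ofReal (1 / ‖s.orf α γ (n + 1) (t : OnePoint ℂ)‖ ^ 2) := by
    have h1 := hDm.comp s.bdryHomeo.symm.continuous.measurable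
    convert h1 using 1
    ext t
    obtain ⟨u, rfl⟩ := s.bdryHomeo.surjective t
    rw [Function.comp_apply, Homeomorph.symm_apply_apply, ← hD, bdryHomeo_apply]
  rw [muN, mMeas_eq_map (hα _), withDensity_map _ hcirc hDm',
    ← withDensity_mul _ (measurable_poissonDensity _) (by simpa only [hD] using hDm), bsMeas]
  congr 2
  ext u
  rw [Pi.mul_apply, hD, poissonDensity, ← ENNReal.ofReal_mul
    (div_nonneg (one_sub_norm_sq_pos (hβ (n + 1))).le (by positivity))]
  congr 1
  -- `|Φ_{n+1}|²` times the Bernstein–Szegő density is the Poisson kernel; as that kernel is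
  -- nonzero, so is `Φ_{n+1}`, and the division is legitimate.
  have h1 := norm_orf_succ_mul_re_wallF hβ0 hβ hγ n u
  have h2 := norm_one_sub_star_mul_sq (β (n + 1)) u
  rw [u.norm_coe, one_pow, sub_self, mul_zero, add_zero] at h2
  rw [Complex.star_def, Complex.mul_conj', re_wallF hβ, re_add_div_sub, ← Complex.star_def, h2,
    norm_mul, u.norm_coe, norm_star, norm_one, mul_one, one_pow] at h1
  norm_cast at h1
  have h3 : ‖(u : ℂ) - β (n + 1)‖ ≠ 0 := norm_ne_zero_iff.mpr (circle_sub_ne_zero (hβ _) u)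
  have h4 := (one_sub_norm_sq_pos (hβ (n + 1))).ne'
  have h5 : ‖disk.orf β γ (n + 1) ((u : ℂ) : OnePoint ℂ)‖ ≠ 0 := by
    intro h
    rw [h] at h1
    exact div_ne_zero h4 (pow_ne_zero 2 h3) (by simpa using h1.symm)
  change (1 - ‖β (n + 1)‖ ^ 2) / ‖(u : ℂ) - β (n + 1)‖ ^ 2 * _ = _
  rw [← h1]
  field_simp

/-! ### Weyl disks -/

/-- Transport of probability measures from the circle to the boundary. -/
noncomputable def ofCircleMeas (s : RSetting) (μ : ProbabilityMeasure Circle) :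
    ProbabilityMeasure s.bdry :=
  μ.map s.continuous_ofCircle.measurable.aemeasurable

lemma integral_map_ofCircle (s : RSetting) (μ : Measure Circle) (f : s.bdry → ℂ) :
    ∫ t, f t ∂(μ.map s.ofCircle) = ∫ u, f (s.ofCircle u) ∂μ :=
  s.bdryHomeo.measurableEmbedding.integral_map f

lemma integral_ofCircleMeas (s : RSetting) (μ : ProbabilityMeasure Circle) (f : s.bdry → ℂ) :
    ∫ t, f t ∂(s.ofCircleMeas μ : Measure s.bdry) = ∫ u, f (s.ofCircle u) ∂(μ : Measure Circle) :=
  integral_map_ofCircle s μ f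

lemma ofCircleMeas_surjective (s : RSetting) : Function.Surjective s.ofCircleMeas := by
  intro ν
  refine ⟨ν.map s.bdryHomeo.symm.continuous.measurable.aemeasurable, Subtype.ext ?_⟩
  change ((ν : Measure s.bdry).map s.bdryHomeo.symm).map s.ofCircle = ν
  rw [Measure.map_map s.continuous_ofCircle.measurable s.bdryHomeo.symm.continuous.measurable]
  have : s.ofCircle ∘ s.bdryHomeo.symm = id := by
    ext t
    exact congrArg Subtype.val (s.bdryHomeo.apply_symm_apply t)
  rw [this, Measure.map_id]

/-- The unimodular constants only multiply the integrals by `c_m conj c_n`, which affects neither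
zeros nor diagonal values. -/
lemma ofCircleMeas_mem_solutions {s : RSetting} {α γ : ℕ → ℂ} (hα0 : α 0 = s.base)
    (hα : ∀ n, α n ∈ s.dom) (μ : ProbabilityMeasure Circle) :
    s.ofCircleMeas μ ∈ s.solutions α γ ↔ μ ∈ circleSolutions (fun n => s.coord (α n)) γ := by
  obtain ⟨c, hc, horf⟩ := exists_orf_ofCircle γ hα0 hα
  refine forall_congr' fun m => forall_congr' fun n => ?_
  rw [integral_ofCircleMeas]
  have hcc : ∀ n, c n * star (c n) = 1 := fun n => by
    rw [Complex.star_def, Complex.mul_conj', hc]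
    simp
  have hne : ∀ n, c n ≠ 0 := fun n => left_ne_zero_of_mul_eq_one (hcc n)
  have h1 : ∫ u, s.orf α γ m (s.ofCircle u : OnePoint ℂ) * star (s.orf α γ n (s.ofCircle u : OnePoint ℂ))
      ∂(μ : Measure Circle) = c m * star (c n) *
      ∫ u : Circle, disk.orf (fun n => s.coord (α n)) γ m ((u : ℂ) : OnePoint ℂ) *
        star (disk.orf (fun n => s.coord (α n)) γ n ((u : ℂ) : OnePoint ℂ)) ∂(μ : Measure Circle) := by
    rw [← integral_const_mul]
    congr 1
    ext u
    rw [horf, horf, star_mul']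
    ring
  rw [h1]
  by_cases hmn : m = n
  · subst hmn
    rw [hcc, one_mul]
  · simp only [if_neg hmn, mul_eq_zero, hne m, star_ne_zero.mpr (hne n), false_or]

lemma cFun_map_ofCircle (s : RSetting) (μ : Measure Circle) (z : ℂ) :
    s.cFun (μ.map s.ofCircle) z = ∫ u : Circle, ((u : ℂ) + s.coord z) / (u - s.coord z) ∂μ := by
  rw [cFun, integral_map_ofCircle]
  simp only [kernelD_ofCircle]

/-- The Poisson kernel is at least `(1 - |x|²)/4` on the circle. Positivity keeps the Möbius map
from `F` to `f` away from its pole. -/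
lemma re_cFun_pos {s : RSetting} (ν : ProbabilityMeasure s.bdry) {z : ℂ} (hz : z ∈ s.dom) :
    0 < (s.cFun (ν : Measure s.bdry) z).re := by
  obtain ⟨μ, rfl⟩ := s.ofCircleMeas_surjective ν
  have hx := norm_coord_lt_one hz
  have hp := one_sub_norm_sq_pos hx
  have h1 : s.cFun (s.ofCircleMeas μ : Measure s.bdry) z = _ := cFun_map_ofCircle s μ z
  rw [h1]
  have hint := integrable_circle (μ : Measure Circle) (continuous_circle_kernel hx)
  have h2 := integral_re (𝕜 := ℂ) hint
  have h3 : ∫ _ : Circle, (1 - ‖s.coord z‖ ^ 2) / 4 ∂(μ : Measure Circle) ≤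
      ∫ u : Circle, RCLike.re (((u : ℂ) + s.coord z) / (u - s.coord z)) ∂(μ : Measure Circle) := by
    refine integral_mono (integrable_const _) hint.re fun u => ?_
    change _ ≤ (((u : ℂ) + s.coord z) / (u - s.coord z)).re
    have h4 : ‖(u : ℂ) - s.coord z‖ ≤ 2 :=
      (norm_sub_le _ _).trans (by rw [u.norm_coe]; linarith)
    have h5 : 0 < ‖(u : ℂ) - s.coord z‖ := norm_pos_iff.mpr fun h => by
      rw [← sub_eq_zero.mp h, u.norm_coe] at hx
      exact hx.false
    rw [re_add_div_sub, u.norm_coe, one_pow]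
    gcongr
    nlinarith
  rw [integral_const, probReal_univ, one_smul] at h3
  have h6 : (0 : ℝ) < (1 - ‖s.coord z‖ ^ 2) / 4 := by positivity
  exact h6.trans_le (h3.trans_eq h2)

lemma cFun_add_one_ne_zero {s : RSetting} (ν : ProbabilityMeasure s.bdry) {z : ℂ} (hz : z ∈ s.dom) :
    s.cFun (ν : Measure s.bdry) z + 1 ≠ 0 := by
  intro h
  have h1 := re_cFun_pos ν hz
  have h2 := congrArg Complex.re h
  simp at h2
  linarith

lemma coord_ne_zero {s : RSetting} {α : ℕ → ℂ} (hα0 : α 0 = s.base) {z : ℂ} (hz : z ∈ s.dom0 α) :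
    s.coord z ≠ 0 := by
  intro h
  rw [← s.coord_base] at h
  exact hz.2 ⟨0, by rw [hα0, s.coord_injOn hz.1 s.base_mem_dom h]⟩

/-- In the indeterminate case with `∑ |γ_n| < ∞`, the Weyl disk contains a disk of fixed radius about
`R_n / S_n`, for all large `n`. -/
theorem exists_ball_subset_weylS {s : RSetting} {α γ : ℕ → ℂ} (hα0 : α 0 = s.base)
    (hα : ∀ n, α n ∈ s.dom) (hγ : ∀ n, ‖γ n‖ < 1) (hind : s.Indeterminate α γ)
    (hsum : Summable fun n => ‖γ n‖) {z : ℂ} (hz : z ∈ s.dom0 α) :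
    ∃ δ > 0, ∃ N, ∀ n ≥ N,
      Metric.ball (s.wallR α γ n z / s.wallS α γ n z) δ ⊆ s.weylS α γ z := by
  set β := fun n => s.coord (α n) with hβdef
  have hβ : ∀ n, ‖β n‖ < 1 := fun n => norm_coord_lt_one (hα n)
  have hβ0 : β 0 = 0 := by simp only [hβdef, hα0, coord_base]
  have hx := norm_coord_lt_one hz.1
  have hx0 := coord_ne_zero hα0 hz
  have hxβ : ∀ n, s.coord z ≠ β n := fun n h =>
    hz.2 ⟨n, (s.coord_injOn hz.1 (hα n) h).symm⟩
  have hnt : (circleSolutions β γ).Nontrivial := by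
    obtain ⟨ν₁, h₁, ν₂, h₂, hne⟩ := hind
    obtain ⟨μ₁, rfl⟩ := s.ofCircleMeas_surjective ν₁
    obtain ⟨μ₂, rfl⟩ := s.ofCircleMeas_surjective ν₂
    exact ⟨μ₁, (ofCircleMeas_mem_solutions hα0 hα μ₁).mp h₁, μ₂,
      (ofCircleMeas_mem_solutions hα0 hα μ₂).mp h₂, fun h => hne (by rw [h])⟩
  obtain ⟨p, hp, hB⟩ := exists_le_norm_blaschkeProd_of_summable hβ
    (summable_of_circleSolutions hβ hnt) hx hxβ
  obtain ⟨δ, hδ, N, h⟩ := exists_ball_wall (s := disk) (α := β) hγ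
    (fun n => norm_zeta_disk_le_one (hβ n) hx.le) hsum hp hB
  refine ⟨δ, hδ, N, fun n hn v hv => ?_⟩
  rw [wallR, wallS, wall_eq_disk γ hα hz.1, mem_ball_iff_norm] at hv
  obtain ⟨μ, hμ, hval⟩ := exists_circleSolutions hβ0 hβ hγ hx n (h n hn v hv)
  refine ⟨s.ofCircleMeas μ, (ofCircleMeas_mem_solutions hα0 hα μ).mpr hμ, ?_⟩
  have hc : s.cFun (s.ofCircleMeas μ : Measure s.bdry) z = _ :=
    (cFun_map_ofCircle s μ z).trans hval
  have hne := cFun_add_one_ne_zero (s.ofCircleMeas μ) hz.1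
  change s.sFun (s.ofCircleMeas μ : Measure s.bdry) z = v
  rw [sFun, ← coord]
  rw [hc] at hne ⊢
  -- If this vanished, the quotient representing `F` would be `0` by the convention for division by
  -- zero, against `Re F > 0`.
  have h1 : 1 - s.coord z * v ≠ 0 := by
    intro h1
    have h2 := re_cFun_pos (s.ofCircleMeas μ) hz.1
    rw [hc, h1, div_zero] at h2
    exact h2.false
  have h3 : (1 + s.coord z * v) / (1 - s.coord z * v) - 1 =
      2 * (s.coord z * v) / (1 - s.coord z * v) := by
    field_simp
    ring
  have h4 : (1 + s.coord z * v) / (1 - s.coord z * v) + 1 = 2 / (1 - s.coord z * v) := by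
    field_simp
    ring
  rw [h3, h4]
  field_simp

/-- Some `R_n/S_n` with `n ≥ N` is within `δ` of the cluster point, whose neighbourhood in the Weyl
disk is then the `δ`-ball about `R_n/S_n`. -/
lemma interior_of_mapClusterPt {s : RSetting} {α γ : ℕ → ℂ} (hα0 : α 0 = s.base)
    (hα : ∀ n, α n ∈ s.dom) (hγ : ∀ n, ‖γ n‖ < 1) (hind : s.Indeterminate α γ)
    (hsum : Summable fun n => ‖γ n‖) {z : ℂ} (hz : z ∈ s.dom0 α) {w : ℂ}
    (hw : MapClusterPt w atTop fun n => s.wallR α γ n z / s.wallS α γ n z) :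
    w ∈ interior (s.weylS α γ z) := by
  obtain ⟨δ, hδ, N, h⟩ := exists_ball_subset_weylS hα0 hα hγ hind hsum hz
  obtain ⟨n, hn, hnw⟩ := frequently_atTop.mp
    (mapClusterPt_iff_frequently.mp hw _ (Metric.ball_mem_nhds w hδ)) N
  rw [mem_interior]
  exact ⟨_, h n hn, Metric.isOpen_ball, by rwa [Metric.mem_ball'] at hnw⟩

/-! ### Limit measures and N-extremality -/

lemma continuous_kernelD {s : RSetting} {z : ℂ} (hz : z ∈ s.dom) :
    Continuous fun t : s.bdry => s.kernelD (t : OnePoint ℂ) (z : OnePoint ℂ) := by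
  have h := (continuous_circle_kernel (norm_coord_lt_one hz)).comp s.bdryHomeo.symm.continuous
  convert h using 1
  ext t
  obtain ⟨u, rfl⟩ := s.bdryHomeo.surjective t
  rw [Function.comp_apply, Homeomorph.symm_apply_apply, ← kernelD_ofCircle, bdryHomeo_apply]

lemma tendsto_integral_of_forall_real {X ι : Type*} [TopologicalSpace X] [CompactSpace X]
    [MeasurableSpace X] [OpensMeasurableSpace X] {l : Filter ι} {m : ι → Measure X}
    [∀ i, IsFiniteMeasure (m i)] {ν : Measure X} [IsFiniteMeasure ν]
    (h : ∀ g : C(X, ℝ), Tendsto (fun i => ∫ t, g t ∂(m i)) l (𝓝 (∫ t, g t ∂ν))) {f : X → ℂ}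
    (hf : Continuous f) : Tendsto (fun i => ∫ t, f t ∂(m i)) l (𝓝 (∫ t, f t ∂ν)) := by
  have hint : ∀ (ρ : Measure X) [IsFiniteMeasure ρ], Integrable f ρ := fun ρ _ =>
    (BoundedContinuousFunction.mkOfCompact ⟨f, hf⟩).integrable ρ
  have heq : ∀ (ρ : Measure X) [IsFiniteMeasure ρ], ∫ t, f t ∂ρ =
      ((∫ t, (f t).re ∂ρ : ℝ) : ℂ) + ((∫ t, (f t).im ∂ρ : ℝ) : ℂ) * Complex.I := fun ρ _ =>
    (integral_re_add_im (hint ρ)).symm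
  simp only [heq]
  have h1 := h ⟨fun t => (f t).re, Complex.continuous_re.comp hf⟩
  have h2 := h ⟨fun t => (f t).im, Complex.continuous_im.comp hf⟩
  exact ((Complex.continuous_ofReal.tendsto _).comp h1).add
    (((Complex.continuous_ofReal.tendsto _).comp h2).mul_const _)

instance (s : RSetting) : CompactSpace s.bdry := s.bdryHomeo.compactSpace

lemma sFun_muN_succ {s : RSetting} {α γ : ℕ → ℂ} (hα0 : α 0 = s.base)
    (hα : ∀ n, α n ∈ s.dom) (hγ : ∀ n, ‖γ n‖ < 1) {z : ℂ} (hz : z ∈ s.dom0 α) (n : ℕ) :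
    s.sFun (s.muN α γ (n + 1)) z = s.wallR α γ n z / s.wallS α γ n z := by
  set β := fun n => s.coord (α n) with hβdef
  have hβ : ∀ n, ‖β n‖ < 1 := fun n => norm_coord_lt_one (hα n)
  have hx := norm_coord_lt_one hz.1
  have hx0 := coord_ne_zero hα0 hz
  have h1 := wall_norm_lt (s := disk) (α := β) (z := s.coord z) hγ
    (fun n => norm_zeta_disk_le_one (hβ n) hx.le) n
  have hS : (disk.wall β γ (s.coord z) n).S ≠ 0 := norm_pos_iff.mp ((norm_nonneg _).trans_lt h1)
  have hd := wallDen_ne_zero hβ hγ n hx.le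
  rw [sFun, muN_succ_eq_map hα0 hα hγ, cFun_map_ofCircle, integral_kernel_bsMeas hβ hγ n hx, ← coord,
    wallR, wallS, wall_eq_disk γ hα hz.1, wallF, ← hβdef]
  have h3 : ((disk.wall β γ (s.coord z) n).S + s.coord z * (disk.wall β γ (s.coord z) n).R) /
      wallDen β γ n (s.coord z) - 1 =
      2 * (s.coord z * (disk.wall β γ (s.coord z) n).R) / wallDen β γ n (s.coord z) := by
    rw [div_sub_one hd]
    congr 1
    rw [wallDen]
    ring
  have h4 : ((disk.wall β γ (s.coord z) n).S + s.coord z * (disk.wall β γ (s.coord z) n).R) /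
      wallDen β γ n (s.coord z) + 1 =
      2 * (disk.wall β γ (s.coord z) n).S / wallDen β γ n (s.coord z) := by
    rw [div_add_one hd]
    congr 1
    rw [wallDen]
    ring
  rw [h3, h4]
  field_simp

lemma tendsto_sFun {s : RSetting} {ν : ProbabilityMeasure s.bdry}
    {z : ℂ} (hz : z ∈ s.dom) {ι : Type*} {l : Filter ι} {m : ι → Measure s.bdry}
    (h : Tendsto (fun i => s.cFun (m i) z) l (𝓝 (s.cFun (ν : Measure s.bdry) z))) :
    Tendsto (fun i => s.sFun (m i) z) l (𝓝 (s.sFun (ν : Measure s.bdry) z)) :=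
  ((h.sub_const 1).div (h.add_const 1) (cFun_add_one_ne_zero ν hz)).const_mul _

/-- The Schur values in the interior of the Weyl disk correspond to Carathéodory values in the
interior. -/
lemma cFun_mem_interior {s : RSetting} {α γ : ℕ → ℂ} (hα0 : α 0 = s.base)
    {ν : ProbabilityMeasure s.bdry} {z : ℂ} (hz : z ∈ s.dom0 α)
    (h : s.sFun (ν : Measure s.bdry) z ∈ interior (s.weylS α γ z)) :
    s.cFun (ν : Measure s.bdry) z ∈ interior (s.weylC α γ z) := by
  have hx0 : s.zeta s.base (z : OnePoint ℂ) ≠ 0 := coord_ne_zero hα0 hz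
  have hne := cFun_add_one_ne_zero ν hz.1
  have hc : ContinuousAt (fun w : ℂ => 1 / s.zeta s.base (z : OnePoint ℂ) * ((w - 1) / (w + 1)))
      (s.cFun (ν : Measure s.bdry) z) := by
    fun_prop (disch := exact hne)
  rw [mem_interior_iff_mem_nhds] at h ⊢
  -- Nearby `w` map to attained Schur values, and injectivity of the Möbius map off its pole `-1`
  -- identifies `w` with the corresponding `F`.
  filter_upwards [hc.preimage_mem_nhds h, (isOpen_ne.mem_nhds (show s.cFun (ν : Measure s.bdry) z ≠ -1
    from fun h => hne (by rw [h]; ring)))] with w hw hw1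
  obtain ⟨μ, hμ, hμw⟩ := hw
  refine ⟨μ, hμ, ?_⟩
  have h1 := cFun_add_one_ne_zero μ hz.1
  have h2 : w + 1 ≠ 0 := fun h => hw1 (eq_neg_of_add_eq_zero_left h)
  have h3 := mul_left_cancel₀ (one_div_ne_zero hx0) hμw
  rw [div_eq_div_iff h1 h2] at h3
  have h4 : 2 * s.cFun (μ : Measure s.bdry) z = 2 * w := by linear_combination h3
  exact mul_left_cancel₀ two_ne_zero h4

/-- Weak convergence tested on the kernel makes `f(z; ν)` a cluster point of `R_n/S_n`, so `F(z; ν)`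
is interior and cannot lie on the frontier. -/
lemma not_NExtremal_of_isLimitMeasure {s : RSetting} {α γ : ℕ → ℂ} (hα0 : α 0 = s.base)
    (hα : ∀ n, α n ∈ s.dom) (hγ : ∀ n, ‖γ n‖ < 1) (hind : s.Indeterminate α γ)
    (hsum : Summable fun n => ‖γ n‖) {ν : ProbabilityMeasure s.bdry}
    (hν : s.IsLimitMeasure (s.muN α γ) ν) : ¬ s.NExtremal α γ ν := by
  rintro ⟨-, z, hz, hfr⟩
  obtain ⟨φ, hφ, hlim⟩ := hν
  refine hfr.2 (cFun_mem_interior hα0 hz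
    (interior_of_mapClusterPt hα0 hα hγ hind hsum hz ?_))
  -- `dμ^(n+1)` belongs to `R_n/S_n`, so index `0` must be avoided; dropping the first term of the
  -- subsequence makes every index positive.
  obtain ⟨ψ, hψ⟩ : ∃ ψ : ℕ → ℕ, ∀ k, φ (k + 1) = ψ k + 1 := by
    refine ⟨fun k => φ (k + 1) - 1, fun k => (Nat.succ_pred ?_).symm⟩
    exact (hφ k.succ_pos).ne_bot
  have hprob : ∀ k, IsFiniteMeasure (s.muN α γ (ψ k + 1)) := fun k => by
    have := isProbabilityMeasure_bsMeas (γ := γ) (fun n => norm_coord_lt_one (hα n)) hγ (ψ k)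
    rw [muN_succ_eq_map hα0 hα hγ]
    infer_instance
  have h1 : Tendsto (fun k => s.cFun (s.muN α γ (ψ k + 1)) z) atTop
      (𝓝 (s.cFun (ν : Measure s.bdry) z)) := by
    refine tendsto_integral_of_forall_real (fun g => ?_) (continuous_kernelD hz.1)
    simpa only [hψ] using (tendsto_add_atTop_iff_nat 1).mpr (hlim g)
  have h2 := tendsto_sFun hz.1 h1
  simp only [sFun_muN_succ hα0 hα hγ hz] at h2
  have h3 : Tendsto ψ atTop atTop :=
    tendsto_atTop_mono (fun k => Nat.le_of_succ_le_succ ((hφ.id_le (k + 1)).trans_eq (hψ k))) tendsto_id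
  exact h2.mapClusterPt.of_comp h3

end RSetting

theorem propositionN1 (s : RSetting) (α γ : ℕ → ℂ)
    (hα0 : α 0 = s.base) (hα : ∀ n, α n ∈ s.dom)
    (hγ : ∀ n, ‖γ n‖ < 1)
    (hind : s.Indeterminate α γ)
    (hsum : Summable fun n => ‖γ n‖) :
    (∀ z ∈ s.dom0 α, ∀ w : ℂ,
      MapClusterPt w atTop (fun n => s.wallR α γ n z / s.wallS α γ n z) →
        w ∈ interior (s.weylS α γ z)) ∧
    (∀ ν : ProbabilityMeasure s.bdry,
      s.IsLimitMeasure (s.muN α γ) ν → ¬ s.NExtremal α γ ν) := by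
  exact ⟨fun z hz w hw => RSetting.interior_of_mapClusterPt hα0 hα hγ hind hsum hz hw,
    fun ν hν => RSetting.not_NExtremal_of_isLimitMeasure hα0 hα hγ hind hsum hν⟩
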